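/- **Conventions.** "Space" means compactly generated space (no separation axiom is imposed), with products and mapping spaces formed in that category. Fix a real inner product space $\mathcal U$ of countably infinite dimension and an integer $n\ge 0$. All categories below have as objects the finite-dimensional subspaces $U,V,W,\dots$ of $\mathcal U$. *The categories.* $\mathcal I$ is the topological category with morphism spaces $\mathcal I(V,W)_+$, where $\mathcal I(V,W)$ is the space of linear isometric isomorphisms $V\to W$. Let $\gamma_n(V,W)$ be the space of pairs $(f,x)$ with $f:V\to W$ a linear isometry and $x\in\mathbb R^n\otimes(W-f(V))$, where $W-f(V)$ is the orthogonal complement of $f(V)$; it is a vector bundle over the compact space of linear isometries $V\to W$. The jet category $\mathcal J_n$ has as morphism space $\mathcal J_n(V,W)$ the Thom space of $\gamma_n(V,W)$. Its composition is induced by $(f,x)(g,y)=(fg,\,x+(\mathrm{id}\otimes f)y)$, and $O(n)$ acts on its morphism spaces by $\sigma(f,x)=(f,(\sigma\otimes\mathrm{id})x)$. *The categories of spaces.* $\mathcal E_n$ is the category of $\mathcal J_n$-spaces (functors from $\mathcal J_n$ to based spaces, enriched over based spaces). $O(n)\mathcal E_n$ is the category of $O(n)$-equivariant $\mathcal J_n$-spaces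 (functors to based $O(n)$-spaces, enriched over based $O(n)$-spaces) and levelwise equivariant natural maps. $\mathcal I$-spaces and $O(n)$-equivariant $\mathcal I$-spaces are defined in the same way, with $O(n)$ acting trivially on $\mathcal I$. They carry the smash product $$(X\wedge Y)(V)=\int^{A,B}\mathcal I(A\oplus B,V)_+\wedge X(A)\wedge Y(B),$$ with diagonal $O(n)$-action in the equivariant case. *The monoid.* $nS$ is the $\mathcal I$-space $nS(V)=S^{\mathbb R^n\otimes V}$ (one-point compactification), on which $f$ acts by $\mathrm{id}\otimes f$ and $O(n)$ acts through $\mathbb R^n$. It is a commutative monoid for $\wedge$, in $\mathcal I$-spaces and in $O(n)$-equivariant $\mathcal I$-spaces: its unit is given by the points $0\in S^{\mathbb R^n\otimes V}$, and its multiplication is induced by the maps $$\mathcal I(A\oplus B,V)_+\wedge S^{\mathbb R^n\otimes A}\wedge S^{\mathbb R^n\otimes B}\cong\mathcal I(A\oplus B,V)_+\wedge S^{\mathbb R^n\otimes(A\oplus B)}\to S^{\mathbb R^n\otimes V}.$$ An $nS$-module is an ($O(n)$-equivariant) $\mathcal I$-space $X$ with a unital associative (equivariant) action $X\wedge nS\to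 X$. *The diagram category.* Write $U^*=\mathcal I(U,-)_+$, and for $nS$-modules $M,N$ in $\mathcal I$-spaces let $nS\text{-mod}(M,N)$ be the based space of $nS$-module maps $M\to N$. Let $\mathscr J_n$ be the topological category with $$\mathscr J_n(U,V)=nS\text{-mod}(V^*\wedge nS,\;U^*\wedge nS)$$ and with composition $\beta\alpha$ given by the composite of module maps "first $\beta$, then $\alpha$". The group $O(n)$ acts on these spaces by conjugation. **Proposition.** For each $n\ge0$: 1. There is an isomorphism of $O(n)$-topological categories $\Phi:\mathcal J_n\cong\mathscr J_n$ that is the identity on objects: it consists of based $O(n)$-equivariant homeomorphisms on morphism spaces, compatible with identities and composition. It is the following one. For every linear isometric isomorphism $h:U\oplus A\to V$ and every $x\in\mathbb R^n\otimes A$, the module map $\Phi\bigl(h|_U,(\mathrm{id}\otimes h|_A)x\bigr):V^*\wedge nS\to U^*\wedge nS$ sends the canonical generator of $V^*\wedge nS$ at $V$ (the identity of $V$ smashed with the unit of $nS$) to the class $[h;\mathrm{id}_U,x]\in(U^*\wedge nS)(V)$. 2. The category $\mathcal E_n$ is equivalent to the category of $nS$-modules in $\mathcal I$-spaces. The equivalence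 can be chosen to come from $\Phi$: the $\mathcal J_n$-space corresponding to a module $M$ is, up to based homeomorphisms natural in $M$, $U\mapsto nS\text{-mod}(U^*\wedge nS,M)$, with $\alpha\in\mathcal J_n(U,V)$ acting by precomposition with $\Phi(\alpha)$. 3. The category $O(n)\mathcal E_n$ is equivalent to the category of $nS$-modules in $O(n)$-equivariant $\mathcal I$-spaces. The equivalence can be chosen to come from $\Phi$ in the same way: the equivariant $\mathcal J_n$-space corresponding to $M$ is, up to based $O(n)$-equivariant homeomorphisms natural in $M$, $U\mapsto nS\text{-mod}(U^*\wedge nS,M)$, where the mapping space is that of nonequivariant module maps with the conjugation action. -/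

import Mathlib

open CategoryTheory Topology
open scoped TensorProduct

universe u v w

namespace OrthCalc

section CompactlyGenerated

theorem continuous_to_compactlyGenerated {X : Type v} [t : TopologicalSpace X] (S : CompHaus.{u})
    (g : C(S, X)) : Continuous[_, TopologicalSpace.compactlyGenerated.{u} X] g := by
  rw [continuous_def]
  intro U hU
  have hU' : IsOpen[TopologicalSpace.coinduced
    (fun (x : (i : (S : CompHaus.{u}) × C(S, X)) × i.fst) => x.1.2 x.2) inferInstance] U := hU
  rw [isOpen_coinduced, isOpen_sigma_iff] at hU'
  exact hU' ⟨S, g⟩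

theorem cg_compactlyGenerated {X : Type v} [t : TopologicalSpace X] :
    @UCompactlyGeneratedSpace.{u} X (TopologicalSpace.compactlyGenerated.{u} X) := by
  refine @uCompactlyGeneratedSpace_of_continuous_maps X (TopologicalSpace.compactlyGenerated.{u} X)
    fun {Y} tY f h => ?_
  exact @continuous_from_compactlyGenerated X Y t tY f fun S g =>
    h S (@ContinuousMap.mk S X _ (TopologicalSpace.compactlyGenerated.{u} X) g
      (continuous_to_compactlyGenerated S g))

theorem cg_compHaus (S : CompHaus.{u}) : UCompactlyGeneratedSpace.{u} S :=
  uCompactlyGeneratedSpace_of_continuous_maps fun _ h => h S (ContinuousMap.id S)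

/-- The product in the category of compactly generated spaces: the product set with the compactly
generated topology associated with the product topology. -/
def KProd (Y : Type v) (Z : Type u) : Type (max v u) := Y × Z

namespace KProd

variable {Y : Type v} {Z : Type u} {T : Type w}

/-- The pair `(y, z)`. -/
def mk (y : Y) (z : Z) : KProd Y Z := (y, z)

variable [TopologicalSpace Y] [TopologicalSpace Z] [TopologicalSpace T]

instance : TopologicalSpace (KProd Y Z) := TopologicalSpace.compactlyGenerated.{u} (Y × Z)

theorem continuous_dom {f : KProd Y Z → T} :
    Continuous f ↔ ∀ (S : CompHaus.{u}) (a : C(S, Y)) (b : C(S, Z)),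
      Continuous fun s => f (mk (a s) (b s)) := by
  constructor
  · intro hf S a b
    exact hf.comp (continuous_to_compactlyGenerated S (a.prodMk b))
  · intro h
    exact continuous_from_compactlyGenerated (X := Y × Z) f
      (fun S g => h S (ContinuousMap.fst.comp g) (ContinuousMap.snd.comp g))

theorem continuous_fst : Continuous (fun p : KProd Y Z => p.1) :=
  continuous_dom.2 fun _ a _ => a.continuous

theorem continuous_snd : Continuous (fun p : KProd Y Z => p.2) :=
  continuous_dom.2 fun _ _ b => b.continuous

theorem continuous_of_prod {f : Y × Z → T} (hf : Continuous f) :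
    Continuous (fun p : KProd Y Z => f (p.1, p.2)) :=
  continuous_dom.2 fun _ a b => hf.comp (a.continuous.prodMk b.continuous)

instance : UCompactlyGeneratedSpace.{u} (KProd Y Z) :=
  cg_compactlyGenerated (X := Y × Z)

theorem continuous_mk {A : Type*} [TopologicalSpace A] [UCompactlyGeneratedSpace.{u} A]
    {f : A → Y} {g : A → Z} (hf : Continuous f) (hg : Continuous g) :
    Continuous fun a => mk (f a) (g a) :=
  continuous_from_uCompactlyGeneratedSpace _ fun S k =>
    continuous_dom.1 continuous_id S ⟨_, hf.comp k.continuous⟩ ⟨_, hg.comp k.continuous⟩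

end KProd

/-- The set of maps `Y → Z` that are continuous on all compact Hausdorff test spaces; these are the
continuous maps when `Y` is compactly generated. It carries the coarsest topology for which
precomposition with any compact Hausdorff test space is continuous for the compact-open topology. -/
abbrev KMap.{a, b, c} (Y : Type b) (Z : Type c) [TopologicalSpace Y] [TopologicalSpace Z] :
    Type (max b c) :=
  ContinuousMapGeneratedBy (fun S : CompHaus.{a} => (S : Type a)) Y Z

theorem continuous_diag {S : Type u} {T : Type w} [TopologicalSpace S] [TopologicalSpace T]
    [CompactSpace S] [T2Space S]
    {φ : S → C(S, T)} (h : Continuous φ) : Continuous fun s => φ s s :=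
  (ContinuousMap.continuous_uncurry_of_continuous ⟨_, h⟩).comp (continuous_id.prodMk continuous_id)

variable {Y : Type v} {T : Type w} [TopologicalSpace Y] [TopologicalSpace T]

theorem KMap.continuous_iff {A : Type*} [TopologicalSpace A] [UCompactlyGeneratedSpace.{u} A]
    {φ : A → KMap.{u} Y T} : Continuous φ ↔
      ∀ (S : CompHaus.{u}) (a : C(S, A)) (b : C(S, Y)), Continuous fun s => φ (a s) (b s) := by
  constructor
  · intro h S a b
    have h1 : Continuous fun s => (ContinuousMapGeneratedBy.precomp
        (X := fun S : CompHaus.{u} => (S : Type u)) b (φ (a s)) : C(S, T)) :=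
      (ContinuousMapGeneratedBy.continuous_iff.1 h S b).comp a.continuous
    exact continuous_diag h1
  · intro h
    rw [ContinuousMapGeneratedBy.continuous_iff]
    intro S f
    refine continuous_from_uCompactlyGeneratedSpace _ fun S' k => ?_
    have h2 : Continuous fun p : S' × S => φ (k p.1) (f p.2) :=
      h (CompHaus.of (S' × S)) ⟨fun p => k p.1, by fun_prop⟩ ⟨fun p => f p.2, by fun_prop⟩
    exact (ContinuousMap.curry ⟨_, h2⟩).continuous

theorem KProd.continuous_quot_right {Z : Type u} [TopologicalSpace Z]
    [UCompactlyGeneratedSpace.{u} Z] {r : Z → Z → Prop} {F : KProd Y (Quot r) → T}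
    (h : Continuous fun p : KProd Y Z => F (mk p.1 (Quot.mk r p.2))) : Continuous F := by
  have hZ := KProd.continuous_dom.1 h
  let φ : Quot r → KMap.{u} Y T := fun q => ⟨fun y => F (mk y q), fun S f => by
    obtain ⟨z, rfl⟩ := Quot.exists_rep q
    exact hZ S f (ContinuousMap.const S z)⟩
  have : UCompactlyGeneratedSpace.{u} (Quot r) :=
    uCompactlyGeneratedSpace_of_coinduced continuous_quot_mk rfl
  have hφ : Continuous φ := isQuotientMap_quot_mk.continuous_iff.2
    (KMap.continuous_iff.2 fun S a b => hZ S b a)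
  exact KProd.continuous_dom.2 fun S a b => KMap.continuous_iff.1 hφ S b a

theorem KProd.continuous_sigma_right {ι : Type u} {Z : ι → Type u} [∀ i, TopologicalSpace (Z i)]
    [∀ i, UCompactlyGeneratedSpace.{u} (Z i)] {F : KProd Y (Σ i, Z i) → T}
    (h : ∀ i, Continuous fun p : KProd Y (Z i) => F (mk p.1 ⟨i, p.2⟩)) : Continuous F := by
  have hZ := fun i => KProd.continuous_dom.1 (h i)
  let φ : (Σ i, Z i) → KMap.{u} Y T := fun q => ⟨fun y => F (mk y q), fun S f =>
    hZ q.1 S f (ContinuousMap.const S q.2)⟩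
  have hφ : Continuous φ := continuous_sigma fun i =>
    (KMap.continuous_iff.2 fun S a b => hZ i S b a)
  exact KProd.continuous_dom.2 fun S a b => KMap.continuous_iff.1 hφ S b a

theorem KProd.continuous_sum_left {A B Z : Type u} [TopologicalSpace A] [TopologicalSpace B]
    [TopologicalSpace Z] [UCompactlyGeneratedSpace.{u} A] [UCompactlyGeneratedSpace.{u} B]
    {F : KProd (A ⊕ B) Z → T}
    (h₁ : Continuous fun p : KProd A Z => F (mk (Sum.inl p.1) p.2))
    (h₂ : Continuous fun p : KProd B Z => F (mk (Sum.inr p.1) p.2)) : Continuous F := by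
  have h₁' := KProd.continuous_dom.1 h₁
  have h₂' := KProd.continuous_dom.1 h₂
  let φ : A ⊕ B → KMap.{u} Z T := fun q => ⟨fun z => F (mk q z), fun S f => by
    cases q with
    | inl a => exact h₁' S (ContinuousMap.const S a) f
    | inr b => exact h₂' S (ContinuousMap.const S b) f⟩
  have hφ : Continuous φ := continuous_sum_dom.2
    ⟨KMap.continuous_iff.2 h₁', KMap.continuous_iff.2 h₂'⟩
  exact KProd.continuous_dom.2 fun S a b => KMap.continuous_iff.1 hφ S a b

end CompactlyGenerated

/-- A based compactly generated topological space. -/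
structure BasedSpace : Type (u + 1) where
  carrier : Type u
  [top : TopologicalSpace carrier]
  [cg : CompactlyGeneratedSpace carrier]
  pt : carrier

namespace BasedSpace

instance : CoeSort BasedSpace.{u} (Type u) := ⟨carrier⟩
instance (X : BasedSpace.{u}) : TopologicalSpace X := X.top
instance (X : BasedSpace.{u}) : UCompactlyGeneratedSpace.{u} X := X.cg

end BasedSpace

/-- A topological category with object set `Obj`: a category enriched in based spaces (with the
smash product). -/
structure TopCategory (Obj : Type u) where
  Hom : Obj → Obj → BasedSpace.{u}
  one (U : Obj) : Hom U U
  comp {U V W : Obj} : Hom V W → Hom U V → Hom U W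
  continuous_comp (U V W : Obj) :
    Continuous fun p : KProd (Hom V W) (Hom U V) => comp p.1 p.2
  comp_pt {U V W : Obj} (β : Hom V W) : comp β (Hom U V).pt = (Hom U W).pt
  pt_comp {U V W : Obj} (α : Hom U V) : comp (Hom V W).pt α = (Hom U W).pt
  one_comp {U V : Obj} (α : Hom U V) : comp (one V) α = α
  comp_one {U V : Obj} (α : Hom U V) : comp α (one U) = α
  comp_assoc {U V W X : Obj} (γ : Hom W X) (β : Hom V W) (α : Hom U V) :
    comp (comp γ β) α = comp γ (comp β α)

/-- A `G`-topological category: a category enriched in based `G`-spaces. -/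
structure GTopCategory (G : Type) [Group G] [TopologicalSpace G] (Obj : Type u) extends
    TopCategory Obj where
  smul {U V : Obj} : G → Hom U V → Hom U V
  continuous_smul (U V : Obj) : Continuous fun p : KProd G (Hom U V) => smul p.1 p.2
  one_smul {U V : Obj} (α : Hom U V) : smul 1 α = α
  mul_smul {U V : Obj} (g h : G) (α : Hom U V) : smul (g * h) α = smul g (smul h α)
  smul_pt {U V : Obj} (g : G) : smul g (Hom U V).pt = (Hom U V).pt
  smul_one (U : Obj) (g : G) : smul g (one U) = one U
  smul_comp {U V W : Obj} (g : G) (β : Hom V W) (α : Hom U V) :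
    smul g (comp β α) = comp (smul g β) (smul g α)

/-- An isomorphism of `G`-topological categories that is the identity on objects. -/
structure GTopCategory.Iso {G : Type} [Group G] [TopologicalSpace G] {Obj : Type u}
    (D D' : GTopCategory G Obj) where
  homeo (U V : Obj) : D.Hom U V ≃ₜ D'.Hom U V
  map_pt (U V : Obj) : homeo U V (D.Hom U V).pt = (D'.Hom U V).pt
  map_one (U : Obj) : homeo U U (D.one U) = D'.one U
  map_comp {U V W : Obj} (β : D.Hom V W) (α : D.Hom U V) :
    homeo U W (D.comp β α) = D'.comp (homeo V W β) (homeo U V α)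
  map_smul {U V : Obj} (g : G) (α : D.Hom U V) :
    homeo U V (D.smul g α) = D'.smul g (homeo U V α)

/-- A `D`-space: a functor from `D` to based spaces, enriched over based spaces. The enrichment is
expressed by the maps `D(U, V) ∧ E(U) → E(V)`. -/
structure DSpace {Obj : Type u} (D : TopCategory Obj) where
  obj : Obj → BasedSpace.{u}
  map {U V : Obj} : D.Hom U V → obj U → obj V
  continuous_map (U V : Obj) : Continuous fun p : KProd (D.Hom U V) (obj U) => map p.1 p.2
  map_pt {U V : Obj} (α : D.Hom U V) : map α (obj U).pt = (obj V).pt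
  pt_map {U V : Obj} (x : obj U) : map (D.Hom U V).pt x = (obj V).pt
  map_one {U : Obj} (x : obj U) : map (D.one U) x = x
  map_comp {U V W : Obj} (β : D.Hom V W) (α : D.Hom U V) (x : obj U) :
    map (D.comp β α) x = map β (map α x)

namespace DSpace

variable {Obj : Type u} {D : TopCategory Obj}

/-- A map of `D`-spaces. -/
@[ext]
structure Hom (E F : DSpace D) where
  app (U : Obj) : E.obj U → F.obj U
  continuous_app (U : Obj) : Continuous (app U)
  app_pt (U : Obj) : app U (E.obj U).pt = (F.obj U).pt
  naturality {U V : Obj} (α : D.Hom U V) (x : E.obj U) :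
    app V (E.map α x) = F.map α (app U x)

instance : Category (DSpace D) where
  Hom := Hom
  id E := ⟨fun _ x => x, fun _ => continuous_id, fun _ => rfl, fun _ _ => rfl⟩
  comp f g := ⟨fun U x => g.app U (f.app U x),
    fun U => (g.continuous_app U).comp (f.continuous_app U),
    fun U => by rw [f.app_pt, g.app_pt], fun α x => by rw [f.naturality, g.naturality]⟩

@[simp] theorem id_app (E : DSpace D) (U : Obj) (x : E.obj U) : Hom.app (𝟙 E) U x = x := rfl
@[simp] theorem comp_app {E F H : DSpace D} (f : E ⟶ F) (g : F ⟶ H) (U : Obj) (x : E.obj U) :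
    Hom.app (f ≫ g) U x = g.app U (f.app U x) := rfl

theorem hom_ext {E F : DSpace D} {f g : E ⟶ F} (h : ∀ U x, f.app U x = g.app U x) : f = g :=
  Hom.ext (funext fun U => funext fun x => h U x)

/-- The represented `D`-space `U^* = D(U, -)`. -/
def repr (D : TopCategory Obj) (U : Obj) : DSpace D where
  obj V := D.Hom U V
  map β α := D.comp β α
  continuous_map V W := D.continuous_comp U V W
  map_pt β := D.comp_pt β
  pt_map α := D.pt_comp α
  map_one α := D.one_comp α
  map_comp γ β α := D.comp_assoc γ β α

end DSpace

/-- A `G`-equivariant `D`-space: a functor from `D` to based `G`-spaces, enriched over based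
`G`-spaces. Here `smul_map` says that `D(U, V) → Top(E(U), E(V))` is equivariant for the
conjugation action on the target. -/
structure GDSpace {G : Type} [Group G] [TopologicalSpace G] {Obj : Type u}
    (D : GTopCategory G Obj) extends DSpace D.toTopCategory where
  smul {U : Obj} : G → obj U → obj U
  continuous_smul (U : Obj) : Continuous fun p : KProd G (obj U) => smul p.1 p.2
  one_smul {U : Obj} (x : obj U) : smul 1 x = x
  mul_smul {U : Obj} (g h : G) (x : obj U) : smul (g * h) x = smul g (smul h x)
  smul_pt (U : Obj) (g : G) : smul g (obj U).pt = (obj U).pt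
  smul_map {U V : Obj} (g : G) (α : D.Hom U V) (x : obj U) :
    smul g (map α x) = map (D.smul g α) (smul g x)

namespace GDSpace

variable {G : Type} [Group G] [TopologicalSpace G] {Obj : Type u} {D : GTopCategory G Obj}

/-- A map of `G`-equivariant `D`-spaces. -/
@[ext]
structure Hom (E F : GDSpace D) where
  toHom : E.toDSpace ⟶ F.toDSpace
  map_smul (U : Obj) (g : G) (x : E.obj U) :
    toHom.app U (E.smul g x) = F.smul g (toHom.app U x)

instance : Category (GDSpace D) where
  Hom := Hom
  id E := ⟨𝟙 E.toDSpace, fun _ _ _ => rfl⟩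
  comp f g := ⟨f.toHom ≫ g.toHom, fun U k x => by simp [f.map_smul, g.map_smul]⟩

@[simp] theorem id_toHom (E : GDSpace D) : Hom.toHom (𝟙 E) = 𝟙 E.toDSpace := rfl
@[simp] theorem comp_toHom {E F H : GDSpace D} (f : E ⟶ F) (g : F ⟶ H) :
    Hom.toHom (f ≫ g) = f.toHom ≫ g.toHom := rfl

theorem hom_ext {E F : GDSpace D} {f g : E ⟶ F} (h : f.toHom = g.toHom) : f = g := Hom.ext h

end GDSpace

section Isometries

variable {V W : Type*} [NormedAddCommGroup V] [InnerProductSpace ℝ V]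
  [NormedAddCommGroup W] [InnerProductSpace ℝ W]

/-- The topology of the operator norm on linear isometries. -/
noncomputable instance : TopologicalSpace (V →ₗᵢ[ℝ] W) :=
  TopologicalSpace.induced LinearIsometry.toContinuousLinearMap inferInstance

/-- The topology of the operator norm on linear isometric isomorphisms. -/
noncomputable instance : TopologicalSpace (V ≃ₗᵢ[ℝ] W) :=
  TopologicalSpace.induced LinearIsometryEquiv.toLinearIsometry inferInstance

variable {T : Type*} [TopologicalSpace T]

theorem continuous_li_iff [FiniteDimensional ℝ V] {F : T → (V →ₗᵢ[ℝ] W)} :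
    Continuous F ↔ ∀ v, Continuous fun t => F t v :=
  continuous_induced_rng.trans (continuous_clm_apply (𝕜 := ℝ))

theorem continuous_lie_iff [FiniteDimensional ℝ V] {F : T → (V ≃ₗᵢ[ℝ] W)} :
    Continuous F ↔ ∀ v, Continuous fun t => F t v :=
  continuous_induced_rng.trans continuous_li_iff

theorem continuous_toCLM :
    Continuous (LinearIsometry.toContinuousLinearMap : (V →ₗᵢ[ℝ] W) → (V →L[ℝ] W)) :=
  continuous_induced_dom

theorem continuous_toLI :
    Continuous (LinearIsometryEquiv.toLinearIsometry : (V ≃ₗᵢ[ℝ] W) → (V →ₗᵢ[ℝ] W)) :=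
  continuous_induced_dom

theorem continuous_li_eval : Continuous fun p : (V →ₗᵢ[ℝ] W) × V => p.1 p.2 :=
  Continuous.clm_apply (f := fun p : (V →ₗᵢ[ℝ] W) × V => p.1.toContinuousLinearMap)
    (continuous_toCLM.comp continuous_fst) continuous_snd

theorem continuous_lie_eval : Continuous fun p : (V ≃ₗᵢ[ℝ] W) × V => p.1 p.2 :=
  continuous_li_eval.comp ((continuous_toLI.comp continuous_fst).prodMk continuous_snd)

theorem _root_.Continuous.lie_trans {U : Type*} [NormedAddCommGroup U] [InnerProductSpace ℝ U]
    [FiniteDimensional ℝ U] {f : T → (U ≃ₗᵢ[ℝ] V)} {g : T → (V ≃ₗᵢ[ℝ] W)} (hf : Continuous f)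
    (hg : Continuous g) : Continuous fun t => (f t).trans (g t) :=
  continuous_lie_iff.2 fun _ => continuous_lie_eval.comp
    (hg.prodMk (continuous_lie_eval.comp (hf.prodMk continuous_const)))

theorem isClosedEmbedding_li [FiniteDimensional ℝ V] :
    IsClosedEmbedding (LinearIsometry.toContinuousLinearMap : (V →ₗᵢ[ℝ] W) → (V →L[ℝ] W)) where
  eq_induced := rfl
  injective f g h := by
    ext v
    exact congrArg (fun k : V →L[ℝ] W => k v) h
  isClosed_range := by
    have : Set.range (LinearIsometry.toContinuousLinearMap : (V →ₗᵢ[ℝ] W) → (V →L[ℝ] W)) =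
        {f | ∀ v, ‖f v‖ = ‖v‖} := by
      ext f
      constructor
      · rintro ⟨g, rfl⟩ v
        exact g.norm_map v
      · intro hf
        exact ⟨⟨f.toLinearMap, hf⟩, rfl⟩
    rw [this, Set.ofPred_forall]
    exact isClosed_iInter fun v => isClosed_eq (by fun_prop) continuous_const

instance [FiniteDimensional ℝ V] : T2Space (V →ₗᵢ[ℝ] W) :=
  isClosedEmbedding_li.isEmbedding.t2Space

instance [FiniteDimensional ℝ V] [FiniteDimensional ℝ W] : CompactSpace (V →ₗᵢ[ℝ] W) := by
  have : ProperSpace (V →L[ℝ] W) := FiniteDimensional.proper ℝ _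
  have h : Set.univ = (LinearIsometry.toContinuousLinearMap : (V →ₗᵢ[ℝ] W) → (V →L[ℝ] W)) ⁻¹'
      Metric.closedBall 0 1 := by
    ext f
    simp only [Set.mem_univ, Set.mem_preimage, mem_closedBall_zero_iff, true_iff]
    exact f.norm_toContinuousLinearMap_le
  exact ⟨h ▸ isClosedEmbedding_li.isCompact_preimage (isCompact_closedBall _ _)⟩

theorem isClosedEmbedding_lie [FiniteDimensional ℝ V] [FiniteDimensional ℝ W] :
    IsClosedEmbedding (LinearIsometryEquiv.toLinearIsometry : (V ≃ₗᵢ[ℝ] W) → (V →ₗᵢ[ℝ] W)) where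
  eq_induced := rfl
  injective := LinearIsometryEquiv.toLinearIsometry_injective
  isClosed_range := by
    by_cases h : Module.finrank ℝ V = Module.finrank ℝ W
    · convert isClosed_univ
      refine Set.eq_univ_of_forall fun f => ⟨f.toLinearIsometryEquiv h, ?_⟩
      ext; simp
    · convert isClosed_empty
      refine Set.range_eq_empty_iff.2 ⟨fun e => h e.toLinearEquiv.finrank_eq⟩

instance [FiniteDimensional ℝ V] [FiniteDimensional ℝ W] : T2Space (V ≃ₗᵢ[ℝ] W) :=
  isClosedEmbedding_lie.isEmbedding.t2Space

instance [FiniteDimensional ℝ V] [FiniteDimensional ℝ W] : CompactSpace (V ≃ₗᵢ[ℝ] W) :=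
  isClosedEmbedding_lie.compactSpace

end Isometries

/-- The finite-dimensional subspaces of the universe `𝒰`. -/
structure FDSub (𝒰 : Type u) [NormedAddCommGroup 𝒰] [InnerProductSpace ℝ 𝒰] : Type u where
  toSubmodule : Submodule ℝ 𝒰
  finiteDimensional : FiniteDimensional ℝ toSubmodule

variable {𝒰 : Type u} [NormedAddCommGroup 𝒰] [InnerProductSpace ℝ 𝒰]

/-- The inner product space underlying an object. -/
def FDSub.Carrier (V : FDSub 𝒰) : Type u := V.toSubmodule

instance : CoeSort (FDSub 𝒰) (Type u) := ⟨FDSub.Carrier⟩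
noncomputable instance (V : FDSub 𝒰) : NormedAddCommGroup V :=
  inferInstanceAs (NormedAddCommGroup V.toSubmodule)
noncomputable instance (V : FDSub 𝒰) : InnerProductSpace ℝ V :=
  inferInstanceAs (InnerProductSpace ℝ V.toSubmodule)
instance (V : FDSub 𝒰) : FiniteDimensional ℝ V := V.finiteDimensional

/-- The orthogonal direct sum of inner product spaces. -/
abbrev OSum (A B : Type u) := WithLp 2 (A × B)

section

variable {A B C A' B' C' V W : Type u}
  [NormedAddCommGroup A] [InnerProductSpace ℝ A] [NormedAddCommGroup B] [InnerProductSpace ℝ B]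
  [NormedAddCommGroup C] [InnerProductSpace ℝ C] [NormedAddCommGroup A'] [InnerProductSpace ℝ A']
  [NormedAddCommGroup B'] [InnerProductSpace ℝ B'] [NormedAddCommGroup C'] [InnerProductSpace ℝ C']
  [NormedAddCommGroup V] [InnerProductSpace ℝ V] [NormedAddCommGroup W] [InnerProductSpace ℝ W]

/-- `f ⊕ g`. -/
noncomputable abbrev osum (f : A ≃ₗᵢ[ℝ] A') (g : B ≃ₗᵢ[ℝ] B') : OSum A B ≃ₗᵢ[ℝ] OSum A' B' :=
  LinearIsometryEquiv.withLpProdCongr 2 f g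

noncomputable abbrev oassoc (A B C : Type u)
  [NormedAddCommGroup A] [InnerProductSpace ℝ A] [NormedAddCommGroup B] [InnerProductSpace ℝ B]
  [NormedAddCommGroup C] [InnerProductSpace ℝ C] : OSum (OSum A B) C ≃ₗᵢ[ℝ] OSum A (OSum B C) :=
  LinearIsometryEquiv.withLpProdAssoc 2 ℝ A B C

theorem oiso_ext {f g : OSum A B ≃ₗᵢ[ℝ] V} (h : ∀ a b, f (.toLp 2 (a, b)) = g (.toLp 2 (a, b))) :
    f = g := by
  ext x
  exact h x.fst x.snd

end

theorem continuous_prod_sum {A B Y Z : Type*} [TopologicalSpace A] [TopologicalSpace B]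
    [TopologicalSpace Y] [TopologicalSpace Z] {F : Y × (A ⊕ B) → Z}
    (h₁ : Continuous fun p : Y × A => F (p.1, Sum.inl p.2))
    (h₂ : Continuous fun p : Y × B => F (p.1, Sum.inr p.2)) : Continuous F :=
  (Homeomorph.prodSumDistrib (X := Y) (Y := A) (Z := B)).symm.comp_continuous_iff'.1
    (continuous_sum_dom.2 ⟨h₁, h₂⟩)

/-- The topological category of finite-dimensional subspaces of `𝒰` and linear isometric
isomorphisms, with a disjoint basepoint added to the spaces of morphisms. -/
noncomputable def isoCat (𝒰 : Type u) [NormedAddCommGroup 𝒰] [InnerProductSpace ℝ 𝒰] :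
    TopCategory (FDSub 𝒰) where
  Hom U V := ⟨(U ≃ₗᵢ[ℝ] V) ⊕ PUnit.{u + 1}, Sum.inr ⟨⟩⟩
  one U := Sum.inl (LinearIsometryEquiv.refl ℝ U)
  comp
    | Sum.inl g, Sum.inl f => Sum.inl (f.trans g)
    | Sum.inl _, Sum.inr _ => Sum.inr ⟨⟩
    | Sum.inr _, _ => Sum.inr ⟨⟩
  continuous_comp U V W := by
    refine KProd.continuous_sum_left ?_ continuous_const
    refine KProd.continuous_of_prod (f := fun p : (V ≃ₗᵢ[ℝ] W) × ((U ≃ₗᵢ[ℝ] V) ⊕ PUnit.{u + 1}) =>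
      match p.2 with
      | Sum.inl f => (Sum.inl (f.trans p.1) : (U ≃ₗᵢ[ℝ] W) ⊕ PUnit.{u + 1})
      | Sum.inr _ => Sum.inr ⟨⟩) (continuous_prod_sum (continuous_inl.comp ?_) continuous_const)
      |>.congr fun p => by rcases p with ⟨g, f | f⟩ <;> rfl
    exact continuous_snd.lie_trans continuous_fst
  comp_pt β := by cases β <;> rfl
  pt_comp α := by cases α <;> rfl
  one_comp α := by cases α <;> rfl
  comp_one α := by cases α <;> rfl
  comp_assoc γ β α := by cases γ <;> cases β <;> cases α <;> rfl

/-- An `ℐ`-space. -/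
abbrev ISpace (𝒰 : Type u) [NormedAddCommGroup 𝒰] [InnerProductSpace ℝ 𝒰] := DSpace (isoCat 𝒰)

namespace ISpace

/-- The action of an isometric isomorphism. -/
noncomputable def tr (X : ISpace 𝒰) {U V : FDSub 𝒰} (f : U ≃ₗᵢ[ℝ] V) (x : X.obj U) : X.obj V :=
  X.map (U := U) (V := V) (Sum.inl f) x

variable (X : ISpace 𝒰) {U V W : FDSub 𝒰}

theorem continuous_tr : Continuous fun p : KProd (U ≃ₗᵢ[ℝ] V) (X.obj U) => X.tr p.1 p.2 :=
  (X.continuous_map U V).comp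
    (KProd.continuous_mk (continuous_inl.comp KProd.continuous_fst) KProd.continuous_snd)

theorem tr_pt (f : U ≃ₗᵢ[ℝ] V) : X.tr f (X.obj U).pt = (X.obj V).pt := X.map_pt _

theorem tr_refl (x : X.obj U) : X.tr (.refl ℝ U) x = x := X.map_one x

theorem tr_trans (g : V ≃ₗᵢ[ℝ] W) (f : U ≃ₗᵢ[ℝ] V) (x : X.obj U) :
    X.tr (f.trans g) x = X.tr g (X.tr f x) := X.map_comp (Sum.inl g) (Sum.inl f) x

theorem hom_tr {X Y : ISpace 𝒰} (φ : X ⟶ Y) (f : U ≃ₗᵢ[ℝ] V) (x : X.obj U) :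
    φ.app V (X.tr f x) = Y.tr f (φ.app U x) := φ.naturality _ x

/-- Constructor for `ℐ`-spaces from the (unbased) action of isometric isomorphisms. -/
noncomputable def mk' (obj : FDSub 𝒰 → BasedSpace.{u})
    (tr : ∀ {U V : FDSub 𝒰}, (U ≃ₗᵢ[ℝ] V) → obj U → obj V)
    (continuous_tr : ∀ U V : FDSub 𝒰,
      Continuous fun p : KProd (U ≃ₗᵢ[ℝ] V) (obj U) => tr p.1 p.2)
    (tr_pt : ∀ {U V : FDSub 𝒰} (f : U ≃ₗᵢ[ℝ] V), tr f (obj U).pt = (obj V).pt)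
    (tr_refl : ∀ {U : FDSub 𝒰} (x : obj U), tr (.refl ℝ U) x = x)
    (tr_trans : ∀ {U V W : FDSub 𝒰} (g : V ≃ₗᵢ[ℝ] W) (f : U ≃ₗᵢ[ℝ] V) (x : obj U),
      tr (f.trans g) x = tr g (tr f x)) : ISpace 𝒰 where
  obj := obj
  map
    | Sum.inl f, x => tr f x
    | Sum.inr _, _ => (obj _).pt
  continuous_map U V := KProd.continuous_sum_left (continuous_tr U V) continuous_const
  map_pt α := by
    cases α with
    | inl f => exact tr_pt f
    | inr _ => rfl
  pt_map _ := rfl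
  map_one x := tr_refl x
  map_comp β α x := by
    cases β with
    | inr _ => rfl
    | inl g =>
      cases α with
      | inl f => exact tr_trans g f x
      | inr _ => exact (tr_pt g).symm

/-- Constructor for maps of `ℐ`-spaces. -/
def homMk {X Y : ISpace 𝒰} (app : ∀ U, X.obj U → Y.obj U) (hc : ∀ U, Continuous (app U))
    (hp : ∀ U, app U (X.obj U).pt = (Y.obj U).pt)
    (hn : ∀ {U V : FDSub 𝒰} (f : U ≃ₗᵢ[ℝ] V) (x : X.obj U),
      app V (X.tr f x) = Y.tr f (app U x)) : X ⟶ Y where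
  app := app
  continuous_app := hc
  app_pt := hp
  naturality {U V} α x := by
    cases α with
    | inl f => exact hn f x
    | inr _ =>
      change app V (X.map ((isoCat 𝒰).Hom U V).pt x) = Y.map ((isoCat 𝒰).Hom U V).pt (app U x)
      rw [X.pt_map, Y.pt_map, hp]

end ISpace

/-- The zero subspace. -/
def FDSub.zero (𝒰 : Type u) [NormedAddCommGroup 𝒰] [InnerProductSpace ℝ 𝒰] : FDSub 𝒰 :=
  ⟨⊥, inferInstance⟩

instance : Unique (FDSub.zero 𝒰) := inferInstanceAs (Unique (⊥ : Submodule ℝ 𝒰))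

/-- The isomorphism `A ⊕ 0 ≅ A`. -/
noncomputable def ozero (A : FDSub 𝒰) : OSum A (FDSub.zero 𝒰) ≃ₗᵢ[ℝ] A :=
  LinearIsometryEquiv.withLpProdUnique 2 ℝ A (FDSub.zero 𝒰)

theorem ozero_apply (A : FDSub 𝒰) (a : A) (b : FDSub.zero 𝒰) : ozero A (.toLp 2 (a, b)) = a := rfl

namespace Smash

variable (X Y Z : ISpace 𝒰) (V : FDSub 𝒰)

/-- The disjoint union of the spaces `ℐ(A ⊕ B, V) × X(A) × Y(B)`. -/
def Pre : Type u := Σ AB : FDSub 𝒰 × FDSub 𝒰,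
  KProd (OSum AB.1 AB.2 ≃ₗᵢ[ℝ] V) (KProd (X.obj AB.1) (Y.obj AB.2))

noncomputable instance : TopologicalSpace (Pre X Y V) := inferInstanceAs (TopologicalSpace (Σ _, _))
instance : UCompactlyGeneratedSpace.{u} (Pre X Y V) :=
  inferInstanceAs (UCompactlyGeneratedSpace.{u} (Σ _, _))

/-- A point whose `X`- or `Y`-coordinate is the basepoint. -/
def Pre.IsPt {X Y : ISpace 𝒰} {V : FDSub 𝒰} (p : Pre X Y V) : Prop :=
  p.2.2.1 = (X.obj p.1.1).pt ∨ p.2.2.2 = (Y.obj p.1.2).pt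

/-- The relation defining the coend of `ℐ(A ⊕ B, V)_+ ∧ X(A) ∧ Y(B)`. -/
inductive Rel : Pre X Y V → Pre X Y V → Prop
  | nat {A B A' B' : FDSub 𝒰} (f : A ≃ₗᵢ[ℝ] A') (g : B ≃ₗᵢ[ℝ] B') (h : OSum A' B' ≃ₗᵢ[ℝ] V)
      (x : X.obj A) (y : Y.obj B) :
      Rel ⟨(A, B), .mk ((osum f g).trans h) (.mk x y)⟩
        ⟨(A', B'), .mk h (.mk (X.tr f x) (Y.tr g y))⟩
  | pt {p q : Pre X Y V} (hp : p.IsPt) (hq : q.IsPt) : Rel p q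

variable {X Y Z V} {A B A' B' : FDSub 𝒰}

/-- The class `[h; x, y]`. -/
def gen (h : OSum A B ≃ₗᵢ[ℝ] V) (x : X.obj A) (y : Y.obj B) : Quot (Rel X Y V) :=
  Quot.mk _ ⟨(A, B), .mk h (.mk x y)⟩

theorem gen_nat (f : A ≃ₗᵢ[ℝ] A') (g : B ≃ₗᵢ[ℝ] B') (h : OSum A' B' ≃ₗᵢ[ℝ] V)
    (x : X.obj A) (y : Y.obj B) :
    gen ((osum f g).trans h) x y = gen h (X.tr f x) (Y.tr g y) := Quot.sound (.nat f g h x y)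

theorem continuous_gen : Continuous
    fun p : KProd (OSum A B ≃ₗᵢ[ℝ] V) (KProd (X.obj A) (Y.obj B)) =>
      (gen p.1 p.2.1 p.2.2 : Quot (Rel X Y V)) :=
  continuous_quot_mk.comp (continuous_sigmaMk (ι := FDSub 𝒰 × FDSub 𝒰)
    (σ := fun AB => KProd (OSum AB.1 AB.2 ≃ₗᵢ[ℝ] V) (KProd (X.obj AB.1) (Y.obj AB.2)))
    (i := (A, B)))

variable (X Y V) in
/-- The based space `(X ∧ Y)(V)`. -/
noncomputable def obj : BasedSpace.{u} where
  carrier := Quot (Rel X Y V)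
  cg := uCompactlyGeneratedSpace_of_coinduced (X := Pre X Y V) continuous_quot_mk rfl
  pt := gen (ozero V) (X.obj V).pt (Y.obj (FDSub.zero 𝒰)).pt

theorem gen_pt_left (h : OSum A B ≃ₗᵢ[ℝ] V) (y : Y.obj B) :
    gen h (X.obj A).pt y = (obj X Y V).pt := Quot.sound (.pt (.inl rfl) (.inl rfl))

theorem gen_pt_right (h : OSum A B ≃ₗᵢ[ℝ] V) (x : X.obj A) :
    gen h x (Y.obj B).pt = (obj X Y V).pt := Quot.sound (.pt (.inr rfl) (.inl rfl))

theorem ind {P : obj X Y V → Prop}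
    (h : ∀ (A B : FDSub 𝒰) (h : OSum A B ≃ₗᵢ[ℝ] V) (x : X.obj A) (y : Y.obj B), P (gen h x y)) :
    ∀ q, P q := by
  rintro ⟨⟨⟨A, B⟩, p⟩⟩
  exact h A B p.1 p.2.1 p.2.2

/-- Maps out of `(X ∧ Y)(V)`. -/
def lift {T : Type*} (t : T)
    (φ : ∀ {A B : FDSub 𝒰}, (OSum A B ≃ₗᵢ[ℝ] V) → X.obj A → Y.obj B → T)
    (hn : ∀ {A B A' B' : FDSub 𝒰} (f : A ≃ₗᵢ[ℝ] A') (g : B ≃ₗᵢ[ℝ] B') (h : OSum A' B' ≃ₗᵢ[ℝ] V)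
      (x : X.obj A) (y : Y.obj B), φ ((osum f g).trans h) x y = φ h (X.tr f x) (Y.tr g y))
    (hl : ∀ {A B : FDSub 𝒰} (h : OSum A B ≃ₗᵢ[ℝ] V) (y : Y.obj B), φ h (X.obj A).pt y = t)
    (hr : ∀ {A B : FDSub 𝒰} (h : OSum A B ≃ₗᵢ[ℝ] V) (x : X.obj A), φ h x (Y.obj B).pt = t) :
    obj X Y V → T :=
  Quot.lift (fun p => φ p.2.1 p.2.2.1 p.2.2.2) (by
    have key : ∀ p : Pre X Y V, p.IsPt → φ p.2.1 p.2.2.1 p.2.2.2 = t := by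
      rintro ⟨⟨A, B⟩, h, x, y⟩ (hx | hy)
      · change φ h x y = t
        rw [show x = (X.obj A).pt from hx, hl]
      · change φ h x y = t
        rw [show y = (Y.obj B).pt from hy, hr]
    rintro p q (⟨f, g, h, x, y⟩ | ⟨hp, hq⟩)
    · exact hn f g h x y
    · rw [key p hp, key q hq])

theorem lift_pt {T : Type*} {t : T}
    {φ : ∀ {A B : FDSub 𝒰}, (OSum A B ≃ₗᵢ[ℝ] V) → X.obj A → Y.obj B → T}
    {hn : ∀ {A B A' B' : FDSub 𝒰} (f : A ≃ₗᵢ[ℝ] A') (g : B ≃ₗᵢ[ℝ] B') (h : OSum A' B' ≃ₗᵢ[ℝ] V)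
      (x : X.obj A) (y : Y.obj B), φ ((osum f g).trans h) x y = φ h (X.tr f x) (Y.tr g y)}
    {hl : ∀ {A B : FDSub 𝒰} (h : OSum A B ≃ₗᵢ[ℝ] V) (y : Y.obj B), φ h (X.obj A).pt y = t}
    {hr : ∀ {A B : FDSub 𝒰} (h : OSum A B ≃ₗᵢ[ℝ] V) (x : X.obj A), φ h x (Y.obj B).pt = t} :
    lift t φ hn hl hr (obj X Y V).pt = t := hl _ _

theorem continuous_dom_right {G : Type v} [TopologicalSpace G] {T : Type w} [TopologicalSpace T]
    {F : KProd G (obj X Y V) → T}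
    (h : ∀ A B : FDSub 𝒰, Continuous
      fun p : KProd G (KProd (OSum A B ≃ₗᵢ[ℝ] V) (KProd (X.obj A) (Y.obj B))) =>
        F (.mk p.1 (gen p.2.1 p.2.2.1 p.2.2.2))) : Continuous F := by
  refine KProd.continuous_quot_right (Z := Pre X Y V) ?_
  exact KProd.continuous_sigma_right (F := fun p => F (.mk p.1 (Quot.mk _ p.2)))
    fun AB => h AB.1 AB.2

theorem continuous_dom {T : Type w} [TopologicalSpace T] {F : obj X Y V → T}
    (h : ∀ A B : FDSub 𝒰, Continuous
      fun p : KProd (OSum A B ≃ₗᵢ[ℝ] V) (KProd (X.obj A) (Y.obj B)) =>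
        F (gen p.1 p.2.1 p.2.2)) : Continuous F := by
  refine isQuotientMap_quot_mk.continuous_iff.2 ?_
  exact continuous_sigma fun AB => h AB.1 AB.2

end Smash

open KProd in
/-- The smash product of `ℐ`-spaces: `(X ∧ Y)(V)` is the coend over `(A, B)` of
`ℐ(A ⊕ B, V)_+ ∧ X(A) ∧ Y(B)`. -/
noncomputable def smash (X Y : ISpace 𝒰) : ISpace 𝒰 :=
  ISpace.mk' (Smash.obj X Y)
    (fun k => Smash.lift (Smash.obj X Y _).pt (fun h x y => Smash.gen (h.trans k) x y)
      (fun f g h x y => Smash.gen_nat f g (h.trans k) x y)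
      (fun _ y => Smash.gen_pt_left _ y) (fun _ x => Smash.gen_pt_right _ x))
    (fun U V => Smash.continuous_dom_right fun A B => Smash.continuous_gen.comp
      (continuous_mk (f := fun p : KProd (U ≃ₗᵢ[ℝ] V)
          (KProd (OSum A B ≃ₗᵢ[ℝ] U) (KProd (X.obj A) (Y.obj B))) => p.2.1.trans p.1)
        ((KProd.continuous_fst.comp KProd.continuous_snd).lie_trans KProd.continuous_fst)
        (KProd.continuous_snd.comp KProd.continuous_snd)))
    (fun f => Smash.gen_pt_left _ _)
    (fun x => by
      induction x using Smash.ind with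
      | h A B h x y => rfl)
    (fun g f x => by
      induction x using Smash.ind with
      | h A B h x y => rfl)

section

variable {X Y X' Y' Z : ISpace 𝒰} {A B C V W : FDSub 𝒰}

/-- The point `[h; x, y]` of `(X ∧ Y)(V)`. -/
def sgen (h : OSum A B ≃ₗᵢ[ℝ] V) (x : X.obj A) (y : Y.obj B) : (smash X Y).obj V :=
  Smash.gen h x y

theorem smash_tr (h : OSum A B ≃ₗᵢ[ℝ] V) (x : X.obj A) (y : Y.obj B) (k : V ≃ₗᵢ[ℝ] W) :
    (smash X Y).tr k (sgen h x y) = sgen (h.trans k) x y := rfl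

theorem smash_hom_ext {f g : smash X Y ⟶ Z} (H : ∀ (A B V : FDSub 𝒰) (h : OSum A B ≃ₗᵢ[ℝ] V)
    (x : X.obj A) (y : Y.obj B), f.app V (sgen h x y) = g.app V (sgen h x y)) : f = g :=
  DSpace.hom_ext fun V => Smash.ind fun A B h x y => H A B V h x y

open KProd in
/-- Functoriality of the smash product. -/
noncomputable def smashMap (φ : X ⟶ X') (ψ : Y ⟶ Y') : smash X Y ⟶ smash X' Y' :=
  ISpace.homMk
    (fun V => Smash.lift (Smash.obj X' Y' V).pt
      (fun {A B} h x y => Smash.gen h (φ.app A x) (ψ.app B y))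
      (fun f g h x y => by rw [Smash.gen_nat, ISpace.hom_tr, ISpace.hom_tr])
      (fun h y => by rw [φ.app_pt, Smash.gen_pt_left])
      (fun h x => by rw [ψ.app_pt, Smash.gen_pt_right]))
    (fun V => Smash.continuous_dom fun A B => Smash.continuous_gen.comp
      (continuous_mk (f := fun p : KProd (OSum A B ≃ₗᵢ[ℝ] V) (KProd (X.obj A) (Y.obj B)) => p.1)
        KProd.continuous_fst (continuous_mk
        ((φ.continuous_app A).comp (KProd.continuous_fst.comp KProd.continuous_snd))
        ((ψ.continuous_app B).comp (KProd.continuous_snd.comp KProd.continuous_snd)))))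
    (fun _ => Smash.lift_pt)
    (fun f x => by
      revert x
      exact Smash.ind fun A B h x y => rfl)

theorem smashMap_sgen (φ : X ⟶ X') (ψ : Y ⟶ Y') (h : OSum A B ≃ₗᵢ[ℝ] V) (x : X.obj A)
    (y : Y.obj B) : (smashMap φ ψ).app V (sgen h x y) = sgen h (φ.app A x) (ψ.app B y) := rfl

end

theorem FDSub.exists_iso [h : Fact (Module.rank ℝ 𝒰 = Cardinal.aleph0)] (T : Type*)
    [NormedAddCommGroup T] [InnerProductSpace ℝ T] [FiniteDimensional ℝ T] :
    ∃ E : FDSub 𝒰, Nonempty (T ≃ₗᵢ[ℝ] E) := by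
  have hle : ((Module.finrank ℝ T : ℕ) : Cardinal) ≤ Module.rank ℝ 𝒰 := by
    rw [h.out]; exact (Cardinal.natCast_lt_aleph0).le
  obtain ⟨b, hb⟩ := Module.le_rank_iff_exists_linearMap.1 hle
  have : FiniteDimensional ℝ (LinearMap.range b) := inferInstance
  have hr : Module.finrank ℝ T = Module.finrank ℝ (LinearMap.range b) := by
    rw [LinearMap.finrank_range_of_inj hb, Module.finrank_fin_fun]
  exact ⟨⟨LinearMap.range b, this⟩, ⟨(stdOrthonormalBasis ℝ T).equiv
    (stdOrthonormalBasis ℝ (LinearMap.range b)) (finCongr hr)⟩⟩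

section Monoidal

variable {X Y Z : ISpace 𝒰} {A B C D E V W A' B' C' D' E' : FDSub 𝒰}

theorem sgen_eq (f : A ≃ₗᵢ[ℝ] A') (g : B ≃ₗᵢ[ℝ] B') (h : OSum A B ≃ₗᵢ[ℝ] V)
    (h' : OSum A' B' ≃ₗᵢ[ℝ] V) (x : X.obj A) (y : Y.obj B)
    (H : ∀ a b, h (.toLp 2 (a, b)) = h' (.toLp 2 (f a, g b))) :
    sgen h x y = sgen h' (X.tr f x) (Y.tr g y) := by
  rw [show h = (osum f g).trans h' from oiso_ext H]
  exact Smash.gen_nat f g h' x y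

/-- The isometry `A ⊕ E ≅ A ⊕ (B ⊕ C) ≅ (A ⊕ B) ⊕ C ≅ D ⊕ C ≅ V`. -/
noncomputable def assocIso (k : OSum A B ≃ₗᵢ[ℝ] D) (e : OSum B C ≃ₗᵢ[ℝ] E)
    (h : OSum D C ≃ₗᵢ[ℝ] V) : OSum A E ≃ₗᵢ[ℝ] V :=
  (osum (.refl ℝ A) e.symm).trans ((oassoc A B C).symm.trans ((osum k (.refl ℝ C)).trans h))

theorem assocIso_apply (k : OSum A B ≃ₗᵢ[ℝ] D) (e : OSum B C ≃ₗᵢ[ℝ] E)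
    (h : OSum D C ≃ₗᵢ[ℝ] V) (a : A) (b : B) (c : C) :
    assocIso k e h (.toLp 2 (a, e (.toLp 2 (b, c)))) =
      h (.toLp 2 (k (.toLp 2 (a, b)), c)) := by
  simp [assocIso]

theorem assocIso_assocIso {F H K L : FDSub 𝒰} (k : OSum A B ≃ₗᵢ[ℝ] D)
    (h : OSum D C ≃ₗᵢ[ℝ] F) (g : OSum F H ≃ₗᵢ[ℝ] V) (e : OSum B C ≃ₗᵢ[ℝ] E)
    (e₂ : OSum E H ≃ₗᵢ[ℝ] K) (e₃ : OSum C H ≃ₗᵢ[ℝ] L) :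
    assocIso (assocIso k e h) e₂ g = assocIso k (assocIso e e₃ e₂) (assocIso h e₃ g) := by
  refine oiso_ext fun a v => ?_
  obtain ⟨⟨w, c'⟩, rfl⟩ := e₂.surjective v
  obtain ⟨⟨b, c⟩, rfl⟩ := e.surjective w
  rw [assocIso_apply, assocIso_apply, ← assocIso_apply e e₃ e₂, assocIso_apply, assocIso_apply]

theorem sgen_assoc_eq (f : A ≃ₗᵢ[ℝ] A') (g : B ≃ₗᵢ[ℝ] B') (l : C ≃ₗᵢ[ℝ] C')
    (k : OSum A B ≃ₗᵢ[ℝ] D) (e : OSum B C ≃ₗᵢ[ℝ] E) (h : OSum D C ≃ₗᵢ[ℝ] V)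
    (k' : OSum A' B' ≃ₗᵢ[ℝ] D') (e' : OSum B' C' ≃ₗᵢ[ℝ] E') (h' : OSum D' C' ≃ₗᵢ[ℝ] V)
    (H : ∀ a b c, h (.toLp 2 (k (.toLp 2 (a, b)), c)) = h' (.toLp 2 (k' (.toLp 2 (f a, g b)), l c)))
    (x : X.obj A) (y : Y.obj B) (z : Z.obj C) :
    sgen (Y := smash Y Z) (assocIso k e h) x (sgen e y z) =
      sgen (assocIso k' e' h') (X.tr f x) (sgen e' (Y.tr g y) (Z.tr l z)) := by
  rw [sgen_eq f (e.symm.trans ((osum g l).trans e')) (assocIso k e h) (assocIso k' e' h')]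
  · rw [smash_tr, sgen_eq g l _ e']
    intro b c
    simp
  · intro a v
    obtain ⟨w, rfl⟩ := e.surjective v
    have := assocIso_apply k e h a w.fst w.snd
    have h2 := assocIso_apply k' e' h' (f a) (g w.fst) (l w.snd)
    refine this.trans ((H _ _ _).trans (h2.symm.trans ?_))
    simp

theorem _root_.Continuous.sgen {T : Type*} [TopologicalSpace T] [UCompactlyGeneratedSpace.{u} T]
    {h : T → (OSum A B ≃ₗᵢ[ℝ] V)} {x : T → X.obj A} {y : T → Y.obj B}
    (hh : Continuous h) (hx : Continuous x) (hy : Continuous y) :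
    Continuous fun t => sgen (h t) (x t) (y t) :=
  Smash.continuous_gen.comp (KProd.continuous_mk hh (KProd.continuous_mk hx hy))

variable [Fact (Module.rank ℝ 𝒰 = Cardinal.aleph0)]

/-- A subspace of `𝒰` isometric to `B ⊕ C`. -/
noncomputable def sumObj (B C : FDSub 𝒰) : FDSub 𝒰 := (FDSub.exists_iso (𝒰 := 𝒰) (OSum B C)).choose

/-- The chosen isometry `B ⊕ C ≅ sumObj B C`. -/
noncomputable def sumIso (B C : FDSub 𝒰) : OSum B C ≃ₗᵢ[ℝ] sumObj B C :=
  (FDSub.exists_iso (𝒰 := 𝒰) (OSum B C)).choose_spec.some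

namespace Assoc

/-- The associator on `[h; -, z]`. -/
noncomputable def aux (h : OSum D C ≃ₗᵢ[ℝ] V) (z : Z.obj C) :
    (smash X Y).obj D → (smash X (smash Y Z)).obj V :=
  Smash.lift ((smash X (smash Y Z)).obj V).pt
    (fun {A B} k x y => sgen (assocIso k (sumIso B C) h) x (sgen (sumIso B C) y z))
    (fun f g k x y => by
      rw [sgen_assoc_eq f g (.refl ℝ C) _ _ h k (sumIso _ C) h, ISpace.tr_refl]
      intro a b c
      simp)
    (fun _ _ => Smash.gen_pt_left _ _)
    (fun k x => by
      refine (congrArg (sgen _ x) (Smash.gen_pt_left _ _)).trans (Smash.gen_pt_right _ _))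

open KProd in
theorem continuous_aux : Continuous
    fun p : KProd (KProd (OSum D C ≃ₗᵢ[ℝ] V) (Z.obj C)) ((smash X Y).obj D) =>
      aux p.1.1 p.1.2 p.2 := by
  refine Smash.continuous_dom_right fun A B => ?_
  let P := KProd (KProd (OSum D C ≃ₗᵢ[ℝ] V) (Z.obj C))
    (KProd (OSum A B ≃ₗᵢ[ℝ] D) (KProd (X.obj A) (Y.obj B)))
  have h1 : Continuous fun p : P => (p.1.1 : OSum D C ≃ₗᵢ[ℝ] V) :=
    KProd.continuous_fst.comp KProd.continuous_fst
  have h2 : Continuous fun p : P => (p.1.2 : Z.obj C) :=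
    KProd.continuous_snd.comp KProd.continuous_fst
  have h3 : Continuous fun p : P => (p.2.1 : OSum A B ≃ₗᵢ[ℝ] D) :=
    KProd.continuous_fst.comp KProd.continuous_snd
  have h4 : Continuous fun p : P => (p.2.2.1 : X.obj A) :=
    KProd.continuous_fst.comp (KProd.continuous_snd.comp KProd.continuous_snd)
  have h5 : Continuous fun p : P => (p.2.2.2 : Y.obj B) :=
    KProd.continuous_snd.comp (KProd.continuous_snd.comp KProd.continuous_snd)
  have h6 : Continuous fun p : P => osum p.2.1 (.refl ℝ C) := by
    refine continuous_lie_iff.2 fun v => ?_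
    have h : Continuous fun p : P => p.2.1 v.fst := continuous_lie_eval.comp
      (h3.prodMk continuous_const)
    exact (WithLp.prod_continuous_toLp 2 D C).comp (h.prodMk continuous_const)
  have h7 : Continuous fun p : P => assocIso p.2.1 (sumIso B C) p.1.1 :=
    continuous_const.lie_trans (continuous_const.lie_trans (h6.lie_trans h1))
  exact Continuous.sgen (Y := smash Y Z) h7 h4 (Continuous.sgen
    (h := fun _ : P => sumIso B C) continuous_const h5 h2)

theorem aux_sgen (h : OSum D C ≃ₗᵢ[ℝ] V) (z : Z.obj C) (k : OSum A B ≃ₗᵢ[ℝ] D)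
    (x : X.obj A) (y : Y.obj B) : aux h z (sgen k x y) =
      sgen (Y := smash Y Z) (assocIso k (sumIso B C) h) x (sgen (sumIso B C) y z) := rfl

theorem aux_pt (h : OSum D C ≃ₗᵢ[ℝ] V) (z : Z.obj C) :
    aux h z ((smash X Y).obj D).pt = ((smash X (smash Y Z)).obj V).pt :=
  Smash.gen_pt_left _ _

theorem aux_tr {D' C' V' : FDSub 𝒰} (f : D ≃ₗᵢ[ℝ] D') (g : C ≃ₗᵢ[ℝ] C') (m : V ≃ₗᵢ[ℝ] V')
    (h : OSum D C ≃ₗᵢ[ℝ] V) (h' : OSum D' C' ≃ₗᵢ[ℝ] V')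
    (H : ∀ d c, m (h (.toLp 2 (d, c))) = h' (.toLp 2 (f d, g c)))
    (q : (smash X Y).obj D) (z : Z.obj C) :
    (smash X (smash Y Z)).tr m (aux h z q) = aux h' (Z.tr g z) ((smash X Y).tr f q) := by
  revert q
  refine Smash.ind fun A B k x y => ?_
  change (smash X (smash Y Z)).tr m (aux h z (sgen k x y)) =
    aux h' (Z.tr g z) ((smash X Y).tr f (sgen k x y))
  rw [smash_tr, aux_sgen, aux_sgen, smash_tr]
  change sgen (assocIso k (sumIso B C) (h.trans m)) x _ = _
  rw [sgen_assoc_eq (.refl ℝ A) (.refl ℝ B) g k _ (h.trans m) (k.trans f)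
    (sumIso B _) h', ISpace.tr_refl, ISpace.tr_refl]
  intro a b c
  simp [H]

/-- The components of the associator. -/
noncomputable def app (V : FDSub 𝒰) :
    (smash (smash X Y) Z).obj V → (smash X (smash Y Z)).obj V :=
  Smash.lift (X := smash X Y) ((smash X (smash Y Z)).obj V).pt (fun h q z => aux h z q)
    (fun f g h q z => by
      rw [← aux_tr f g (.refl ℝ V) ((osum f g).trans h) h (fun _ _ => rfl), ISpace.tr_refl])
    (fun _ _ => aux_pt _ _)
    (fun h q => by
      revert q
      refine Smash.ind fun A B k x y => ?_
      exact (congrArg (sgen _ x) (Smash.gen_pt_right _ _)).trans (Smash.gen_pt_right _ _))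

theorem app_sgen (h : OSum D C ≃ₗᵢ[ℝ] V) (q : (smash X Y).obj D) (z : Z.obj C) :
    app V (sgen h q z) = aux h z q := rfl

theorem app_tr (f : V ≃ₗᵢ[ℝ] W) (p : (smash (smash X Y) Z).obj V) :
    app W ((smash (smash X Y) Z).tr f p) = (smash X (smash Y Z)).tr f (app V p) := by
  revert p
  refine Smash.ind fun D C h q z => ?_
  change app W (sgen (h.trans f) q z) = (smash X (smash Y Z)).tr f (app V (sgen h q z))
  rw [app_sgen, app_sgen, aux_tr (.refl ℝ D) (.refl ℝ C) f h (h.trans f) (fun _ _ => rfl),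
    ISpace.tr_refl, ISpace.tr_refl]

theorem continuous_app : Continuous (app V : (smash (smash X Y) Z).obj V → _) := by
  refine Smash.continuous_dom (X := smash X Y) (Y := Z) fun D C => ?_
  have h : Continuous fun p : KProd (OSum D C ≃ₗᵢ[ℝ] V) (KProd ((smash X Y).obj D) (Z.obj C)) =>
      (KProd.mk (KProd.mk p.1 p.2.2) p.2.1 :
        KProd (KProd (OSum D C ≃ₗᵢ[ℝ] V) (Z.obj C)) ((smash X Y).obj D)) :=
    KProd.continuous_mk
      (KProd.continuous_mk KProd.continuous_fst (KProd.continuous_snd.comp KProd.continuous_snd))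
      (KProd.continuous_fst.comp KProd.continuous_snd)
  exact ((continuous_aux (X := X) (Y := Y) (Z := Z) (V := V)).comp h).congr fun p =>
    (app_sgen p.1 p.2.1 p.2.2).symm

end Assoc

/-- The associator `(X ∧ Y) ∧ Z → X ∧ (Y ∧ Z)`, `[h; [k; x, y], z] ↦ [h (k ⊕ 1); x, [1; y, z]]`,
where `B ⊕ C` is replaced by the isometric subspace `sumObj B C`. -/
noncomputable def sassoc (X Y Z : ISpace 𝒰) : smash (smash X Y) Z ⟶ smash X (smash Y Z) :=
  ISpace.homMk Assoc.app (fun _ => Assoc.continuous_app) (fun _ => Assoc.aux_pt _ _) Assoc.app_tr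

theorem sassoc_sgen (h : OSum D C ≃ₗᵢ[ℝ] V) (k : OSum A B ≃ₗᵢ[ℝ] D) (e : OSum B C ≃ₗᵢ[ℝ] E)
    (x : X.obj A) (y : Y.obj B) (z : Z.obj C) :
    (sassoc X Y Z).app V (sgen (X := smash X Y) h (sgen k x y) z) =
      sgen (Y := smash Y Z) (assocIso k e h) x (sgen e y z) := by
  rw [sgen_assoc_eq (.refl ℝ A) (.refl ℝ B) (.refl ℝ C) k e h k (sumIso B C) h, ISpace.tr_refl,
    ISpace.tr_refl, ISpace.tr_refl]
  · rfl
  · intro a b c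
    rfl

end Monoidal

section Unit

variable {X Y : ISpace 𝒰} {A B V : FDSub 𝒰}

/-- The unit `ℐ`-space `ℐ(0, -)_+`. -/
noncomputable def iunit (𝒰 : Type u) [NormedAddCommGroup 𝒰] [InnerProductSpace ℝ 𝒰] : ISpace 𝒰 :=
  DSpace.repr (isoCat 𝒰) (FDSub.zero 𝒰)

/-- The isometry `A ≅ A ⊕ 0 ≅ A ⊕ B ≅ V`. -/
noncomputable def unitIso (h : OSum A B ≃ₗᵢ[ℝ] V) (f : FDSub.zero 𝒰 ≃ₗᵢ[ℝ] B) : A ≃ₗᵢ[ℝ] V :=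
  (ozero A).symm.trans ((osum (.refl ℝ A) f).trans h)

theorem unitIso_apply (h : OSum A B ≃ₗᵢ[ℝ] V) (f : FDSub.zero 𝒰 ≃ₗᵢ[ℝ] B) (a : A) :
    unitIso h f a = h (.toLp 2 (a, 0)) := by
  simp [unitIso, ozero]
  rfl

/-- The unitor `X ∧ ℐ(0, -)_+ → X`, `[h; x, f] ↦ X(h (1 ⊕ f)) x`. -/
noncomputable def runitor (X : ISpace 𝒰) : smash X (iunit 𝒰) ⟶ X :=
  ISpace.homMk
    (fun V => Smash.lift (X.obj V).pt (fun {A B} h x (f : (FDSub.zero 𝒰 ≃ₗᵢ[ℝ] B) ⊕ PUnit) =>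
        match f with
        | Sum.inl f => X.tr (unitIso h f) x
        | Sum.inr _ => (X.obj V).pt)
      (fun {A B A' B'} f g h x φ => by
        rcases φ with φ | φ
        · change X.tr (unitIso ((osum f g).trans h) φ) x = X.tr (unitIso h (φ.trans g)) (X.tr f x)
          rw [← X.tr_trans]
          congr 1
        · rfl)
      (fun {A B} _ φ => by
        rcases φ with φ | φ
        · exact X.tr_pt _
        · rfl)
      (fun _ _ => rfl))
    (fun V => Smash.continuous_dom fun A B => by
      have hc : Continuous fun p : KProd ((FDSub.zero 𝒰 ≃ₗᵢ[ℝ] B) ⊕ PUnit.{u + 1})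
          (KProd (OSum A B ≃ₗᵢ[ℝ] V) (X.obj A)) =>
          (match p.1 with
          | Sum.inl f => X.tr (unitIso p.2.1 f) p.2.2
          | Sum.inr _ => (X.obj V).pt : X.obj V) := by
        refine KProd.continuous_sum_left ?_ continuous_const
        refine X.continuous_tr.comp (KProd.continuous_mk (f := fun p : KProd
          (FDSub.zero 𝒰 ≃ₗᵢ[ℝ] B) (KProd (OSum A B ≃ₗᵢ[ℝ] V) (X.obj A)) => unitIso p.2.1 p.1) ?_
          (KProd.continuous_snd.comp KProd.continuous_snd))
        refine continuous_lie_iff.2 fun v => ?_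
        simp only [unitIso_apply]
        exact continuous_lie_eval.comp
          ((KProd.continuous_fst.comp KProd.continuous_snd).prodMk continuous_const)
      exact hc.comp (KProd.continuous_mk (f := fun p : KProd (OSum A B ≃ₗᵢ[ℝ] V)
          (KProd (X.obj A) ((iunit 𝒰).obj B)) => p.2.2)
        (KProd.continuous_snd.comp KProd.continuous_snd)
        (KProd.continuous_mk KProd.continuous_fst
          (KProd.continuous_fst.comp KProd.continuous_snd))))
    (fun _ => Smash.lift_pt)
    (fun f => Smash.ind fun _ _ h x φ => by
      rcases φ with φ | φ
      · exact X.tr_trans f (unitIso h φ) x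
      · exact (X.tr_pt f).symm)

theorem runitor_sgen (h : OSum A B ≃ₗᵢ[ℝ] V) (x : X.obj A) (f : FDSub.zero 𝒰 ≃ₗᵢ[ℝ] B) :
    (runitor X).app V (sgen (Y := iunit 𝒰) h x (Sum.inl f)) = X.tr (unitIso h f) x := rfl

/-- The symmetry `X ∧ Y → Y ∧ X`, `[h; x, y] ↦ [h τ; y, x]`. -/
noncomputable def sbraid (X Y : ISpace 𝒰) : smash X Y ⟶ smash Y X :=
  ISpace.homMk
    (fun V => Smash.lift ((smash Y X).obj V).pt
      (fun {A B} h x y => sgen ((LinearIsometryEquiv.withLpProdComm 2 ℝ B A).trans h) y x)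
      (fun f g _ x y => sgen_eq g f _ _ y x fun _ _ => rfl)
      (fun _ _ => Smash.gen_pt_right _ _) (fun _ _ => Smash.gen_pt_left _ _))
    (fun V => Smash.continuous_dom fun A B => Continuous.sgen
      (h := fun p : KProd (OSum A B ≃ₗᵢ[ℝ] V) (KProd (X.obj A) (Y.obj B)) =>
        (LinearIsometryEquiv.withLpProdComm 2 ℝ B A).trans p.1)
      (continuous_const.lie_trans KProd.continuous_fst)
      (KProd.continuous_snd.comp KProd.continuous_snd)
      (KProd.continuous_fst.comp KProd.continuous_snd))
    (fun _ => Smash.lift_pt)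
    (fun _ => Smash.ind fun _ _ _ _ _ => rfl)

theorem sbraid_sgen (h : OSum A B ≃ₗᵢ[ℝ] V) (x : X.obj A) (y : Y.obj B) :
    (sbraid X Y).app V (sgen h x y) =
      sgen ((LinearIsometryEquiv.withLpProdComm 2 ℝ B A).trans h) y x := rfl

end Unit

section Modules

variable [Fact (Module.rank ℝ 𝒰 = Cardinal.aleph0)]

/-- A commutative monoid structure on an `ℐ`-space, for the smash product of `ℐ`-spaces. -/
structure CommMonoidStr (R : ISpace 𝒰) where
  one : iunit 𝒰 ⟶ R
  mul : smash R R ⟶ R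
  mul_one : smashMap (𝟙 R) one ≫ mul = runitor R
  one_mul : smashMap one (𝟙 R) ≫ mul = sbraid (iunit 𝒰) R ≫ runitor R
  mul_assoc : smashMap mul (𝟙 R) ≫ mul = sassoc R R R ≫ smashMap (𝟙 R) mul ≫ mul
  mul_comm : sbraid R R ≫ mul = mul

/-- An `R`-module in `ℐ`-spaces: an `ℐ`-space `X` with a unital and associative action
`X ∧ R → X`. -/
structure IModule {R : ISpace 𝒰} (m : CommMonoidStr R) where
  X : ISpace 𝒰
  act : smash X R ⟶ X
  act_one : smashMap (𝟙 X) m.one ≫ act = runitor X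
  act_mul : smashMap act (𝟙 R) ≫ act = sassoc X R R ≫ smashMap (𝟙 X) m.mul ≫ act

namespace IModule

variable {R : ISpace 𝒰} {m : CommMonoidStr R}

/-- A map of `R`-modules. -/
@[ext]
structure Hom (M N : IModule m) where
  hom : M.X ⟶ N.X
  comm : smashMap hom (𝟙 R) ≫ N.act = M.act ≫ hom

theorem Hom.comm_apply {M N : IModule m} (f : Hom M N) {A B V : FDSub 𝒰}
    (h : OSum A B ≃ₗᵢ[ℝ] V) (x : M.X.obj A) (r : R.obj B) :
    N.act.app V (sgen h (f.hom.app A x) r) = f.hom.app V (M.act.app V (sgen h x r)) :=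
  congrArg (fun k : smash M.X R ⟶ N.X => k.app V (sgen h x r)) f.comm

theorem comm_of_apply {M N : IModule m} {f : M.X ⟶ N.X} (H : ∀ {A B V : FDSub 𝒰}
    (h : OSum A B ≃ₗᵢ[ℝ] V) (x : M.X.obj A) (r : R.obj B),
    N.act.app V (sgen h (f.app A x) r) = f.app V (M.act.app V (sgen h x r))) :
    smashMap f (𝟙 R) ≫ N.act = M.act ≫ f :=
  smash_hom_ext fun _ _ _ h x r => H h x r

noncomputable instance : Category (IModule m) where
  Hom := Hom
  id M := ⟨𝟙 M.X, comm_of_apply fun _ _ _ => rfl⟩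
  comp f g := ⟨f.hom ≫ g.hom, comm_of_apply fun h x r => by
    simp only [DSpace.comp_app]
    rw [g.comm_apply, f.comm_apply]⟩

@[simp] theorem id_hom (M : IModule m) : Hom.hom (𝟙 M) = 𝟙 M.X := rfl
@[simp] theorem comp_hom {M N P : IModule m} (f : M ⟶ N) (g : N ⟶ P) :
    Hom.hom (f ≫ g) = f.hom ≫ g.hom := rfl

theorem hom_ext' {M N : IModule m} {f g : M ⟶ N} (h : ∀ U x, f.hom.app U x = g.hom.app U x) :
    f = g := Hom.ext (DSpace.hom_ext h)

/-- The component of a module map as a point of the mapping space. -/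
def toKMap {M N : IModule m} (W : FDSub 𝒰) (f : M ⟶ N) : KMap.{u} (M.X.obj W) (N.X.obj W) :=
  ⟨f.hom.app W, fun _ k => (f.hom.continuous_app W).comp k.continuous⟩

/-- The topology on module maps as a subset of the product of the mapping spaces
`Top(M(W), N(W))`. -/
abbrev homTopology (M N : IModule m) : TopologicalSpace (M ⟶ N) :=
  ⨅ W, TopologicalSpace.induced (toKMap W) inferInstance

/-- The zero map. -/
noncomputable def zeroHom (M N : IModule m) : M ⟶ N where
  hom := ISpace.homMk (fun U _ => (N.X.obj U).pt) (fun _ => continuous_const) (fun _ => rfl)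
    (fun f _ => (N.X.tr_pt f).symm)
  comm := comm_of_apply fun h _ r =>
    (congrArg (N.act.app _) (Smash.gen_pt_left h r)).trans (N.act.app_pt _)

/-- The based space of module maps `M → N`, i.e. the (compactly generated) subspace of module maps
in the end `∫_W Top(M(W), N(W))`; the basepoint is the zero map. -/
noncomputable def mapSpace (M N : IModule m) : BasedSpace.{u} where
  carrier := M ⟶ N
  top := @TopologicalSpace.compactlyGenerated.{u} _ (homTopology M N)
  cg := @cg_compactlyGenerated.{u} _ (homTopology M N)
  pt := zeroHom M N

variable {M N P : IModule m}

theorem continuous_mapSpace {A : Type*} [TopologicalSpace A] [UCompactlyGeneratedSpace.{u} A]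
    {φ : A → mapSpace M N} (h : ∀ W, Continuous
      fun p : KProd A (M.X.obj W) => Hom.hom (φ p.1) |>.app W p.2) : Continuous φ := by
  refine continuous_from_uCompactlyGeneratedSpace φ fun S a => ?_
  have := cg_compHaus S
  have h2 : Continuous[_, homTopology M N] (φ ∘ a) := by
    refine continuous_iInf_rng.2 fun W => continuous_induced_rng.2 ?_
    exact KMap.continuous_iff.2 fun S' c b => KProd.continuous_dom.1 (h W) S' (a.comp c) b
  exact @continuous_to_compactlyGenerated _ (homTopology M N) S (@ContinuousMap.mk _ _ _ (homTopology M N) _ h2)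

theorem continuous_eval (W : FDSub 𝒰) :
    Continuous fun p : KProd (mapSpace M N) (M.X.obj W) => Hom.hom p.1 |>.app W p.2 := by
  have h1 : Continuous fun f : mapSpace M N => (toKMap W f : KMap.{u} (M.X.obj W) (N.X.obj W)) := by
    refine @continuous_from_compactlyGenerated (M ⟶ N) _ (homTopology M N) _ _ fun S g => ?_
    exact (continuous_iInf_rng.1 (@ContinuousMap.continuous _ _ _ (homTopology M N) g) W
      |> continuous_induced_rng.1)
  exact KProd.continuous_dom.2 fun S a b => KMap.continuous_iff.1 h1 S a b

theorem continuous_mapSpace_comp :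
    Continuous fun p : KProd (mapSpace M N) (mapSpace N P) =>
      (show mapSpace M P from CategoryStruct.comp (obj := IModule m) p.1 p.2) := by
  refine continuous_mapSpace fun W => ?_
  let T := KProd (KProd (mapSpace M N) (mapSpace N P)) (M.X.obj W)
  have h1 : Continuous fun p : T => (p.1.1 : mapSpace M N) :=
    KProd.continuous_fst.comp KProd.continuous_fst
  have h2 : Continuous fun p : T => (p.1.2 : mapSpace N P) :=
    KProd.continuous_snd.comp KProd.continuous_fst
  have h3 : Continuous fun p : T => (p.2 : M.X.obj W) := KProd.continuous_snd
  exact (continuous_eval W).comp (KProd.continuous_mk h2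
    ((continuous_eval W).comp (KProd.continuous_mk h1 h3)))

/-- The composition pairing of spaces of module maps. -/
noncomputable def mapComp (f : mapSpace M N) (k : mapSpace N P) : mapSpace M P :=
  CategoryStruct.comp (obj := IModule m) f k

theorem act_one_apply (M : IModule m) {A B V : FDSub 𝒰} (h : OSum A B ≃ₗᵢ[ℝ] V) (x : M.X.obj A)
    (f : FDSub.zero 𝒰 ≃ₗᵢ[ℝ] B) : M.act.app V (sgen h x (m.one.app B (Sum.inl f))) =
      M.X.tr (unitIso h f) x :=
  congrArg (fun k : smash M.X (iunit 𝒰) ⟶ M.X => k.app V (sgen (Y := iunit 𝒰) h x (Sum.inl f)))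
    M.act_one

end IModule

theorem CommMonoidStr.mul_one_apply {R : ISpace 𝒰} (m : CommMonoidStr R) {A B V : FDSub 𝒰}
    (h : OSum A B ≃ₗᵢ[ℝ] V) (x : R.obj A) (f : FDSub.zero 𝒰 ≃ₗᵢ[ℝ] B) :
    m.mul.app V (sgen h x (m.one.app B (Sum.inl f))) = R.tr (unitIso h f) x :=
  congrArg (fun k : smash R (iunit 𝒰) ⟶ R => k.app V (sgen (Y := iunit 𝒰) h x (Sum.inl f)))
    m.mul_one

theorem CommMonoidStr.mul_assoc_apply {R : ISpace 𝒰} (m : CommMonoidStr R)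
    {A B C D E V : FDSub 𝒰} (h : OSum D C ≃ₗᵢ[ℝ] V) (k : OSum A B ≃ₗᵢ[ℝ] D)
    (e : OSum B C ≃ₗᵢ[ℝ] E) (x : R.obj A) (y : R.obj B) (z : R.obj C) :
    m.mul.app V (sgen h (m.mul.app D (sgen k x y)) z) =
      m.mul.app V (sgen (assocIso k e h) x (m.mul.app E (sgen e y z))) := by
  have := congrArg (fun f : smash (smash R R) R ⟶ R =>
    f.app V (sgen (X := smash R R) h (sgen k x y) z)) m.mul_assoc
  refine this.trans ?_
  simp only [DSpace.comp_app]
  rw [sassoc_sgen h k e]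
  rfl

namespace IModule

variable {R : ISpace 𝒰} (m : CommMonoidStr R)

/-- The action `(X ∧ R) ∧ R ≅ X ∧ (R ∧ R) → X ∧ R`. -/
noncomputable def freeAct (X : ISpace 𝒰) : smash (smash X R) R ⟶ smash X R :=
  sassoc X R R ≫ smashMap (𝟙 X) m.mul

theorem freeAct_sgen {X : ISpace 𝒰} {A B C D E V : FDSub 𝒰} (h : OSum D C ≃ₗᵢ[ℝ] V)
    (k : OSum A B ≃ₗᵢ[ℝ] D) (e : OSum B C ≃ₗᵢ[ℝ] E) (x : X.obj A) (r : R.obj B) (s : R.obj C) :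
    (freeAct m X).app V (sgen (X := smash X R) h (sgen k x r) s) =
      sgen (assocIso k e h) x (m.mul.app E (sgen e r s)) := by
  change (smashMap (𝟙 X) m.mul).app V ((sassoc X R R).app V
    (sgen (X := smash X R) h (sgen k x r) s)) = _
  rw [sassoc_sgen h k e]
  rfl

theorem freeAct_one (X : ISpace 𝒰) :
    smashMap (𝟙 (smash X R)) m.one ≫ freeAct m X = runitor (smash X R) := by
  refine smash_hom_ext (X := smash X R) fun D C V h q f => ?_
  rcases f with f | f
  · revert q
    refine Smash.ind fun A B k x r => ?_
    change (freeAct m X).app V (sgen (X := smash X R) h (sgen k x r) (m.one.app C (Sum.inl f))) =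
      (smash X R).tr (unitIso h f) (sgen k x r)
    rw [freeAct_sgen m h k (sumIso B C), smash_tr, m.mul_one_apply,
      sgen_eq (.refl ℝ A) (unitIso (sumIso B C) f) _ (assocIso k (sumIso B C) h), X.tr_refl]
    intro a b
    rw [unitIso_apply, LinearIsometryEquiv.coe_refl, id, assocIso_apply]
    exact unitIso_apply h f _
  · change (freeAct m X).app V (sgen (X := smash X R) h q (m.one.app C ((iunit 𝒰).obj C).pt)) = _
    rw [m.one.app_pt]
    exact (congrArg _ (Smash.gen_pt_right h q)).trans ((freeAct m X).app_pt V)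

theorem freeAct_mul (X : ISpace 𝒰) : smashMap (freeAct m X) (𝟙 R) ≫ freeAct m X =
    sassoc (smash X R) R R ≫ smashMap (𝟙 (smash X R)) m.mul ≫ freeAct m X := by
  refine smash_hom_ext (X := smash (smash X R) R) fun F H V g p t => ?_
  revert p
  refine Smash.ind (X := smash X R) fun D C h q s => ?_
  revert q
  refine Smash.ind fun A B k x r => ?_
  change (freeAct m X).app V (sgen (X := smash X R) g ((freeAct m X).app F
    (sgen (X := smash X R) h (sgen k x r) s)) t) = (freeAct m X).app V
    ((smashMap (𝟙 (smash X R)) m.mul).app V ((sassoc (smash X R) R R).app V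
      (sgen (X := smash (smash X R) R) g (sgen (X := smash X R) h (sgen k x r) s) t)))
  rw [sassoc_sgen g h (sumIso C H), freeAct_sgen m h k (sumIso B C),
    freeAct_sgen m g _ (sumIso _ H), smashMap_sgen, DSpace.id_app,
    freeAct_sgen m _ k (assocIso (sumIso B C) (sumIso C H) (sumIso _ H)),
    m.mul_assoc_apply _ _ (sumIso C H), assocIso_assocIso]

/-- The free `R`-module `X ∧ R` on an `ℐ`-space `X`. -/
noncomputable def free (X : ISpace 𝒰) : IModule m where
  X := smash X R
  act := freeAct m X
  act_one := freeAct_one m X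
  act_mul := freeAct_mul m X

end IModule

end Modules

section Equivariant

variable (G : Type) [Group G] [TopologicalSpace G]

/-- The topological category `ℐ` with trivial `G`-action. -/
noncomputable abbrev gisoCat (𝒰 : Type u) [NormedAddCommGroup 𝒰] [InnerProductSpace ℝ 𝒰] :
    GTopCategory G (FDSub 𝒰) where
  toTopCategory := isoCat 𝒰
  smul _ α := α
  continuous_smul _ _ := KProd.continuous_snd
  one_smul _ := rfl
  mul_smul _ _ _ := rfl
  smul_pt _ := rfl
  smul_one _ _ := rfl
  smul_comp _ _ _ := rfl

/-- A `G`-equivariant `ℐ`-space. -/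
abbrev GISpace (𝒰 : Type u) [NormedAddCommGroup 𝒰] [InnerProductSpace ℝ 𝒰] :=
  GDSpace (gisoCat G 𝒰)

variable {G}

namespace GISpace

/-- The underlying `ℐ`-space. -/
abbrev und (X : GISpace G 𝒰) : ISpace 𝒰 := X.toDSpace

/-- The action of `g` as a map of `ℐ`-spaces. -/
def smulHom (X : GISpace G 𝒰) (g : G) : X.und ⟶ X.und where
  app _ := X.smul g
  continuous_app U := (X.continuous_smul U).comp
    (KProd.continuous_mk continuous_const continuous_id)
  app_pt U := X.smul_pt U g
  naturality α x := X.smul_map g α x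

/-- An `ℐ`-space with trivial `G`-action. -/
def triv (G : Type) [Group G] [TopologicalSpace G] (X : ISpace 𝒰) : GISpace G 𝒰 where
  toDSpace := X
  smul _ x := x
  continuous_smul _ := KProd.continuous_snd
  one_smul _ := rfl
  mul_smul _ _ _ := rfl
  smul_pt _ _ := rfl
  smul_map _ _ _ := rfl

theorem smul_inv_smul (X : GISpace G 𝒰) {U : FDSub 𝒰} (g : G) (x : X.obj U) :
    X.smul g (X.smul g⁻¹ x) = x := by
  rw [← X.mul_smul, mul_inv_cancel, X.one_smul]

end GISpace

/-- The smash product of `G`-equivariant `ℐ`-spaces, with the diagonal action. -/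
noncomputable def gsmash (X Y : GISpace G 𝒰) : GISpace G 𝒰 where
  toDSpace := smash X.und Y.und
  smul {U} g q := (smashMap (X.smulHom g) (Y.smulHom g)).app U q
  continuous_smul U := by
    refine Smash.continuous_dom_right (X := X.und) (Y := Y.und) fun A B => ?_
    let P := KProd G (KProd (OSum A B ≃ₗᵢ[ℝ] U) (KProd (X.und.obj A) (Y.und.obj B)))
    have h1 : Continuous fun p : P => (p.1 : G) := KProd.continuous_fst
    have h2 : Continuous fun p : P => (p.2.1 : OSum A B ≃ₗᵢ[ℝ] U) :=
      KProd.continuous_fst.comp KProd.continuous_snd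
    have h3 : Continuous fun p : P => (p.2.2.1 : X.und.obj A) :=
      KProd.continuous_fst.comp (KProd.continuous_snd.comp KProd.continuous_snd)
    have h4 : Continuous fun p : P => (p.2.2.2 : Y.und.obj B) :=
      KProd.continuous_snd.comp (KProd.continuous_snd.comp KProd.continuous_snd)
    exact Continuous.sgen (X := X.und) (Y := Y.und) h2
      ((X.continuous_smul A).comp (KProd.continuous_mk h1 h3))
      ((Y.continuous_smul B).comp (KProd.continuous_mk h1 h4))
  one_smul {U} q := by
    revert q
    refine Smash.ind fun A B h x y => ?_
    change sgen (X := X.und) (Y := Y.und) h (X.smul 1 x) (Y.smul 1 y) = sgen h x y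
    rw [X.one_smul, Y.one_smul]
  mul_smul {U} g k q := by
    revert q
    refine Smash.ind fun A B h x y => ?_
    change sgen (X := X.und) (Y := Y.und) h (X.smul (g * k) x) (Y.smul (g * k) y) =
      sgen h (X.smul g (X.smul k x)) (Y.smul g (Y.smul k y))
    rw [X.mul_smul, Y.mul_smul]
  smul_pt U g := DSpace.Hom.app_pt _ _
  smul_map g α q := DSpace.Hom.naturality _ α q

section

variable [Fact (Module.rank ℝ 𝒰 = Cardinal.aleph0)]

/-- A commutative monoid structure on a `G`-equivariant `ℐ`-space: a commutative monoid structure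
on the underlying `ℐ`-space with `G`-equivariant unit and multiplication. -/
structure GCommMonoidStr (R : GISpace G 𝒰) extends CommMonoidStr R.und where
  smul_one (U : FDSub 𝒰) (g : G) (x : (iunit 𝒰).obj U) : R.smul g (one.app U x) = one.app U x
  smul_mul (U : FDSub 𝒰) (g : G) (q : (gsmash R R).obj U) :
    mul.app U ((gsmash R R).smul g q) = R.smul g (mul.app U q)

/-- An `R`-module in `G`-equivariant `ℐ`-spaces: a `G`-equivariant `ℐ`-space `X` with an equivariant
unital and associative action `X ∧ R → X`. -/
structure GIModule {R : GISpace G 𝒰} (m : GCommMonoidStr R) where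
  X : GISpace G 𝒰
  act : gsmash X R ⟶ X
  act_one : smashMap (𝟙 X.und) m.one ≫ (act.toHom : smash X.und R.und ⟶ X.und) = runitor X.und
  act_mul : smashMap (act.toHom : smash X.und R.und ⟶ X.und) (𝟙 R.und) ≫
      (act.toHom : smash X.und R.und ⟶ X.und) =
    sassoc X.und R.und R.und ≫ smashMap (𝟙 X.und) m.mul ≫ act.toHom

namespace GIModule

variable {R : GISpace G 𝒰} {m : GCommMonoidStr R}

/-- The underlying nonequivariant module. -/
noncomputable abbrev und (M : GIModule m) : IModule m.toCommMonoidStr where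
  X := M.X.und
  act := M.act.toHom
  act_one := M.act_one
  act_mul := M.act_mul

/-- A map of `R`-modules in `G`-equivariant `ℐ`-spaces. -/
@[ext]
structure Hom (M N : GIModule m) where
  hom : M.X ⟶ N.X
  comm : smashMap (hom.toHom : M.X.und ⟶ N.X.und) (𝟙 R.und) ≫
    (N.act.toHom : smash N.X.und R.und ⟶ N.X.und) = M.act.toHom ≫ hom.toHom

/-- The underlying map of nonequivariant modules. -/
def Hom.und {M N : GIModule m} (f : Hom M N) : M.und ⟶ N.und := ⟨f.hom.toHom, f.comm⟩

noncomputable instance : Category (GIModule m) where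
  Hom := Hom
  id M := ⟨𝟙 M.X, (𝟙 M.und : M.und ⟶ M.und).comm⟩
  comp f g := ⟨f.hom ≫ g.hom, (f.und ≫ g.und).comm⟩
  id_comp _ := rfl
  comp_id _ := rfl
  assoc _ _ _ := rfl

variable {M N P : GIModule m}

theorem act_smul (M : GIModule m) {A B V : FDSub 𝒰} (g : G) (h : OSum A B ≃ₗᵢ[ℝ] V)
    (x : M.X.obj A) (r : R.obj B) :
    M.und.act.app V (sgen h (M.X.smul g x) (R.smul g r)) =
      M.X.smul g (M.und.act.app V (sgen (X := M.X.und) (Y := R.und) h x r)) :=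
  M.act.map_smul V g (sgen (X := M.X.und) (Y := R.und) h x r)

/-- The conjugation action of `G` on nonequivariant module maps: `(g f)(x) = g f(g⁻¹ x)`. -/
noncomputable def conj (g : G) (f : M.und ⟶ N.und) : M.und ⟶ N.und where
  hom := M.X.smulHom g⁻¹ ≫ f.hom ≫ N.X.smulHom g
  comm := IModule.comm_of_apply fun {A B V} h (x : M.X.obj A) (r : R.obj B) => by
    have h1 := act_smul N g h (f.hom.app A (M.X.smul g⁻¹ x)) (R.smul g⁻¹ r)
    rw [GISpace.smul_inv_smul, f.comm_apply] at h1
    exact h1.trans (congrArg (fun z => N.X.smul g (f.hom.app V z)) (act_smul M g⁻¹ h x r))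

theorem conj_app (g : G) (f : M.und ⟶ N.und) (U : FDSub 𝒰) (x : M.X.obj U) :
    (conj g f).hom.app U x = N.X.smul g (f.hom.app U (M.X.smul g⁻¹ x)) := rfl

theorem conj_one (f : M.und ⟶ N.und) : conj 1 f = f :=
  IModule.hom_ext' fun U (x : M.X.obj U) => by
    rw [conj_app, inv_one, GDSpace.one_smul, GDSpace.one_smul]

theorem conj_mul (g h : G) (f : M.und ⟶ N.und) : conj (g * h) f = conj g (conj h f) :=
  IModule.hom_ext' fun U (x : M.X.obj U) => by
    rw [conj_app, conj_app, conj_app, mul_inv_rev, GDSpace.mul_smul, GDSpace.mul_smul]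

theorem conj_zeroHom (g : G) :
    conj g (IModule.zeroHom M.und N.und) = IModule.zeroHom M.und N.und :=
  IModule.hom_ext' fun U _ => N.X.smul_pt U g

theorem conj_id (g : G) : conj g (𝟙 M.und) = 𝟙 M.und :=
  IModule.hom_ext' fun U (x : M.X.obj U) => M.X.smul_inv_smul g x

theorem conj_comp (g : G) (f : M.und ⟶ N.und) (k : N.und ⟶ P.und) :
    conj g (f ≫ k) = conj g f ≫ conj g k :=
  IModule.hom_ext' fun U (x : M.X.obj U) => by
    have := N.X.smul_inv_smul g⁻¹ (f.hom.app U (M.X.smul g⁻¹ x))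
    rw [inv_inv] at this
    exact congrArg (fun z => P.X.smul g (k.hom.app U z)) this.symm

theorem continuous_conj [ContinuousInv G] :
    Continuous fun p : KProd G (IModule.mapSpace M.und N.und) =>
      (show IModule.mapSpace M.und N.und from conj p.1 p.2) := by
  refine IModule.continuous_mapSpace fun W => ?_
  let P := KProd (KProd G (IModule.mapSpace M.und N.und)) (M.und.X.obj W)
  have h1 : Continuous fun p : P => (p.1.1 : G) := KProd.continuous_fst.comp KProd.continuous_fst
  have h2 : Continuous fun p : P => (p.1.2 : IModule.mapSpace M.und N.und) :=
    KProd.continuous_snd.comp KProd.continuous_fst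
  have h3 : Continuous fun p : P => (p.2 : M.und.X.obj W) := KProd.continuous_snd
  exact (N.X.continuous_smul W).comp (KProd.continuous_mk h1 ((IModule.continuous_eval W).comp
    (KProd.continuous_mk h2 ((M.X.continuous_smul W).comp
      (KProd.continuous_mk (continuous_inv.comp h1) h3)))))

variable (m)

theorem freeAct_smul (X : GISpace G 𝒰) (V : FDSub 𝒰) (g : G)
    (q : (gsmash (gsmash X R) R).obj V) :
    (IModule.freeAct m.toCommMonoidStr X.und).app V ((gsmash (gsmash X R) R).smul g q) =
      (gsmash X R).smul g ((IModule.freeAct m.toCommMonoidStr X.und).app V q) := by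
  revert q
  refine Smash.ind fun D C h p s => ?_
  revert p
  refine Smash.ind fun A B k x r => ?_
  change (IModule.freeAct m.toCommMonoidStr X.und).app V (sgen (X := smash X.und R.und) h
      (sgen (X := X.und) (Y := R.und) k (X.smul g x) (R.smul g r)) (R.smul g s)) =
    (smashMap (X.smulHom g) (R.smulHom g)).app V ((IModule.freeAct m.toCommMonoidStr X.und).app V
      (sgen (X := smash X.und R.und) h (sgen k x r) s))
  rw [IModule.freeAct_sgen _ h k (sumIso B C), IModule.freeAct_sgen _ h k (sumIso B C),
    smashMap_sgen]
  exact congrArg (sgen _ _) (m.smul_mul _ g (sgen (X := R.und) (Y := R.und) (sumIso B C) r s))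

/-- The free `R`-module `X ∧ R` on a `G`-equivariant `ℐ`-space `X`. -/
noncomputable def free (X : GISpace G 𝒰) : GIModule m where
  X := gsmash X R
  act := ⟨IModule.freeAct m.toCommMonoidStr X.und, freeAct_smul m X⟩
  act_one := IModule.freeAct_one m.toCommMonoidStr X.und
  act_mul := IModule.freeAct_mul m.toCommMonoidStr X.und

/-- The free `R`-module `U^* ∧ R` on the represented `ℐ`-space `U^* = ℐ(U, -)_+`. -/
noncomputable def freeRepr (U : FDSub 𝒰) : GIModule m :=
  free m (GISpace.triv G (DSpace.repr (isoCat 𝒰) U))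

/-- The diagram category of `R`: the space of morphisms `U → V` is the space of (nonequivariant)
`R`-module maps `V^* ∧ R → U^* ∧ R`, on which `G` acts by conjugation. (The variance is the one for
which `U ↦ U^* ∧ R` is contravariant, as for `ℐ` itself.) -/
noncomputable def diagramCategory [ContinuousInv G] : GTopCategory G (FDSub 𝒰) where
  Hom U V := IModule.mapSpace (freeRepr m V).und (freeRepr m U).und
  one U := 𝟙 (freeRepr m U).und
  comp β α := CategoryStruct.comp (obj := IModule m.toCommMonoidStr) β α
  continuous_comp _ _ _ := IModule.continuous_mapSpace_comp
  comp_pt _ := IModule.hom_ext' fun _ _ => rfl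
  pt_comp {U V _} (α : (freeRepr m V).und ⟶ (freeRepr m U).und) := IModule.hom_ext' fun _ _ =>
    α.hom.app_pt _
  one_comp α := Category.id_comp (obj := IModule m.toCommMonoidStr) α
  comp_one α := Category.comp_id (obj := IModule m.toCommMonoidStr) α
  comp_assoc γ β α := Category.assoc (obj := IModule m.toCommMonoidStr) γ β α
  smul g f := conj g f
  continuous_smul _ _ := continuous_conj
  one_smul α := conj_one α
  mul_smul g h α := conj_mul g h α
  smul_pt g := conj_zeroHom g
  smul_one _ g := conj_id g
  smul_comp g β α := conj_comp g β α

end GIModule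

end

end Equivariant

section OnePointMaps

variable {S T X Y Z : Type*}

/-- The map `X^+ ∧ Y^+ → Z^+` of one-point compactifications given by `φ : X × Y → Z`. -/
def opMap₂ (φ : X → Y → Z) : OnePoint X → OnePoint Y → OnePoint Z
  | OnePoint.some x, OnePoint.some y => OnePoint.some (φ x y)
  | OnePoint.some _, OnePoint.infty => OnePoint.infty
  | OnePoint.infty, _ => OnePoint.infty

theorem opMap₂_infty (φ : X → Y → Z) (p : OnePoint X) : opMap₂ φ p OnePoint.infty = OnePoint.infty := by
  cases p <;> rfl

variable [TopologicalSpace S] [TopologicalSpace T] [TopologicalSpace X] [TopologicalSpace Y]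
  [TopologicalSpace Z]

theorem continuous_onePoint {F : S → OnePoint Z}
    (h1 : ∀ U : Set Z, IsOpen U → IsOpen (F ⁻¹' (OnePoint.some '' U)))
    (h2 : ∀ K : Set Z, IsClosed K → IsCompact K → IsClosed (F ⁻¹' (OnePoint.some '' K))) :
    Continuous F := by
  rw [continuous_def]
  intro s hs
  by_cases h : OnePoint.infty ∈ s
  · obtain ⟨hc, hk⟩ := (OnePoint.isOpen_iff_of_mem h).1 hs
    have h3 := (h2 _ hc hk).isOpen_compl
    convert h3 using 1
    ext p
    simp only [Set.mem_preimage, Set.mem_compl_iff, Set.mem_image, not_exists, not_and, not_imp_not]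
    constructor
    · intro hp z hz
      rw [hz]
      exact hp
    · intro hp
      induction hF : F p using OnePoint.rec with
      | infty => exact h
      | coe z => exact hp z hF.symm
  · have h3 := h1 _ ((OnePoint.isOpen_iff_of_notMem h).1 hs)
    convert h3 using 2
    ext q
    constructor
    · intro hq
      induction q using OnePoint.rec with
      | infty => exact absurd hq h
      | coe z => exact ⟨z, hq, rfl⟩
    · rintro ⟨z, hz, rfl⟩
      exact hz

theorem continuous_opMap {φ : T → X → Z} (hφ : Continuous fun p : T × X => φ p.1 p.2)
    (hp : ∀ K : Set Z, IsClosed K → IsCompact K → ∃ K' : Set X, IsClosed K' ∧ IsCompact K' ∧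
      ∀ t x, φ t x ∈ K → x ∈ K') :
    Continuous fun p : T × OnePoint X => OnePoint.map (φ p.1) p.2 := by
  have hj : IsOpenMap (Prod.map id OnePoint.some : T × X → T × OnePoint X) :=
    IsOpenMap.id.prodMap OnePoint.isOpenMap_coe
  have key : ∀ (s : Set Z) (t : T) (p : OnePoint X), OnePoint.map (φ t) p ∈ OnePoint.some '' s ↔
      ∃ x, p = OnePoint.some x ∧ φ t x ∈ s := by
    intro s t p
    induction p using OnePoint.rec with
    | infty => simp
    | coe x => simp
  refine continuous_onePoint (fun U hU => ?_) fun K hc hk => ?_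
  · convert hj _ (hU.preimage hφ) using 1
    ext ⟨t, p⟩
    simp only [Set.mem_preimage, key, Set.mem_image, Prod.exists, Prod.map_apply, id, Prod.mk.injEq]
    constructor
    · rintro ⟨x, rfl, h⟩
      exact ⟨t, x, h, rfl, rfl⟩
    · rintro ⟨t, x, h, rfl, rfl⟩
      exact ⟨x, rfl, h⟩
  · obtain ⟨K', hc', hk', h⟩ := hp K hc hk
    rw [← isOpen_compl_iff, isOpen_iff_mem_nhds]
    rintro ⟨t, p⟩ hn
    induction p using OnePoint.rec with
    | infty =>
      have ho : IsOpen ((Set.univ : Set T) ×ˢ (OnePoint.some '' K')ᶜ) :=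
        isOpen_univ.prod (OnePoint.isOpen_compl_image_coe.2 ⟨hc', hk'⟩)
      refine Filter.mem_of_superset (ho.mem_nhds ⟨trivial, OnePoint.infty_notMem_image_coe⟩) ?_
      rintro ⟨t', q⟩ ⟨_, hq⟩ hq'
      obtain ⟨x, rfl, hx⟩ := (key _ _ _).1 hq'
      exact hq ⟨x, h _ _ hx, rfl⟩
    | coe x =>
      refine Filter.mem_of_superset ((hj _ (hc.isOpen_compl.preimage hφ)).mem_nhds
        ⟨(t, x), fun hx => hn ((key _ _ _).2 ⟨x, rfl, hx⟩), rfl⟩) ?_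
      rintro _ ⟨⟨t', x'⟩, hx', rfl⟩ hq'
      obtain ⟨x'', he, hx⟩ := (key _ _ _).1 hq'
      cases OnePoint.coe_injective he
      exact hx' hx

theorem continuous_opMap₂ {φ : T → X → Y → Z}
    (hφ : Continuous fun p : T × (X × Y) => φ p.1 p.2.1 p.2.2)
    (hp : ∀ K : Set Z, IsClosed K → IsCompact K → ∃ (K₁ : Set X) (K₂ : Set Y), IsClosed K₁ ∧
      IsCompact K₁ ∧ IsClosed K₂ ∧ IsCompact K₂ ∧ ∀ t x y, φ t x y ∈ K → x ∈ K₁ ∧ y ∈ K₂) :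
    Continuous fun p : T × (OnePoint X × OnePoint Y) => opMap₂ (φ p.1) p.2.1 p.2.2 := by
  have hj : IsOpenMap (Prod.map id (Prod.map OnePoint.some OnePoint.some) :
      T × (X × Y) → T × (OnePoint X × OnePoint Y)) :=
    IsOpenMap.id.prodMap (OnePoint.isOpenMap_coe.prodMap OnePoint.isOpenMap_coe)
  have key : ∀ (s : Set Z) (t : T) (p : OnePoint X) (q : OnePoint Y),
      opMap₂ (φ t) p q ∈ OnePoint.some '' s ↔
      ∃ x y, p = OnePoint.some x ∧ q = OnePoint.some y ∧ φ t x y ∈ s := by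
    intro s t p q
    induction p using OnePoint.rec with
    | infty => simp [opMap₂]
    | coe x =>
      induction q using OnePoint.rec with
      | infty => simp [opMap₂]
      | coe y => simp [opMap₂]
  refine continuous_onePoint (fun U hU => ?_) fun K hc hk => ?_
  · convert hj _ (hU.preimage hφ) using 1
    ext ⟨t, p, q⟩
    simp only [Set.mem_preimage, key, Set.mem_image, Prod.exists, Prod.map_apply, id, Prod.mk.injEq]
    constructor
    · rintro ⟨x, y, rfl, rfl, h⟩
      exact ⟨t, x, y, h, rfl, rfl, rfl⟩
    · rintro ⟨t, x, y, h, rfl, rfl, rfl⟩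
      exact ⟨x, y, rfl, rfl, h⟩
  · obtain ⟨K₁, K₂, hc₁, hk₁, hc₂, hk₂, h⟩ := hp K hc hk
    rw [← isOpen_compl_iff, isOpen_iff_mem_nhds]
    rintro ⟨t, p, q⟩ hn
    induction p using OnePoint.rec with
    | infty =>
      have ho : IsOpen ((Set.univ : Set T) ×ˢ ((OnePoint.some '' K₁)ᶜ ×ˢ
          (Set.univ : Set (OnePoint Y)))) :=
        isOpen_univ.prod ((OnePoint.isOpen_compl_image_coe.2 ⟨hc₁, hk₁⟩).prod isOpen_univ)
      refine Filter.mem_of_superset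
        (ho.mem_nhds ⟨trivial, OnePoint.infty_notMem_image_coe, trivial⟩) ?_
      rintro ⟨t', p', q'⟩ ⟨_, hp', _⟩ hq'
      obtain ⟨x, y, rfl, rfl, hx⟩ := (key _ _ _ _).1 hq'
      exact hp' ⟨x, (h _ _ _ hx).1, rfl⟩
    | coe x =>
      induction q using OnePoint.rec with
      | infty =>
        have ho : IsOpen ((Set.univ : Set T) ×ˢ ((Set.univ : Set (OnePoint X)) ×ˢ
            (OnePoint.some '' K₂)ᶜ)) :=
          isOpen_univ.prod (isOpen_univ.prod (OnePoint.isOpen_compl_image_coe.2 ⟨hc₂, hk₂⟩))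
        refine Filter.mem_of_superset
          (ho.mem_nhds ⟨trivial, trivial, OnePoint.infty_notMem_image_coe⟩) ?_
        rintro ⟨t', p', q'⟩ ⟨_, _, hp'⟩ hq'
        obtain ⟨x, y, rfl, rfl, hx⟩ := (key _ _ _ _).1 hq'
        exact hp' ⟨y, (h _ _ _ hx).2, rfl⟩
      | coe y =>
        refine Filter.mem_of_superset ((hj _ (hc.isOpen_compl.preimage hφ)).mem_nhds
          ⟨(t, x, y), fun hx => hn ((key _ _ _ _).2 ⟨x, y, rfl, rfl, hx⟩), rfl⟩) ?_
        rintro _ ⟨⟨t', x', y'⟩, hx', rfl⟩ hq'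
        obtain ⟨x'', y'', he, he', hx⟩ := (key _ _ _ _).1 hq'
        cases OnePoint.coe_injective he
        cases OnePoint.coe_injective he'
        exact hx' hx

end OnePointMaps

section Tensor

/-- `ℝ^n` with its standard inner product. -/
abbrev RN (n : ℕ) : Type := EuclideanSpace ℝ (Fin n)

/-- The orthogonal group `O(n)`. -/
abbrev O (n : ℕ) : Type := RN n ≃ₗᵢ[ℝ] RN n

/-- `ℝ^n ⊗ V` with the tensor product inner product. -/
abbrev NT (n : ℕ) (V : Type v) [NormedAddCommGroup V] [InnerProductSpace ℝ V] : Type v :=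
  RN n ⊗[ℝ] V

instance (n : ℕ) : ContinuousInv (O n) where
  continuous_inv := continuous_lie_iff.2 fun v => by
    refine continuous_iff_continuousAt.2 fun f₀ => ?_
    rw [ContinuousAt, tendsto_iff_norm_sub_tendsto_zero]
    have h : ∀ f : O n, ‖f⁻¹ v - f₀⁻¹ v‖ = ‖v - f (f₀⁻¹ v)‖ := fun f => by
      rw [← f.norm_map, map_sub]
      congr 2
      exact f.apply_symm_apply v
    simp only [h]
    have hc : Continuous fun f : O n => ‖v - f (f₀⁻¹ v)‖ :=
      (continuous_const.sub (continuous_lie_iff.1 continuous_id (f₀⁻¹ v))).norm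
    refine (hc.tendsto f₀).trans_eq ?_
    have : f₀ (f₀⁻¹ v) = v := f₀.apply_symm_apply v
    rw [this, sub_self, norm_zero]

variable {A B V W V' W' : Type*}
  [NormedAddCommGroup A] [InnerProductSpace ℝ A] [NormedAddCommGroup B] [InnerProductSpace ℝ B]
  [NormedAddCommGroup V] [InnerProductSpace ℝ V] [NormedAddCommGroup W] [InnerProductSpace ℝ W]

/-- `ℝ^n ⊗ f`. -/
noncomputable def tmap (n : ℕ) (f : V →ₗᵢ[ℝ] W) : NT n V →ₗᵢ[ℝ] NT n W :=
  f.lTensor (RN n)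

/-- `σ ⊗ V`. -/
noncomputable def trot {n : ℕ} (σ : O n) : NT n V →ₗᵢ[ℝ] NT n V :=
  σ.toLinearIsometry.rTensor V

variable {n : ℕ}

theorem tmap_tmul (f : V →ₗᵢ[ℝ] W) (a : RN n) (v : V) : tmap n f (a ⊗ₜ v) = a ⊗ₜ f v := rfl

theorem trot_tmul (σ : O n) (a : RN n) (v : V) : trot σ (a ⊗ₜ[ℝ] v) = σ a ⊗ₜ v := rfl

theorem tmap_comp (g : W →ₗᵢ[ℝ] B) (f : V →ₗᵢ[ℝ] W) (x : NT n V) :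
    tmap n (g.comp f) x = tmap n g (tmap n f x) := by
  induction x using TensorProduct.induction_on with
  | zero => simp
  | add x y hx hy => simp [hx, hy]
  | tmul a v => rfl

theorem tmap_id (x : NT n V) : tmap n (LinearIsometry.id : V →ₗᵢ[ℝ] V) x = x := by
  induction x using TensorProduct.induction_on with
  | zero => simp
  | add x y hx hy => simp [hx, hy]
  | tmul a v => rfl

theorem trot_one (x : NT n V) : trot 1 x = x := by
  induction x using TensorProduct.induction_on with
  | zero => simp
  | add x y hx hy => simp [hx, hy]
  | tmul a v => rfl

theorem trot_mul (σ τ : O n) (x : NT n V) : trot (σ * τ) x = trot σ (trot τ x) := by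
  induction x using TensorProduct.induction_on with
  | zero => simp
  | add x y hx hy => simp [hx, hy]
  | tmul a v => rfl

theorem trot_tmap (σ : O n) (f : V →ₗᵢ[ℝ] W) (x : NT n V) :
    trot σ (tmap n f x) = tmap n f (trot σ x) := by
  induction x using TensorProduct.induction_on with
  | zero => simp
  | add x y hx hy => simp [hx, hy]
  | tmul a v => rfl

theorem continuous_tmap [FiniteDimensional ℝ V] [FiniteDimensional ℝ W] :
    Continuous fun p : (V →ₗᵢ[ℝ] W) × NT n V => tmap n p.1 p.2 := by
  let L : (V →L[ℝ] W) →ₗ[ℝ] (NT n V →L[ℝ] NT n W) :=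
    LinearMap.toContinuousLinearMap.toLinearMap ∘ₗ
      (TensorProduct.mapBilinear (.id ℝ) (RN n) V (RN n) W LinearMap.id) ∘ₗ
      LinearMap.toContinuousLinearMap.symm.toLinearMap
  have hL : Continuous L := L.continuous_of_finiteDimensional
  exact Continuous.clm_apply (f := fun p : (V →ₗᵢ[ℝ] W) × NT n V =>
    L p.1.toContinuousLinearMap) (hL.comp (continuous_toCLM.comp continuous_fst)) continuous_snd

theorem continuous_trot [FiniteDimensional ℝ V] :
    Continuous fun p : O n × NT n V => trot p.1 p.2 := by
  let L : (RN n →L[ℝ] RN n) →ₗ[ℝ] (NT n V →L[ℝ] NT n V) :=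
    LinearMap.toContinuousLinearMap.toLinearMap ∘ₗ
      (TensorProduct.mapBilinear (.id ℝ) (RN n) V (RN n) V).flip LinearMap.id ∘ₗ
      LinearMap.toContinuousLinearMap.symm.toLinearMap
  have hL : Continuous L := L.continuous_of_finiteDimensional
  exact Continuous.clm_apply (f := fun p : O n × NT n V =>
    L p.1.toLinearIsometry.toContinuousLinearMap)
    (hL.comp (continuous_toCLM.comp (continuous_toLI.comp continuous_fst))) continuous_snd

theorem _root_.Continuous.tmap [FiniteDimensional ℝ V] [FiniteDimensional ℝ W] {T : Type*}
    [TopologicalSpace T] {f : T → (V →ₗᵢ[ℝ] W)} {x : T → NT n V} (hf : Continuous f)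
    (hx : Continuous x) : Continuous fun t => tmap n (f t) (x t) :=
  Continuous.comp (g := fun p : (V →ₗᵢ[ℝ] W) × NT n V => OrthCalc.tmap n p.1 p.2)
    (f := fun t => (f t, x t)) continuous_tmap (hf.prodMk hx)

theorem _root_.Continuous.trot [FiniteDimensional ℝ V] {T : Type*}
    [TopologicalSpace T] {f : T → O n} {x : T → NT n V} (hf : Continuous f)
    (hx : Continuous x) : Continuous fun t => trot (f t) (x t) :=
  Continuous.comp (g := fun p : O n × NT n V => OrthCalc.trot p.1 p.2)
    (f := fun t => (f t, x t)) continuous_trot (hf.prodMk hx)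

theorem inner_tmap_tmap {f : A →ₗᵢ[ℝ] V} {g : B →ₗᵢ[ℝ] V} (h : ∀ a b, inner ℝ (f a) (g b) = 0)
    (x : NT n A) (y : NT n B) : inner ℝ (tmap n f x) (tmap n g y) = 0 := by
  induction x using TensorProduct.induction_on with
  | zero => simp
  | add x x' hx hx' => simp [inner_add_left, hx, hx']
  | tmul a v =>
    induction y using TensorProduct.induction_on with
    | zero => simp
    | add y y' hy hy' => simp [inner_add_right, hy, hy']
    | tmul b w => simp [tmap_tmul, h]

/-- The orthogonal complement of the image of `f`, i.e. `W - f(V)`. -/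
noncomputable abbrev coker (f : V →ₗᵢ[ℝ] W) : Submodule ℝ W := (LinearMap.range f.toLinearMap)ᗮ

/-- The subspace `ℝ^n ⊗ (W - f(V))` of `ℝ^n ⊗ W`. -/
noncomputable def jetFib (n : ℕ) (f : V →ₗᵢ[ℝ] W) : Submodule ℝ (NT n W) :=
  LinearMap.range (tmap n (coker f).subtypeₗᵢ).toLinearMap

theorem inner_of_mem_jetFib {f : V →ₗᵢ[ℝ] W} {x : NT n W} (hx : x ∈ jetFib n f)
    (y : NT n V) : inner ℝ x (tmap n f y) = 0 := by
  obtain ⟨t, rfl⟩ := hx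
  refine inner_tmap_tmap (fun a b => ?_) t y
  exact Submodule.inner_left_of_mem_orthogonal (LinearMap.mem_range_self _ b) a.2

theorem mem_jetFib_iff [FiniteDimensional ℝ W] {f : V →ₗᵢ[ℝ] W} {x : NT n W} :
    x ∈ jetFib n f ↔ ∀ (a : RN n) (v : V), inner ℝ x (a ⊗ₜ f v) = 0 := by
  refine ⟨fun hx a v => inner_of_mem_jetFib hx (a ⊗ₜ v), fun h => ?_⟩
  let R := LinearMap.range f.toLinearMap
  let P : W →ₗ[ℝ] W := R.starProjection.toLinearMap
  let Q : W →ₗ[ℝ] Rᗮ := Rᗮ.orthogonalProjectionOnto.toLinearMap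
  have hP : ∀ (x : NT n W) (a : RN n) (w : W),
      inner ℝ (P.lTensor (RN n) x) (a ⊗ₜ w) = inner ℝ x (a ⊗ₜ P w) := by
    intro x a w
    induction x using TensorProduct.induction_on with
    | zero => simp
    | add x y hx hy => rw [map_add, inner_add_left, inner_add_left, hx, hy]
    | tmul b v =>
      simp only [LinearMap.lTensor_tmul, TensorProduct.inner_tmul]
      congr 1
      exact R.inner_starProjection_left_eq_right v w
  have h0 : P.lTensor (RN n) x = 0 := by
    refine TensorProduct.ext_iff_inner_right.2 fun a w => ?_
    obtain ⟨v, hv⟩ : P w ∈ R := R.starProjection_apply_mem w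
    rw [hP, inner_zero_left, ← hv]
    exact h a v
  refine ⟨Q.lTensor (RN n) x, ?_⟩
  have hs : ∀ x : NT n W,
      tmap n (coker f).subtypeₗᵢ (Q.lTensor (RN n) x) + P.lTensor (RN n) x = x := by
    intro x
    induction x using TensorProduct.induction_on with
    | zero => simp
    | add x y hx hy =>
      rw [map_add, map_add, map_add, add_add_add_comm, hx, hy]
    | tmul b v =>
      rw [LinearMap.lTensor_tmul, LinearMap.lTensor_tmul, tmap_tmul, ← TensorProduct.tmul_add]
      congr 1
      rw [add_comm]
      exact R.starProjection_add_starProjection_orthogonal v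
  have := hs x
  rw [h0, add_zero] at this
  exact this

theorem norm_add_tmap {f : V →ₗᵢ[ℝ] W} {x : NT n W} (hx : x ∈ jetFib n f)
    (y : NT n V) : ‖x + tmap n f y‖ * ‖x + tmap n f y‖ = ‖x‖ * ‖x‖ + ‖y‖ * ‖y‖ := by
  rw [norm_add_sq_eq_norm_sq_add_norm_sq_of_inner_eq_zero _ _ (inner_of_mem_jetFib hx y),
    LinearIsometry.norm_map]

end Tensor

section SphereMonoid

/-- The inclusion `A → A ⊕ B`. -/
noncomputable def oinl (A B : Type u) [NormedAddCommGroup A] [InnerProductSpace ℝ A]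
    [NormedAddCommGroup B] [InnerProductSpace ℝ B] : A →ₗᵢ[ℝ] OSum A B where
  toFun a := .toLp 2 (a, 0)
  map_add' a b := by rw [← WithLp.toLp_add, Prod.mk_add_mk, add_zero]
  map_smul' r a := by rw [RingHom.id_apply, ← WithLp.toLp_smul, Prod.smul_mk, smul_zero]
  norm_map' a := WithLp.norm_toLp_fst 2 A B a

/-- The inclusion `B → A ⊕ B`. -/
noncomputable def oinr (A B : Type u) [NormedAddCommGroup A] [InnerProductSpace ℝ A]
    [NormedAddCommGroup B] [InnerProductSpace ℝ B] : B →ₗᵢ[ℝ] OSum A B where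
  toFun b := .toLp 2 (0, b)
  map_add' a b := by rw [← WithLp.toLp_add, Prod.mk_add_mk, add_zero]
  map_smul' r a := by rw [RingHom.id_apply, ← WithLp.toLp_smul, Prod.smul_mk, smul_zero]
  norm_map' b := WithLp.norm_toLp_snd 2 A B b

section

variable {A B A' B' V W : Type u} (n : ℕ)
  [NormedAddCommGroup A] [InnerProductSpace ℝ A] [NormedAddCommGroup B] [InnerProductSpace ℝ B]
  [NormedAddCommGroup A'] [InnerProductSpace ℝ A'] [NormedAddCommGroup B'] [InnerProductSpace ℝ B']
  [NormedAddCommGroup V] [InnerProductSpace ℝ V] [NormedAddCommGroup W] [InnerProductSpace ℝ W]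

/-- The restriction of `h` to `A`. -/
noncomputable def resl (h : OSum A B ≃ₗᵢ[ℝ] V) : A →ₗᵢ[ℝ] V :=
  h.toLinearIsometry.comp (oinl A B)

/-- The restriction of `h` to `B`. -/
noncomputable def resr (h : OSum A B ≃ₗᵢ[ℝ] V) : B →ₗᵢ[ℝ] V :=
  h.toLinearIsometry.comp (oinr A B)

theorem resl_apply (h : OSum A B ≃ₗᵢ[ℝ] V) (a : A) : resl h a = h (.toLp 2 (a, 0)) := rfl

theorem resr_apply (h : OSum A B ≃ₗᵢ[ℝ] V) (b : B) : resr h b = h (.toLp 2 (0, b)) := rfl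

theorem inner_resl_resr (h : OSum A B ≃ₗᵢ[ℝ] V) (a : A) (b : B) :
    inner ℝ (resl h a) (resr h b) = 0 := by
  rw [resl_apply, resr_apply, h.inner_map_map]
  simp

/-- `ℝ^n ⊗ h` composed with `(ℝ^n ⊗ A) ⊕ (ℝ^n ⊗ B) ≅ ℝ^n ⊗ (A ⊕ B)`. -/
noncomputable def sumMap (h : OSum A B ≃ₗᵢ[ℝ] V) (s : NT n A) (t : NT n B) :
    NT n V :=
  tmap n h.toLinearIsometry (tmap n (oinl A B) s + tmap n (oinr A B) t)

variable {n}

theorem sumMap_eq (h : OSum A B ≃ₗᵢ[ℝ] V) (s : NT n A) (t : NT n B) :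
    sumMap n h s t = tmap n (resl h) s + tmap n (resr h) t := by
  rw [sumMap, map_add, resl, resr, tmap_comp, tmap_comp]

theorem norm_sumMap (h : OSum A B ≃ₗᵢ[ℝ] V) (s : NT n A) (t : NT n B) :
    ‖sumMap n h s t‖ * ‖sumMap n h s t‖ = ‖s‖ * ‖s‖ + ‖t‖ * ‖t‖ := by
  rw [sumMap_eq, norm_add_sq_eq_norm_sq_add_norm_sq_of_inner_eq_zero _ _
    (inner_tmap_tmap (inner_resl_resr h) s t), LinearIsometry.norm_map, LinearIsometry.norm_map]

theorem continuous_resl [FiniteDimensional ℝ A] [FiniteDimensional ℝ B] :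
    Continuous (resl : (OSum A B ≃ₗᵢ[ℝ] V) → (A →ₗᵢ[ℝ] V)) :=
  continuous_li_iff.2 fun _ => continuous_lie_eval.comp (continuous_id.prodMk continuous_const)

theorem continuous_resr [FiniteDimensional ℝ A] [FiniteDimensional ℝ B] :
    Continuous (resr : (OSum A B ≃ₗᵢ[ℝ] V) → (B →ₗᵢ[ℝ] V)) :=
  continuous_li_iff.2 fun _ => continuous_lie_eval.comp (continuous_id.prodMk continuous_const)

theorem continuous_sumMap [FiniteDimensional ℝ A] [FiniteDimensional ℝ B] [FiniteDimensional ℝ V] :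
    Continuous
    fun p : (OSum A B ≃ₗᵢ[ℝ] V) × (NT n A × NT n B) =>
      sumMap n p.1 p.2.1 p.2.2 := by
  simp only [sumMap_eq]
  have h : Continuous fun p : (OSum A B ≃ₗᵢ[ℝ] V) × (NT n A × NT n B) => p.1 := continuous_fst
  have hs : Continuous fun p : (OSum A B ≃ₗᵢ[ℝ] V) × (NT n A × NT n B) => p.2.1 :=
    continuous_fst.comp continuous_snd
  have ht : Continuous fun p : (OSum A B ≃ₗᵢ[ℝ] V) × (NT n A × NT n B) => p.2.2 :=
    continuous_snd.comp continuous_snd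
  exact ((continuous_resl.comp h).tmap hs).add ((continuous_resr.comp h).tmap ht)

theorem sumMap_osum (f : A ≃ₗᵢ[ℝ] A') (g : B ≃ₗᵢ[ℝ] B')
    (h : OSum A' B' ≃ₗᵢ[ℝ] V) (s : NT n A) (t : NT n B) :
    sumMap n ((osum f g).trans h) s t =
      sumMap n h (tmap n f.toLinearIsometry s) (tmap n g.toLinearIsometry t) := by
  rw [sumMap_eq, sumMap_eq, ← tmap_comp, ← tmap_comp]
  congr 2
  · congr 1
    refine LinearIsometry.ext fun a => ?_
    simp [resl_apply]
  · congr 1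
    refine LinearIsometry.ext fun a => ?_
    simp [resr_apply]

theorem sumMap_trans (f : V ≃ₗᵢ[ℝ] W) (h : OSum A B ≃ₗᵢ[ℝ] V) (s : NT n A)
    (t : NT n B) :
    sumMap n (h.trans f) s t = tmap n f.toLinearIsometry (sumMap n h s t) :=
  tmap_comp f.toLinearIsometry h.toLinearIsometry _

theorem sumMap_comm (h : OSum A B ≃ₗᵢ[ℝ] V) (s : NT n A) (t : NT n B) :
    sumMap n ((LinearIsometryEquiv.withLpProdComm 2 ℝ B A).trans h) t s = sumMap n h s t := by
  rw [sumMap_eq, sumMap_eq, add_comm]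
  rfl

theorem trot_sumMap (σ : O n) (h : OSum A B ≃ₗᵢ[ℝ] V) (s : NT n A) (t : NT n B) :
    trot σ (sumMap n h s t) = sumMap n h (trot σ s) (trot σ t) := by
  rw [sumMap_eq, sumMap_eq, map_add, trot_tmap, trot_tmap]

end

variable {A B C D E U V W : FDSub 𝒰} {n : ℕ}

theorem sumMap_zero (h : OSum A B ≃ₗᵢ[ℝ] V) (f : FDSub.zero 𝒰 ≃ₗᵢ[ℝ] B) (s : NT n A) :
    sumMap n h s 0 = tmap n (unitIso h f).toLinearIsometry s := by
  rw [sumMap_eq, map_zero, add_zero]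
  congr 2
  refine LinearIsometry.ext fun a => ?_
  exact (unitIso_apply h f a).symm

theorem sumMap_assoc (h : OSum D C ≃ₗᵢ[ℝ] V) (k : OSum A B ≃ₗᵢ[ℝ] D) (e : OSum B C ≃ₗᵢ[ℝ] E)
    (x : NT n A) (y : NT n B) (z : NT n C) :
    sumMap n h (sumMap n k x y) z = sumMap n (assocIso k e h) x (sumMap n e y z) := by
  simp only [sumMap_eq, map_add, ← tmap_comp, add_assoc]
  have h1 : (resl h).comp (resl k) = resl (assocIso k e h) := by
    refine LinearIsometry.ext fun a => ?_
    have := assocIso_apply k e h a 0 0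
    rw [show (WithLp.toLp 2 ((0 : B), (0 : C))) = 0 from rfl, map_zero] at this
    exact this.symm
  have h2 : (resl h).comp (resr k) = (resr (assocIso k e h)).comp (resl e) := by
    refine LinearIsometry.ext fun b => ?_
    exact (assocIso_apply k e h 0 b 0).symm
  have h3 : resr h = (resr (assocIso k e h)).comp (resr e) := by
    refine LinearIsometry.ext fun c => ?_
    have := assocIso_apply k e h 0 0 c
    rw [show (WithLp.toLp 2 ((0 : A), (0 : B))) = 0 from rfl, map_zero] at this
    exact this.symm
  rw [h1, h2, h3]

/-- A continuous family of isometries of finite-dimensional inner product spaces extends to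
one-point compactifications. -/
theorem continuous_onePoint_isometry {T X Z : Type*} [TopologicalSpace T] [NormedAddCommGroup X]
    [InnerProductSpace ℝ X] [FiniteDimensional ℝ X] [NormedAddCommGroup Z] [InnerProductSpace ℝ Z]
    {φ : T → X →ₗᵢ[ℝ] Z} (hφ : Continuous fun p : T × X => φ p.1 p.2) :
    Continuous fun p : T × OnePoint X => OnePoint.map (φ p.1) p.2 := by
  have : ProperSpace X := FiniteDimensional.proper_real X
  refine continuous_opMap (φ := fun t x => φ t x) hφ fun K _ hK => ?_
  obtain ⟨r, hr⟩ := hK.isBounded.subset_closedBall 0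
  refine ⟨Metric.closedBall 0 r, Metric.isClosed_closedBall, isCompact_closedBall _ _,
    fun t x hx => ?_⟩
  simpa using hr hx

variable (n) in
/-- The `ℐ`-space `nS(V) = S^{ℝ^n ⊗ V}` with the action of `O(n)` on `ℝ^n`. -/
noncomputable def nS (𝒰 : Type u) [NormedAddCommGroup 𝒰] [InnerProductSpace ℝ 𝒰] :
    GISpace (O n) 𝒰 where
  toDSpace := ISpace.mk' (fun V => ⟨OnePoint (NT n V), OnePoint.infty⟩)
    (fun f => OnePoint.map (tmap n f.toLinearIsometry))
    (fun U V => KProd.continuous_of_prod (f := fun p : (U ≃ₗᵢ[ℝ] V) × OnePoint (NT n U) =>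
      OnePoint.map (tmap n p.1.toLinearIsometry) p.2) (continuous_onePoint_isometry
      (φ := fun f : U ≃ₗᵢ[ℝ] V => tmap n f.toLinearIsometry)
      ((continuous_toLI.comp continuous_fst).tmap continuous_snd)))
    (fun _ => rfl)
    (fun x => by
      induction x using OnePoint.rec with
      | infty => rfl
      | coe x => exact congrArg OnePoint.some (tmap_id x))
    (fun g f x => by
      induction x using OnePoint.rec with
      | infty => rfl
      | coe x => exact congrArg OnePoint.some (tmap_comp g.toLinearIsometry f.toLinearIsometry x))
  smul σ := OnePoint.map (trot σ)
  continuous_smul U := KProd.continuous_of_prod (f := fun p : O n × OnePoint (NT n U) =>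
      OnePoint.map (trot p.1) p.2) (continuous_onePoint_isometry continuous_trot)
  one_smul {U} (x : OnePoint (NT n U)) := by
    induction x using OnePoint.rec with
    | infty => rfl
    | coe x => exact congrArg OnePoint.some (trot_one x)
  mul_smul {U} σ τ (x : OnePoint (NT n U)) := by
    induction x using OnePoint.rec with
    | infty => rfl
    | coe x => exact congrArg OnePoint.some (trot_mul σ τ x)
  smul_pt _ _ := rfl
  smul_map {U V} σ α (x : OnePoint (NT n U)) := by
    rcases α with f | _
    · induction x using OnePoint.rec with
      | infty => rfl
      | coe x => exact congrArg OnePoint.some (trot_tmap σ f.toLinearIsometry x)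
    · rfl

/-- The point `x ∈ ℝ^n ⊗ V` of the sphere `nS(V)`. -/
def nSpt (x : NT n V) : (nS n 𝒰).obj V := OnePoint.some x

theorem nS_cases {P : (nS n 𝒰).obj V → Prop} (h0 : P ((nS n 𝒰).obj V).pt)
    (h : ∀ x : NT n V, P (nSpt x)) (s : (nS n 𝒰).obj V) : P s :=
  OnePoint.rec (C := P) h0 h s

theorem continuous_nsMul : Continuous fun p : KProd (OSum A B ≃ₗᵢ[ℝ] V)
    (KProd ((nS n 𝒰).obj A) ((nS n 𝒰).obj B)) =>
      (opMap₂ (sumMap n p.1) p.2.1 p.2.2 : (nS n 𝒰).obj V) := by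
  have h : Continuous fun p : (OSum A B ≃ₗᵢ[ℝ] V) × (OnePoint (NT n A) ×
      OnePoint (NT n B)) => opMap₂ (sumMap n p.1) p.2.1 p.2.2 := by
    refine continuous_opMap₂ (φ := fun h s t => sumMap n h s t) continuous_sumMap fun K _ hK => ?_
    obtain ⟨r, hr⟩ := hK.isBounded.subset_closedBall 0
    refine ⟨Metric.closedBall 0 r, Metric.closedBall 0 r, Metric.isClosed_closedBall,
      isCompact_closedBall _ _, Metric.isClosed_closedBall, isCompact_closedBall _ _,
      fun h x y hx => ?_⟩
    have h1 := mem_closedBall_zero_iff.1 (hr hx)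
    have h2 := norm_sumMap h x y
    have h3 := norm_nonneg (sumMap n h x y)
    constructor <;> rw [mem_closedBall_zero_iff] <;>
      nlinarith [norm_nonneg x, norm_nonneg y]
  have h' : Continuous fun p : KProd (OSum A B ≃ₗᵢ[ℝ] V)
      (KProd ((nS n 𝒰).obj A) ((nS n 𝒰).obj B)) =>
      ((p.1, (p.2.1, p.2.2)) : (OSum A B ≃ₗᵢ[ℝ] V) × (OnePoint (NT n A) ×
      OnePoint (NT n B))) :=
    KProd.continuous_fst.prodMk ((KProd.continuous_fst.comp KProd.continuous_snd).prodMk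
      (KProd.continuous_snd.comp KProd.continuous_snd))
  exact h.comp h'

/-- The multiplication `S^{nA} ∧ S^{nB} ≅ S^{n(A ⊕ B)} → S^{nV}` of `nS`. -/
noncomputable def nsMul (n : ℕ) : smash (nS n 𝒰).und (nS n 𝒰).und ⟶ (nS n 𝒰).und :=
  ISpace.homMk
    (fun V => Smash.lift (X := (nS n 𝒰).und) (Y := (nS n 𝒰).und) ((nS n 𝒰).obj V).pt
      (fun h s t => (opMap₂ (sumMap n h) s t : (nS n 𝒰).obj V))
      (fun {A B A' B'} f g h s t => by
        induction s using nS_cases with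
        | h0 => rfl
        | h s =>
          induction t using nS_cases with
          | h0 => rfl
          | h t => exact congrArg OnePoint.some (sumMap_osum f g h s t))
      (fun _ _ => rfl) (fun _ _ => opMap₂_infty _ _))
    (fun V => Smash.continuous_dom (X := (nS n 𝒰).und) (Y := (nS n 𝒰).und) fun A B =>
      continuous_nsMul)
    (fun V => Smash.lift_pt)
    (fun {V W} f => Smash.ind (X := (nS n 𝒰).und) (Y := (nS n 𝒰).und) fun A B h s t => by
      induction s using nS_cases with
      | h0 => rfl
      | h s =>
        induction t using nS_cases with
        | h0 => rfl
        | h t => exact congrArg OnePoint.some (sumMap_trans f h s t))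

theorem nsMul_sgen (h : OSum A B ≃ₗᵢ[ℝ] V) (s : (nS n 𝒰).und.obj A) (t : (nS n 𝒰).und.obj B) :
    (nsMul n).app V (sgen h s t) = opMap₂ (sumMap n h) s t := rfl

theorem nsMul_pt_left (h : OSum A B ≃ₗᵢ[ℝ] V) (t : (nS n 𝒰).und.obj B) :
    (nsMul n).app V (sgen h ((nS n 𝒰).und.obj A).pt t) = ((nS n 𝒰).und.obj V).pt := rfl

theorem nsMul_pt_right (h : OSum A B ≃ₗᵢ[ℝ] V) (s : (nS n 𝒰).und.obj A) :
    (nsMul n).app V (sgen h s ((nS n 𝒰).und.obj B).pt) = ((nS n 𝒰).und.obj V).pt :=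
  opMap₂_infty _ _

theorem nsMul_nSpt (h : OSum A B ≃ₗᵢ[ℝ] V) (s : NT n A) (t : NT n B) :
    (nsMul n).app V (sgen (X := (nS n 𝒰).und) (Y := (nS n 𝒰).und) h (nSpt s) (nSpt t)) =
      nSpt (sumMap n h s t) := rfl

/-- The unit of `nS`, given by `0 ∈ S^{nV}`. -/
noncomputable def nsOne (n : ℕ) : iunit 𝒰 ⟶ (nS n 𝒰).und :=
  ISpace.homMk
    (fun V (f : (FDSub.zero 𝒰 ≃ₗᵢ[ℝ] V) ⊕ PUnit.{u + 1}) => (match f with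
      | Sum.inl _ => nSpt 0
      | Sum.inr _ => ((nS n 𝒰).obj V).pt : (nS n 𝒰).obj V))
    (fun V => continuous_sum_dom.2 ⟨continuous_const, continuous_const⟩)
    (fun V => rfl)
    (fun {V W} g f => by
      rcases f with f | f
      · exact congrArg OnePoint.some (map_zero (tmap n g.toLinearIsometry)).symm
      · rfl)

variable [Fact (Module.rank ℝ 𝒰 = Cardinal.aleph0)]

/-- The commutative monoid `nS`, in `O(n)`-equivariant `ℐ`-spaces. -/
noncomputable def nSMonoid (𝒰 : Type u) [NormedAddCommGroup 𝒰] [InnerProductSpace ℝ 𝒰]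
    [Fact (Module.rank ℝ 𝒰 = Cardinal.aleph0)] (n : ℕ) : GCommMonoidStr (nS n 𝒰) where
  one := nsOne n
  mul := nsMul n
  mul_one := smash_hom_ext fun A B V h s f => by
    rcases f with f | f
    · induction s using nS_cases with
      | h0 => rfl
      | h s => exact congrArg OnePoint.some (sumMap_zero h f s)
    · exact nsMul_pt_right h s
  one_mul := smash_hom_ext fun A B V h f t => by
    rcases f with f | f
    · induction t using nS_cases with
      | h0 => rfl
      | h t => exact congrArg OnePoint.some ((sumMap_comm h 0 t).symm.trans (sumMap_zero _ f t))
    · rfl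
  mul_assoc := smash_hom_ext (X := smash (nS n 𝒰).und (nS n 𝒰).und) fun D C V h q z => by
    revert q
    refine Smash.ind (X := (nS n 𝒰).und) (Y := (nS n 𝒰).und) fun A B k x y => ?_
    change (nsMul n).app V (sgen h ((nsMul n).app D (sgen k x y)) z) =
      (nsMul n).app V (sgen (assocIso k (sumIso B C) h) x
        ((nsMul n).app _ (sgen (sumIso B C) y z)))
    induction x using nS_cases with
    | h0 => rw [nsMul_pt_left, nsMul_pt_left, nsMul_pt_left]
    | h x =>
      induction y using nS_cases with
      | h0 => rw [nsMul_pt_right, nsMul_pt_left, nsMul_pt_left, nsMul_pt_right]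
      | h y =>
        induction z using nS_cases with
        | h0 => rw [nsMul_pt_right, nsMul_pt_right, nsMul_pt_right]
        | h z => exact congrArg OnePoint.some (sumMap_assoc h k (sumIso B C) x y z)
  mul_comm := smash_hom_ext fun A B V h s t => by
    induction s using nS_cases with
    | h0 => exact nsMul_pt_right _ t
    | h s =>
      induction t using nS_cases with
      | h0 => rfl
      | h t => exact congrArg OnePoint.some (sumMap_comm h s t)
  smul_one U σ f := by
    rcases f with f | f
    · exact congrArg OnePoint.some (map_zero (trot σ))
    · rfl
  smul_mul U σ := Smash.ind (X := (nS n 𝒰).und) (Y := (nS n 𝒰).und) fun A B h s t => by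
    induction s using nS_cases with
    | h0 => rfl
    | h s =>
      induction t using nS_cases with
      | h0 => rfl
      | h t => exact congrArg OnePoint.some (trot_sumMap σ h s t).symm

end SphereMonoid

section Jet

variable {A U V W X : FDSub 𝒰} {n : ℕ}

/-- The total space of the bundle `γ_n(V, W)` over the space of linear isometries `V → W`, with
fibre `ℝ^n ⊗ (W - f(V))` over `f`. -/
def Gamma (n : ℕ) (V W : FDSub 𝒰) : Type u :=
  {p : (V →ₗᵢ[ℝ] W) × NT n W // p.2 ∈ jetFib n p.1}

noncomputable instance : TopologicalSpace (Gamma n V W) :=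
  inferInstanceAs (TopologicalSpace {p : (V →ₗᵢ[ℝ] W) × NT n W // p.2 ∈ jetFib n p.1})

theorem isClosedEmbedding_gamma : IsClosedEmbedding
    (Subtype.val : Gamma n V W → (V →ₗᵢ[ℝ] W) × NT n W) where
  toIsEmbedding := .subtypeVal
  isClosed_range := by
    have h : Set.range (Subtype.val : Gamma n V W → (V →ₗᵢ[ℝ] W) × NT n W) =
        ⋂ (a : RN n) (v : V), {p | inner ℝ p.2 (a ⊗ₜ p.1 v) = 0} := by
      ext p
      simp only [Set.mem_iInter, Set.mem_ofPred_eq]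
      rw [← mem_jetFib_iff]
      exact ⟨fun ⟨q, hq⟩ => hq ▸ q.2, fun hp => ⟨⟨p, hp⟩, rfl⟩⟩
    rw [h]
    refine isClosed_iInter fun a => isClosed_iInter fun v => isClosed_eq ?_ continuous_const
    have h1 : Continuous fun p : (V →ₗᵢ[ℝ] W) × NT n W => p.1 v :=
      continuous_li_eval.comp (continuous_fst.prodMk continuous_const)
    have h2 : Continuous fun p : (V →ₗᵢ[ℝ] W) × NT n W => (a ⊗ₜ p.1 v : NT n W) :=
      TensorProduct.continuous_tmul.comp (continuous_const.prodMk h1)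
    exact continuous_snd.inner h2

noncomputable instance (V : FDSub 𝒰) : ProperSpace (NT n V) := FiniteDimensional.proper_real _

instance : T2Space (Gamma n V W) := isClosedEmbedding_gamma.isEmbedding.t2Space

instance : LocallyCompactSpace (Gamma n V W) := isClosedEmbedding_gamma.locallyCompactSpace

/-- The disc bundle. -/
def Gamma.disc (n : ℕ) (V W : FDSub 𝒰) (r : ℝ) : Set (Gamma n V W) := {p | ‖p.1.2‖ ≤ r}

theorem isCompact_gamma (r : ℝ) : IsCompact (Gamma.disc n V W r) := by
  have h := isClosedEmbedding_gamma (n := n) (V := V) (W := W) |>.isCompact_preimage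
    (isCompact_univ.prod (isCompact_closedBall (0 : NT n W) r))
  refine (congrArg IsCompact (Set.ext fun p => ?_)).mp h
  exact ⟨fun hp => mem_closedBall_zero_iff.1 hp.2,
    fun hp => ⟨trivial, mem_closedBall_zero_iff.2 hp⟩⟩

theorem bounded_gamma {K : Set (Gamma n V W)} (hK : IsCompact K) :
    ∃ r, ∀ p ∈ K, p ∈ Gamma.disc n V W r := by
  obtain ⟨r, hr⟩ := (hK.image (continuous_snd.comp continuous_subtype_val)).isBounded
    |>.subset_closedBall 0
  exact ⟨r, fun p hp => mem_closedBall_zero_iff.1 (hr ⟨p, hp, rfl⟩)⟩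

/-- The identity `(id, 0)`. -/
noncomputable def Gamma.one (V : FDSub 𝒰) : Gamma n V V := ⟨(LinearIsometry.id, 0), zero_mem _⟩

/-- The composition `(f, x)(g, y) = (fg, x + f_* y)`. -/
noncomputable def Gamma.comp (p : Gamma n V W) (q : Gamma n U V) : Gamma n U W :=
  ⟨(p.1.1.comp q.1.1, p.1.2 + tmap n p.1.1 q.1.2), by
    refine add_mem (mem_jetFib_iff.2 fun a u => mem_jetFib_iff.1 p.2 a (q.1.1 u))
      (mem_jetFib_iff.2 fun a u => ?_)
    change inner ℝ (tmap n p.1.1 q.1.2) (tmap n p.1.1 (a ⊗ₜ q.1.1 u)) = 0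
    rw [LinearIsometry.inner_map_map]
    exact mem_jetFib_iff.1 q.2 a u⟩

/-- The action `σ (f, x) = (f, (σ ⊗ 1) x)` of `O(n)`. -/
noncomputable def Gamma.smul (σ : O n) (p : Gamma n V W) : Gamma n V W :=
  ⟨(p.1.1, trot σ p.1.2), by
    obtain ⟨t, ht⟩ := p.2
    exact ⟨trot σ t, (trot_tmap σ _ t).symm.trans (congrArg (trot σ) ht)⟩⟩

theorem Gamma.one_comp (p : Gamma n V W) : (Gamma.one W).comp p = p :=
  Subtype.ext (Prod.ext (LinearIsometry.ext fun _ => rfl)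
    ((zero_add _).trans (tmap_id _)))

theorem Gamma.comp_one (p : Gamma n V W) : p.comp (Gamma.one V) = p :=
  Subtype.ext (Prod.ext (LinearIsometry.ext fun _ => rfl)
    ((congrArg (p.1.2 + ·) (map_zero _)).trans (add_zero _)))

theorem Gamma.comp_assoc (p : Gamma n W X) (q : Gamma n V W) (r : Gamma n U V) :
    (p.comp q).comp r = p.comp (q.comp r) := by
  refine Subtype.ext (Prod.ext (LinearIsometry.ext fun _ => rfl) ?_)
  change p.1.2 + tmap n p.1.1 q.1.2 + tmap n (p.1.1.comp q.1.1) r.1.2 =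
    p.1.2 + tmap n p.1.1 (q.1.2 + tmap n q.1.1 r.1.2)
  rw [map_add, tmap_comp, add_assoc]

theorem Gamma.smul_comp (σ : O n) (p : Gamma n V W) (q : Gamma n U V) :
    (p.comp q).smul σ = (p.smul σ).comp (q.smul σ) := by
  refine Subtype.ext (Prod.ext rfl ?_)
  change trot σ (p.1.2 + tmap n p.1.1 q.1.2) = trot σ p.1.2 + tmap n p.1.1 (trot σ q.1.2)
  rw [map_add, trot_tmap]

theorem Gamma.continuous_comp : Continuous
    fun p : Gamma n V W × Gamma n U V => p.1.comp p.2 := by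
  have h1 : Continuous fun p : Gamma n V W × Gamma n U V => p.1.1 :=
    continuous_subtype_val.comp continuous_fst
  have h2 : Continuous fun p : Gamma n V W × Gamma n U V => p.2.1 :=
    continuous_subtype_val.comp continuous_snd
  refine Continuous.subtype_mk (Continuous.prodMk ?_ ?_) _
  · refine continuous_li_iff.2 fun v => ?_
    have h3 : Continuous fun p : Gamma n V W × Gamma n U V => p.2.1.1 v :=
      continuous_li_eval.comp ((continuous_fst.comp h2).prodMk continuous_const)
    exact continuous_li_eval.comp ((continuous_fst.comp h1).prodMk h3)
  · exact (continuous_snd.comp h1).add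
      ((continuous_fst.comp h1).tmap (continuous_snd.comp h2))

theorem Gamma.continuous_smul : Continuous fun p : O n × Gamma n V W => p.2.smul p.1 := by
  have h : Continuous fun p : O n × Gamma n V W => p.2.1 :=
    continuous_subtype_val.comp continuous_snd
  exact Continuous.subtype_mk ((continuous_fst.comp h).prodMk
    (continuous_fst.trot (continuous_snd.comp h))) _

theorem Gamma.continuous_opComp : Continuous
    fun p : OnePoint (Gamma n V W) × OnePoint (Gamma n U V) => opMap₂ Gamma.comp p.1 p.2 := by
  have h : Continuous fun p : Unit × (OnePoint (Gamma n V W) × OnePoint (Gamma n U V)) =>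
      opMap₂ Gamma.comp p.2.1 p.2.2 := by
    refine continuous_opMap₂ (φ := fun _ p q => Gamma.comp p q)
      (Gamma.continuous_comp.comp continuous_snd) fun K _ hK => ?_
    obtain ⟨r, hr⟩ := bounded_gamma hK
    have key : ∀ (p : Gamma n V W) (q : Gamma n U V), p.comp q ∈ Gamma.disc n U W r →
        p ∈ Gamma.disc n V W r ∧ q ∈ Gamma.disc n U V r := by
      intro p q hpq
      have h1 : ‖p.1.2 + tmap n p.1.1 q.1.2‖ ≤ r := hpq
      have h2 := norm_add_tmap p.2 q.1.2
      have h3 := norm_nonneg (p.1.2 + tmap n p.1.1 q.1.2)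
      generalize ‖p.1.2 + tmap n p.1.1 q.1.2‖ = c at h1 h2 h3
      have h4 := norm_nonneg p.1.2
      have h5 := norm_nonneg q.1.2
      constructor
      · change ‖p.1.2‖ ≤ r
        generalize ‖p.1.2‖ = a at *
        generalize ‖q.1.2‖ = b at *
        nlinarith
      · change ‖q.1.2‖ ≤ r
        generalize ‖p.1.2‖ = a at *
        generalize ‖q.1.2‖ = b at *
        nlinarith
    exact ⟨Gamma.disc n V W r, Gamma.disc n U V r, (isCompact_gamma r).isClosed, isCompact_gamma r,
      (isCompact_gamma r).isClosed, isCompact_gamma r, fun _ p q hpq => key p q (hr _ hpq)⟩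
  exact h.comp (f := fun p => ((), p)) (continuous_const.prodMk continuous_id)

theorem Gamma.continuous_opSmul : Continuous
    fun p : O n × OnePoint (Gamma n V W) => OnePoint.map (Gamma.smul p.1) p.2 := by
  refine continuous_opMap (φ := fun (σ : O n) (p : Gamma n V W) => p.smul σ)
    Gamma.continuous_smul fun K _ hK => ?_
  obtain ⟨r, hr⟩ := bounded_gamma hK
  have key : ∀ (σ : O n) (p : Gamma n V W), p.smul σ ∈ Gamma.disc n V W r →
      p ∈ Gamma.disc n V W r := fun σ p hp => ((trot σ).norm_map p.1.2).symm.trans_le hp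
  exact ⟨Gamma.disc n V W r, (isCompact_gamma r).isClosed, isCompact_gamma r,
    fun σ p hp => key σ p (hr _ hp)⟩

/-- The `n`-th jet category `𝒥_n`: the space of morphisms `V → W` is the Thom space of
`γ_n(V, W)`, i.e. the one-point compactification of its total space (the base is compact). -/
noncomputable def jet (𝒰 : Type u) [NormedAddCommGroup 𝒰] [InnerProductSpace ℝ 𝒰] (n : ℕ) :
    GTopCategory (O n) (FDSub 𝒰) where
  Hom V W := ⟨OnePoint (Gamma n V W), OnePoint.infty⟩
  one V := OnePoint.some (Gamma.one V)
  comp β α := opMap₂ Gamma.comp β α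
  continuous_comp _ _ _ := KProd.continuous_of_prod Gamma.continuous_opComp
  comp_pt β := opMap₂_infty _ β
  pt_comp _ := rfl
  one_comp {U V} (α : OnePoint (Gamma n U V)) := by
    induction α using OnePoint.rec with
    | infty => rfl
    | coe p => exact congrArg OnePoint.some p.one_comp
  comp_one {U V} (α : OnePoint (Gamma n U V)) := by
    induction α using OnePoint.rec with
    | infty => rfl
    | coe p => exact congrArg OnePoint.some p.comp_one
  comp_assoc {U V W X} (γ : OnePoint (Gamma n W X)) (β : OnePoint (Gamma n V W))
      (α : OnePoint (Gamma n U V)) := by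
    induction γ using OnePoint.rec with
    | infty => rfl
    | coe p =>
      induction β using OnePoint.rec with
      | infty => rfl
      | coe q =>
        induction α using OnePoint.rec with
        | infty => rfl
        | coe r => exact congrArg OnePoint.some (p.comp_assoc q r)
  smul σ := OnePoint.map (Gamma.smul σ)
  continuous_smul _ _ := KProd.continuous_of_prod Gamma.continuous_opSmul
  one_smul {U V} (α : OnePoint (Gamma n U V)) := by
    induction α using OnePoint.rec with
    | infty => rfl
    | coe p => exact congrArg OnePoint.some (Subtype.ext (Prod.ext rfl (trot_one p.1.2)))
  mul_smul {U V} σ τ (α : OnePoint (Gamma n U V)) := by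
    induction α using OnePoint.rec with
    | infty => rfl
    | coe p => exact congrArg OnePoint.some (Subtype.ext (Prod.ext rfl (trot_mul σ τ p.1.2)))
  smul_pt _ := rfl
  smul_one V σ := congrArg OnePoint.some (Subtype.ext (Prod.ext rfl (map_zero (trot σ))))
  smul_comp {U V W} σ (β : OnePoint (Gamma n V W)) (α : OnePoint (Gamma n U V)) := by
    induction β using OnePoint.rec with
    | infty => rfl
    | coe p =>
      induction α using OnePoint.rec with
      | infty => rfl
      | coe q => exact congrArg OnePoint.some (Gamma.smul_comp σ p q)

/-- The point `(f, x)` of `𝒥_n(V, W)`. -/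
def jetPt (f : V →ₗᵢ[ℝ] W) (x : NT n W) (hx : x ∈ jetFib n f) : (jet 𝒰 n).Hom V W :=
  OnePoint.some ⟨(f, x), hx⟩

theorem resr_mem_jetFib (h : OSum U A ≃ₗᵢ[ℝ] V) (x : NT n A) :
    tmap n (resr h) x ∈ jetFib n (resl h) := by
  refine mem_jetFib_iff.2 fun a v => ?_
  exact (real_inner_comm (tmap n (resl h) (a ⊗ₜ v)) (tmap n (resr h) x)).trans
    (inner_tmap_tmap (inner_resl_resr h) (a ⊗ₜ v) x)

variable [Fact (Module.rank ℝ 𝒰 = Cardinal.aleph0)]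

/-- The underlying `ℐ`-space of the free module `U^* ∧ nS`. -/
noncomputable abbrev freeSpace (n : ℕ) (U : FDSub 𝒰) : ISpace 𝒰 :=
  smash (DSpace.repr (isoCat 𝒰) U) (nS n 𝒰).und

/-- The point `[h; f, x]` of `(U^* ∧ nS)(V)`, for `h : U' ⊕ A ≅ V`, `f : U ≅ U'` and
`x ∈ ℝ^n ⊗ A`. -/
noncomputable def freePt {U' : FDSub 𝒰} (h : OSum U' A ≃ₗᵢ[ℝ] V) (f : U ≃ₗᵢ[ℝ] U') (x : NT n A) :
    (freeSpace n U).obj V :=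
  sgen (X := DSpace.repr (isoCat 𝒰) U) (Y := (nS n 𝒰).und) h
    (Sum.inl f : (U ≃ₗᵢ[ℝ] U') ⊕ PUnit.{u + 1}) (nSpt x)

/-- The free `nS`-module `U^* ∧ nS` in `O(n)`-equivariant `ℐ`-spaces. -/
noncomputable abbrev freeMod (n : ℕ) (U : FDSub 𝒰) : GIModule (nSMonoid 𝒰 n) :=
  GIModule.freeRepr (nSMonoid 𝒰 n) U

/-- The diagram category of `nS`, with its action of `O(n)`. -/
noncomputable abbrev diagram (𝒰 : Type u) [NormedAddCommGroup 𝒰] [InnerProductSpace ℝ 𝒰]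
    [Fact (Module.rank ℝ 𝒰 = Cardinal.aleph0)] (n : ℕ) : GTopCategory (O n) (FDSub 𝒰) :=
  GIModule.diagramCategory (nSMonoid 𝒰 n)

/-- The component at `W` of an element of the diagram category, as a map
`(V^* ∧ nS)(W) → (U^* ∧ nS)(W)`. -/
noncomputable def diagramApp (φ : (diagram 𝒰 n).Hom U V) (W : FDSub 𝒰) :
    (freeSpace n V).obj W → (freeSpace n U).obj W :=
  (IModule.Hom.hom φ).app W

/-- The canonical generator of the free module `V^* ∧ nS`: the point of `(V^* ∧ nS)(V)` given by
the identity of `V` and the unit of `nS`. -/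
noncomputable def freeGen (n : ℕ) (V : FDSub 𝒰) : (freeSpace n V).obj V :=
  freePt (ozero V) (.refl ℝ V) 0

end Jet

end OrthCalc

/-!
A module map out of the free module `U^* ∧ nS` is determined by the image of its generator, which
may be any point, so that `nS-mod(U^* ∧ nS, M) ≅ M(U)` as spaces (`IModule.evalGen`). In particular
`nS-mod(V^* ∧ nS, U^* ∧ nS)` is the space `(U^* ∧ nS)(V)`. Its points are the basepoint and the
classes `[h; id, s]` with `h : U ⊕ A ≅ V` and `s ∈ S^{ℝ^n ⊗ A}`, and `[h; id, s]` depends only on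
the isometry `h|_U` and the point `(ℝ^n ⊗ h|_A) s`, because two splittings `U ⊕ A ≅ V` and
`U ⊕ B ≅ V` of the same isometry differ by an isometry `A ≅ B` (`exists_iso_of_resl_eq`). Since
every isometry `U → V` has a splitting (`exists_splitting`), this gives a continuous bijection
`(U^* ∧ nS)(V) → 𝒥_n(U, V)` from a compact space to a Hausdorff space (`freeHomeoJet`). Under these
identifications both compositions add the points of the spheres, and the conjugation action is the
action on the spheres, as the generator is fixed by `O(n)`. This is the isomorphism `jetIso`.

Precomposition with the module map of the jet of `(h, s)` becomes, under evaluation at the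
generators, the action of `s` along `h` (`evalFree_jetHomeo_comp`). The functor that sends a module
`M` to `U ↦ nS-mod(U^* ∧ nS, M)` is therefore fully faithful: a family of maps `M(U) → N(U)` that is
compatible with all jets is compatible with the action of `nS`, hence with the action of
isometries, which is multiplication by the unit. It is essentially surjective, because a
`𝒥_n`-space `E` is a module with the action `[h; x, s] ↦ E(h|_U, (ℝ^n ⊗ h|_A) s) x` (`moduleOf`).
All of this is compatible with the actions of `O(n)`, which gives the equivariant equivalence.
-/

namespace OrthCalc

/-! ### Maps out of free modules on represented spaces -/

section FreeModules

variable {𝒰 : Type u} [NormedAddCommGroup 𝒰] [InnerProductSpace ℝ 𝒰]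
  [Fact (Module.rank ℝ 𝒰 = Cardinal.aleph0)] {R : ISpace 𝒰} {m : CommMonoidStr R}
  {A B C D E U V W : FDSub 𝒰}

theorem CommMonoidStr.one_mul_apply (m : CommMonoidStr R) (h : OSum A B ≃ₗᵢ[ℝ] V)
    (f : FDSub.zero 𝒰 ≃ₗᵢ[ℝ] A) (r : R.obj B) :
    m.mul.app V (sgen h (m.one.app A (Sum.inl f)) r) =
      R.tr (unitIso ((LinearIsometryEquiv.withLpProdComm 2 ℝ B A).trans h) f) r :=
  congrArg (fun k : smash (iunit 𝒰) R ⟶ R => k.app V (sgen (X := iunit 𝒰) h (Sum.inl f) r))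
    m.one_mul

namespace IModule

theorem act_mul_apply (M : IModule m) (h : OSum D C ≃ₗᵢ[ℝ] V) (k : OSum A B ≃ₗᵢ[ℝ] D)
    (e : OSum B C ≃ₗᵢ[ℝ] E) (x : M.X.obj A) (r : R.obj B) (s : R.obj C) :
    M.act.app V (sgen h (M.act.app D (sgen k x r)) s) =
      M.act.app V (sgen (assocIso k e h) x (m.mul.app E (sgen e r s))) := by
  have := congrArg (fun f : smash (smash M.X R) R ⟶ M.X =>
    f.app V (sgen (X := smash M.X R) h (sgen k x r) s)) M.act_mul
  refine this.trans ?_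
  simp only [DSpace.comp_app]
  rw [sassoc_sgen h k e]
  rfl

/-- The action of isometric isomorphisms on a module is part of the action of the ring: it is
multiplication by the unit. -/
theorem tr_eq_act_one (M : IModule m) (f : U ≃ₗᵢ[ℝ] V) (x : M.X.obj U) :
    M.X.tr f x = M.act.app V (sgen ((ozero U).trans f) x
      (m.one.app (FDSub.zero 𝒰) (Sum.inl (.refl ℝ _)))) := by
  rw [act_one_apply]
  congr 1

/-- The extension of a map `X → M` of `ℐ`-spaces to a module map `X ∧ R → M`. -/
noncomputable def extend {X : ISpace 𝒰} (M : IModule m) (φ : X ⟶ M.X) : free m X ⟶ M where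
  hom := smashMap φ (𝟙 R) ≫ M.act
  comm := by
    refine smash_hom_ext (X := smash X R) fun D C V h q s => ?_
    revert q
    refine Smash.ind fun A B k x r => ?_
    change M.act.app V (sgen h (M.act.app D (sgen k (φ.app A x) r)) s) =
      (smashMap φ (𝟙 R) ≫ M.act).app V ((freeAct m X).app V
        (sgen (X := smash X R) h (sgen k x r) s))
    rw [freeAct_sgen m h k (sumIso B C), act_mul_apply M h k (sumIso B C)]
    rfl

/-- The Yoneda map `U^* → X` of a point of `X(U)`. -/
def yoneda (X : ISpace 𝒰) (x : X.obj U) : DSpace.repr (isoCat 𝒰) U ⟶ X where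
  app _ α := X.map α x
  continuous_app V := (X.continuous_map U V).comp
    (KProd.continuous_mk continuous_id continuous_const)
  app_pt _ := X.pt_map x
  naturality β α := X.map_comp β α x

/-- The module map `U^* ∧ R → M` that sends the generator to `x`. -/
noncomputable def ofPoint (M : IModule m) (x : M.X.obj U) :
    free m (DSpace.repr (isoCat 𝒰) U) ⟶ M :=
  extend M (yoneda M.X x)

/-- The generator of `U^* ∧ R`: the identity of `U` smashed with the unit of `R`. -/
noncomputable def generator (m : CommMonoidStr R) (U : FDSub 𝒰) :
    (free m (DSpace.repr (isoCat 𝒰) U)).X.obj U :=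
  sgen (X := DSpace.repr (isoCat 𝒰) U) (ozero U) ((isoCat 𝒰).one U)
    (m.one.app (FDSub.zero 𝒰) (Sum.inl (.refl ℝ _)))

/-- The generator generates `U^* ∧ R`: the class `[h; f, r]` is `r` acting along `h` on the
translate of the generator by `f`. -/
theorem sgen_eq_act_generator (h : OSum A B ≃ₗᵢ[ℝ] V) (f : U ≃ₗᵢ[ℝ] A) (r : R.obj B) :
    sgen (X := DSpace.repr (isoCat 𝒰) U) h (Sum.inl f : (U ≃ₗᵢ[ℝ] A) ⊕ PUnit.{u + 1}) r =
      (free m (DSpace.repr (isoCat 𝒰) U)).act.app V (sgen h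
        ((free m (DSpace.repr (isoCat 𝒰) U)).X.tr f (generator m U)) r) := by
  let e : OSum (FDSub.zero 𝒰) B ≃ₗᵢ[ℝ] B :=
    (LinearIsometryEquiv.withLpProdComm 2 ℝ (FDSub.zero 𝒰) B).trans (ozero B)
  have h1 : (free m (DSpace.repr (isoCat 𝒰) U)).act.app V (sgen h
        ((free m (DSpace.repr (isoCat 𝒰) U)).X.tr f (generator m U)) r) =
      sgen (X := DSpace.repr (isoCat 𝒰) U) (assocIso ((ozero U).trans f) e h)
        ((isoCat 𝒰).one U) (m.mul.app B (sgen e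
          (m.one.app (FDSub.zero 𝒰) (Sum.inl (.refl ℝ _))) r)) :=
    freeAct_sgen m h ((ozero U).trans f) e _ _ r
  have h2 : unitIso ((LinearIsometryEquiv.withLpProdComm 2 ℝ B (FDSub.zero 𝒰)).trans e)
      (.refl ℝ _) = .refl ℝ B := by
    ext b
    rw [unitIso_apply]
    rfl
  have h3 := sgen_eq (X := DSpace.repr (isoCat 𝒰) U) f (.refl ℝ B)
    (assocIso ((ozero U).trans f) e h) h ((isoCat 𝒰).one U) r fun a b => by
      obtain ⟨⟨z, b⟩, rfl⟩ := e.surjective b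
      rw [assocIso_apply]
      rfl
  rw [R.tr_refl] at h3
  rw [h1, m.one_mul_apply, h2, R.tr_refl]
  exact h3.symm

theorem ofPoint_generator (M : IModule m) (x : M.X.obj U) :
    (ofPoint M x).hom.app U (generator m U) = x := by
  have := (tr_eq_act_one M (.refl ℝ U) x).symm
  rw [M.X.tr_refl] at this
  refine Eq.trans ?_ this
  change M.act.app U (sgen _ (M.X.map ((isoCat 𝒰).one U) x) _) = _
  rw [M.X.map_one]
  rfl

theorem app_sgen_eq {M : IModule m} (φ : free m (DSpace.repr (isoCat 𝒰) U) ⟶ M)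
    (h : OSum A B ≃ₗᵢ[ℝ] V) (f : U ≃ₗᵢ[ℝ] A) (r : R.obj B) :
    φ.hom.app V (sgen (X := DSpace.repr (isoCat 𝒰) U) h
        (Sum.inl f : (U ≃ₗᵢ[ℝ] A) ⊕ PUnit.{u + 1}) r) =
      M.act.app V (sgen h (M.X.tr f (φ.hom.app U (generator m U))) r) := by
  rw [sgen_eq_act_generator (m := m), ← φ.comm_apply, ISpace.hom_tr]

/-- A module map out of `U^* ∧ R` is determined by the image of the generator. -/
theorem ofPoint_app_generator {M : IModule m} (φ : free m (DSpace.repr (isoCat 𝒰) U) ⟶ M) :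
    ofPoint M (φ.hom.app U (generator m U)) = φ := by
  refine hom_ext' fun V => Smash.ind fun A B h α r => ?_
  rcases α with f | _
  · exact (app_sgen_eq φ h f r).symm
  · have h0 := Smash.gen_pt_left (X := DSpace.repr (isoCat 𝒰) U) h r
    exact (congrArg _ h0).trans ((DSpace.Hom.app_pt _ _).trans
      ((congrArg _ h0).trans (φ.hom.app_pt V)).symm)

theorem continuous_ofPoint (M : IModule m) :
    Continuous fun x : M.X.obj U =>
      (show mapSpace (free m (DSpace.repr (isoCat 𝒰) U)) M from ofPoint M x) := by
  refine continuous_mapSpace fun V => ?_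
  refine Smash.continuous_dom_right (X := DSpace.repr (isoCat 𝒰) U) (Y := R) fun A B => ?_
  let P := KProd (M.X.obj U) (KProd (OSum A B ≃ₗᵢ[ℝ] V)
    (KProd ((DSpace.repr (isoCat 𝒰) U).obj A) (R.obj B)))
  have h1 : Continuous fun p : P => (p.1 : M.X.obj U) := KProd.continuous_fst
  have h2 : Continuous fun p : P => (p.2.1 : OSum A B ≃ₗᵢ[ℝ] V) :=
    KProd.continuous_fst.comp KProd.continuous_snd
  have h3 : Continuous fun p : P => (p.2.2.1 : (isoCat 𝒰).Hom U A) :=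
    KProd.continuous_fst.comp (KProd.continuous_snd.comp KProd.continuous_snd)
  have h4 : Continuous fun p : P => (p.2.2.2 : R.obj B) :=
    KProd.continuous_snd.comp (KProd.continuous_snd.comp KProd.continuous_snd)
  have h5 : Continuous fun p : P => M.X.map (p.2.2.1 : (isoCat 𝒰).Hom U A) p.1 :=
    (M.X.continuous_map U A).comp (KProd.continuous_mk h3 h1)
  exact (M.act.continuous_app V).comp (Continuous.sgen h2 h5 h4)

theorem continuous_app_generator (M : IModule m) :
    Continuous fun φ : mapSpace (free m (DSpace.repr (isoCat 𝒰) U)) M =>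
      Hom.hom φ |>.app U (generator m U) :=
  (continuous_eval U).comp (KProd.continuous_mk continuous_id continuous_const)

/-- Evaluation at the generator, as a homeomorphism between the space of module maps `U^* ∧ R → M`
and `M(U)`. -/
noncomputable def evalGen (M : IModule m) (U : FDSub 𝒰) :
    mapSpace (free m (DSpace.repr (isoCat 𝒰) U)) M ≃ₜ M.X.obj U where
  toFun φ := Hom.hom φ |>.app U (generator m U)
  invFun := ofPoint M
  left_inv := ofPoint_app_generator
  right_inv := ofPoint_generator M
  continuous_toFun := continuous_app_generator M
  continuous_invFun := continuous_ofPoint M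

end IModule

end FreeModules

/-! ### Splitting isometries -/

section Splitting

variable {𝒰 : Type u} [NormedAddCommGroup 𝒰] [InnerProductSpace ℝ 𝒰]
  {A B C U V W : FDSub 𝒰} {n : ℕ}

theorem FDSub.nonempty_iso_of_osum (h : OSum U A ≃ₗᵢ[ℝ] V) (h' : OSum U B ≃ₗᵢ[ℝ] V) :
    Nonempty (A ≃ₗᵢ[ℝ] B) := by
  have h1 := (h.trans h'.symm).toLinearEquiv.finrank_eq
  rw [(WithLp.linearEquiv 2 ℝ (U × A)).finrank_eq, (WithLp.linearEquiv 2 ℝ (U × B)).finrank_eq,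
    Module.finrank_prod, Module.finrank_prod] at h1
  exact ⟨(stdOrthonormalBasis ℝ A).equiv (stdOrthonormalBasis ℝ B)
    (finCongr (Nat.add_left_cancel h1))⟩

/-- Two splittings of the same isometry `U → V` differ by an isometry of the complements. -/
theorem exists_iso_of_resl_eq (h : OSum U A ≃ₗᵢ[ℝ] V) (h' : OSum U B ≃ₗᵢ[ℝ] V)
    (H : resl h = resl h') :
    ∃ g : A ≃ₗᵢ[ℝ] B, ∀ u a, h (.toLp 2 (u, a)) = h' (.toLp 2 (u, g a)) := by
  have hl : ∀ u, h (.toLp 2 (u, 0)) = h' (.toLp 2 (u, 0)) := fun u =>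
    congrArg (fun f : U →ₗᵢ[ℝ] V => f u) H
  -- `h'⁻¹ h` is the identity on `U`, so it carries `A`, the orthogonal complement of `U`, into `B`
  have h0 : ∀ a, (h'.symm (h (.toLp 2 (0, a)))).fst = 0 := fun a => by
    refine ext_inner_right ℝ fun u => ?_
    have h1 : inner ℝ (h'.symm (h (.toLp 2 (0, a)))) (.toLp 2 (u, 0) : OSum U B) = 0 := by
      rw [← h'.inner_map_map, h'.apply_symm_apply, ← hl, h.inner_map_map]
      simp
    simpa using h1
  have hk : ∀ a, h'.symm (h (.toLp 2 (0, a))) =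
      .toLp 2 (0, (h'.symm (h (.toLp 2 (0, a)))).snd) := fun a => by
    conv_lhs => rw [← WithLp.toLp_ofLp 2 (h'.symm (h (.toLp 2 (0, a))))]
    congr 1
    exact Prod.ext (h0 a) rfl
  let k : A →ₗᵢ[ℝ] B :=
    { toLinearMap := (LinearMap.snd ℝ U B) ∘ₗ (WithLp.linearEquiv 2 ℝ (U × B)).toLinearMap ∘ₗ
        (resr (h.trans h'.symm)).toLinearMap
      norm_map' := fun a => by
        have h1 := (resr (h.trans h'.symm)).norm_map a
        rw [resr_apply, LinearIsometryEquiv.trans_apply, hk, WithLp.norm_toLp_snd] at h1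
        exact h1 }
  obtain ⟨e⟩ := FDSub.nonempty_iso_of_osum h h'
  refine ⟨k.toLinearIsometryEquiv e.toLinearEquiv.finrank_eq, fun u a => ?_⟩
  have h2 : ∀ (D : FDSub 𝒰) (u : U) (a : D), (.toLp 2 (u, a) : OSum U D) =
      .toLp 2 (u, 0) + .toLp 2 (0, a) := fun D u a => by
    rw [← WithLp.toLp_add, Prod.mk_add_mk, add_zero, zero_add]
  rw [h2, h2 B, map_add, map_add, hl]
  congr 1
  have h3 := congrArg h' (hk a)
  rw [h'.apply_symm_apply] at h3
  exact h3

variable [Fact (Module.rank ℝ 𝒰 = Cardinal.aleph0)]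

/-- Every isometry `f : U → V` extends to an isometric isomorphism `U ⊕ B ≅ V`, and every point of
the fibre of `γ_n(U, V)` over `f` comes from `ℝ^n ⊗ B`. -/
theorem exists_splitting (n : ℕ) (f : U →ₗᵢ[ℝ] V) :
    ∃ (B : FDSub 𝒰) (h : OSum U B ≃ₗᵢ[ℝ] V), resl h = f ∧
      ∀ x ∈ jetFib n f, ∃ y, tmap n (resr h) y = x := by
  obtain ⟨B, ⟨e⟩⟩ := FDSub.exists_iso (𝒰 := 𝒰) (coker f)
  let h : OSum U B ≃ₗᵢ[ℝ] V := (LinearIsometryEquiv.withLpProdCongr 2 f.equivRange e.symm).trans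
    (LinearMap.range f.toLinearMap).orthogonalDecomposition.symm
  have hh : ∀ u b, h (.toLp 2 (u, b)) = f u + e.symm b := fun u b => by
    simp [h]
  refine ⟨B, h, ?_, ?_⟩
  · refine LinearIsometry.ext fun u => ?_
    rw [resl_apply, hh]
    simp
  · rintro x ⟨t, rfl⟩
    refine ⟨tmap n e.toLinearIsometry t, ?_⟩
    rw [← tmap_comp]
    change _ = tmap n _ t
    congr 2
    refine LinearIsometry.ext fun v => ?_
    change resr h (e v) = v
    rw [resr_apply, hh]
    simp

end Splitting

/-! ### Jets as points of free modules -/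

section JetsFromSplittings

variable {𝒰 : Type u} [NormedAddCommGroup 𝒰] [InnerProductSpace ℝ 𝒰]
  {A B C D E U V W : FDSub 𝒰} {n : ℕ}

/-- The jet `(h|_U, (ℝ^n ⊗ h|_A) s)` of an isometric isomorphism `h : U ⊕ A ≅ V` and a point `s` of
the sphere `nS(A)`; the point at infinity gives the basepoint. -/
noncomputable def jetOf (h : OSum U A ≃ₗᵢ[ℝ] V) (s : (nS n 𝒰).und.obj A) : (jet 𝒰 n).Hom U V :=
  OnePoint.map (fun x : NT n A => (⟨(resl h, tmap n (resr h) x), resr_mem_jetFib h x⟩ :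
    Gamma n U V)) s

theorem jetOf_congr {h : OSum U A ≃ₗᵢ[ℝ] V} {h' : OSum U B ≃ₗᵢ[ℝ] V} (g : A ≃ₗᵢ[ℝ] B)
    (H : ∀ u a, h (.toLp 2 (u, a)) = h' (.toLp 2 (u, g a))) (s : (nS n 𝒰).und.obj A) :
    jetOf h s = jetOf h' ((nS n 𝒰).und.tr g s) := by
  induction s using nS_cases with
  | h0 => rfl
  | h x =>
    refine congrArg OnePoint.some (Subtype.ext (Prod.ext ?_ ?_))
    · refine LinearIsometry.ext fun u => ?_
      have := H u 0
      rwa [map_zero] at this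
    · change tmap n (resr h) x = tmap n (resr h') (tmap n g.toLinearIsometry x)
      rw [← tmap_comp]
      congr 2
      exact LinearIsometry.ext fun a => H 0 a

theorem continuous_jetOf : Continuous
    fun p : (OSum U A ≃ₗᵢ[ℝ] V) × OnePoint (NT n A) =>
      (jetOf p.1 p.2 : (jet 𝒰 n).Hom U V) := by
  refine continuous_opMap (φ := fun (h : OSum U A ≃ₗᵢ[ℝ] V) (x : NT n A) =>
    (⟨(resl h, tmap n (resr h) x), resr_mem_jetFib h x⟩ : Gamma n U V)) ?_ fun K _ hK => ?_
  · have h : Continuous fun p : (OSum U A ≃ₗᵢ[ℝ] V) × NT n A => p.1 := continuous_fst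
    exact Continuous.subtype_mk ((continuous_resl.comp h).prodMk
      ((continuous_resr.comp h).tmap continuous_snd)) _
  · obtain ⟨r, hr⟩ := bounded_gamma hK
    refine ⟨Metric.closedBall 0 r, Metric.isClosed_closedBall, isCompact_closedBall _ _,
      fun h x hx => ?_⟩
    have h1 : ‖tmap n (resr h) x‖ ≤ r := hr _ hx
    rw [mem_closedBall_zero_iff]
    rwa [LinearIsometry.norm_map] at h1

/-- Composition of jets is multiplication in `nS`: both add the two points in
`ℝ^n ⊗ (B ⊕ C)`. -/
theorem jet_comp_jetOf (h : OSum V C ≃ₗᵢ[ℝ] W) (k : OSum U B ≃ₗᵢ[ℝ] V) (e : OSum B C ≃ₗᵢ[ℝ] E)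
    (s : (nS n 𝒰).und.obj C) (r : (nS n 𝒰).und.obj B) :
    (jet 𝒰 n).comp (jetOf h s) (jetOf k r) =
      jetOf (assocIso k e h) ((nsMul n).app E (sgen e r s)) := by
  induction s using nS_cases with
  | h0 => rw [nsMul_pt_right]; rfl
  | h x =>
    induction r using nS_cases with
    | h0 => rw [nsMul_pt_left]; rfl
    | h y =>
      refine congrArg OnePoint.some (Subtype.ext (Prod.ext ?_ ?_))
      · refine LinearIsometry.ext fun u => ?_
        have h1 := assocIso_apply k e h u 0 0
        rw [show (WithLp.toLp 2 ((0 : B), (0 : C))) = 0 from rfl, map_zero] at h1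
        exact h1.symm
      · change tmap n (resr h) x + tmap n (resl h) (tmap n (resr k) y) =
          tmap n (resr (assocIso k e h)) (sumMap n e y x)
        rw [sumMap_eq, map_add, ← tmap_comp, ← tmap_comp, ← tmap_comp, add_comm]
        congr 3
        · exact LinearIsometry.ext fun b => (assocIso_apply k e h 0 b 0).symm
        · refine LinearIsometry.ext fun c => ?_
          have h1 := assocIso_apply k e h 0 0 c
          rw [show (WithLp.toLp 2 ((0 : U), (0 : B))) = 0 from rfl, map_zero] at h1
          exact h1.symm

theorem jet_smul_jetOf (σ : O n) (h : OSum U A ≃ₗᵢ[ℝ] V) (s : (nS n 𝒰).und.obj A) :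
    (jet 𝒰 n).smul σ (jetOf h s) = jetOf h ((nS n 𝒰).smul σ s) := by
  induction s using nS_cases with
  | h0 => rfl
  | h x => exact congrArg OnePoint.some (Subtype.ext (Prod.ext rfl (trot_tmap σ (resr h) x)))

theorem osum_refl_refl (h : OSum U A ≃ₗᵢ[ℝ] V) :
    (osum (.refl ℝ U) (.refl ℝ A)).trans h = h := oiso_ext fun _ _ => rfl

/-- The point `[h; id, s]` of `(U^* ∧ nS)(V)`. -/
noncomputable def freeCls (h : OSum U A ≃ₗᵢ[ℝ] V) (s : (nS n 𝒰).und.obj A) :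
    (smash (DSpace.repr (isoCat 𝒰) U) (nS n 𝒰).und).obj V :=
  sgen (X := DSpace.repr (isoCat 𝒰) U) h ((isoCat 𝒰).one U) s

theorem sgen_eq_freeCls (k : OSum A B ≃ₗᵢ[ℝ] V) (f : U ≃ₗᵢ[ℝ] A) (s : (nS n 𝒰).und.obj B) :
    sgen (X := DSpace.repr (isoCat 𝒰) U) k (Sum.inl f : (U ≃ₗᵢ[ℝ] A) ⊕ PUnit.{u + 1}) s =
      freeCls ((osum f (.refl ℝ B)).trans k) s := by
  have h1 := sgen_eq (X := DSpace.repr (isoCat 𝒰) U) (Y := (nS n 𝒰).und) f (.refl ℝ B)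
    ((osum f (.refl ℝ B)).trans k) k ((isoCat 𝒰).one U) s (fun _ _ => rfl)
  rw [ISpace.tr_refl] at h1
  exact h1.symm

theorem freeCls_congr {h : OSum U A ≃ₗᵢ[ℝ] V} {h' : OSum U B ≃ₗᵢ[ℝ] V} (g : A ≃ₗᵢ[ℝ] B)
    (H : ∀ u a, h (.toLp 2 (u, a)) = h' (.toLp 2 (u, g a))) (s : (nS n 𝒰).und.obj A) :
    freeCls h s = freeCls h' ((nS n 𝒰).und.tr g s) :=
  sgen_eq (X := DSpace.repr (isoCat 𝒰) U) (Y := (nS n 𝒰).und) (.refl ℝ U) g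
    h h' ((isoCat 𝒰).one U) s H

theorem freeCls_pt (h : OSum U A ≃ₗᵢ[ℝ] V) : freeCls h ((nS n 𝒰).und.obj A).pt =
    ((smash (DSpace.repr (isoCat 𝒰) U) (nS n 𝒰).und).obj V).pt :=
  Smash.gen_pt_right (X := DSpace.repr (isoCat 𝒰) U) (Y := (nS n 𝒰).und) h _

/-- The map `(U^* ∧ nS)(V) → 𝒥_n(U, V)`, `[h; f, s] ↦ (h|_A f, (ℝ^n ⊗ h|_B) s)` for `h : A ⊕ B ≅ V`
and `f : U ≅ A`. -/
noncomputable def freeToJet (n : ℕ) (U V : FDSub 𝒰) :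
    (smash (DSpace.repr (isoCat 𝒰) U) (nS n 𝒰).und).obj V → (jet 𝒰 n).Hom U V :=
  Smash.lift (X := DSpace.repr (isoCat 𝒰) U) (Y := (nS n 𝒰).und) ((jet 𝒰 n).Hom U V).pt
    (fun {A B} h (α : (U ≃ₗᵢ[ℝ] A) ⊕ PUnit.{u + 1}) s => match α with
      | Sum.inl f => jetOf ((osum f (.refl ℝ B)).trans h) s
      | Sum.inr _ => ((jet 𝒰 n).Hom U V).pt)
    (fun f g h α s => by
      rcases α with k | _
      · exact jetOf_congr g (fun _ _ => rfl) s
      · rfl)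
    (fun _ _ => rfl)
    (fun h α => by
      rcases α with k | _
      · rfl
      · rfl)

theorem freeToJet_pt : freeToJet n U V
    ((smash (DSpace.repr (isoCat 𝒰) U) (nS n 𝒰).und).obj V).pt = ((jet 𝒰 n).Hom U V).pt := rfl

theorem freeToJet_freeCls (h : OSum U A ≃ₗᵢ[ℝ] V) (s : (nS n 𝒰).und.obj A) :
    freeToJet n U V (freeCls h s) = jetOf h s := by
  change jetOf ((osum (.refl ℝ U) (.refl ℝ A)).trans h) s = _
  rw [osum_refl_refl]

theorem continuous_freeToJet : Continuous (freeToJet n U V) := by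
  refine Smash.continuous_dom (X := DSpace.repr (isoCat 𝒰) U) (Y := (nS n 𝒰).und) fun A B => ?_
  let Q := KProd (OSum A B ≃ₗᵢ[ℝ] V) ((nS n 𝒰).und.obj B)
  have hc : Continuous fun p : KProd ((U ≃ₗᵢ[ℝ] A) ⊕ PUnit.{u + 1}) Q =>
      (match p.1 with
      | Sum.inl f => jetOf ((osum f (.refl ℝ B)).trans p.2.1) p.2.2
      | Sum.inr _ => ((jet 𝒰 n).Hom U V).pt : (jet 𝒰 n).Hom U V) := by
    refine KProd.continuous_sum_left ?_ continuous_const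
    let P := KProd (U ≃ₗᵢ[ℝ] A) Q
    have h1 : Continuous fun p : P => osum p.1 (.refl ℝ B) := by
      refine continuous_lie_iff.2 fun v => ?_
      have h : Continuous fun p : P => p.1 v.fst := continuous_lie_eval.comp
        (KProd.continuous_fst.prodMk continuous_const)
      exact (WithLp.prod_continuous_toLp 2 A B).comp (h.prodMk continuous_const)
    have h2 : Continuous fun p : P => (p.2.1 : OSum A B ≃ₗᵢ[ℝ] V) :=
      KProd.continuous_fst.comp KProd.continuous_snd
    have h3 : Continuous fun p : P => (p.2.2 : OnePoint (NT n B)) :=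
      KProd.continuous_snd.comp KProd.continuous_snd
    exact continuous_jetOf.comp ((h1.lie_trans h2).prodMk h3)
  exact (hc.comp (KProd.continuous_mk (f := fun p : KProd (OSum A B ≃ₗᵢ[ℝ] V)
      (KProd ((DSpace.repr (isoCat 𝒰) U).obj A) ((nS n 𝒰).und.obj B)) => p.2.1)
    (KProd.continuous_fst.comp KProd.continuous_snd)
    (KProd.continuous_mk KProd.continuous_fst
      (KProd.continuous_snd.comp KProd.continuous_snd)))).congr fun p => by
        rcases p with ⟨h, α | α, s⟩ <;> rfl

/-- Every point of `(U^* ∧ nS)(V)` is the basepoint or of the form `[h; id, s]`. -/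
theorem free_cases {P : (smash (DSpace.repr (isoCat 𝒰) U) (nS n 𝒰).und).obj V → Prop}
    (h0 : P ((smash (DSpace.repr (isoCat 𝒰) U) (nS n 𝒰).und).obj V).pt)
    (h : ∀ (A : FDSub 𝒰) (h : OSum U A ≃ₗᵢ[ℝ] V) (s : (nS n 𝒰).und.obj A),
      P (freeCls h s)) : ∀ q, P q := by
  refine Smash.ind fun A B k α s => ?_
  rcases α with f | _
  · exact (congrArg P (sgen_eq_freeCls k f s)).mpr (h B _ s)
  · exact (congrArg P (Smash.gen_pt_left (X := DSpace.repr (isoCat 𝒰) U) (Y := (nS n 𝒰).und)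
      k s)).mpr h0

theorem freeToJet_injective : Function.Injective (freeToJet n U V) := by
  have key0 : ∀ (A : FDSub 𝒰) (h : OSum U A ≃ₗᵢ[ℝ] V) (s : (nS n 𝒰).und.obj A),
      jetOf h s = ((jet 𝒰 n).Hom U V).pt →
      freeCls h s =
        ((smash (DSpace.repr (isoCat 𝒰) U) (nS n 𝒰).und).obj V).pt := by
    intro A h s hs
    induction s using nS_cases with
    | h0 => exact freeCls_pt h
    | h x => exact absurd hs (OnePoint.coe_ne_infty _)
  intro q q'
  induction q using free_cases with
  | h0 =>
    induction q' using free_cases with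
    | h0 => exact fun _ => rfl
    | h A h s =>
      intro H
      rw [freeToJet_freeCls] at H
      exact (key0 A h s H.symm).symm
  | h A h s =>
    induction q' using free_cases with
    | h0 =>
      intro H
      rw [freeToJet_freeCls] at H
      exact key0 A h s H
    | h B h' t =>
      intro H
      rw [freeToJet_freeCls, freeToJet_freeCls] at H
      induction s using nS_cases with
      | h0 => rw [key0 A h _ rfl, key0 B h' t H.symm]
      | h x =>
        induction t using nS_cases with
        | h0 => exact absurd H (OnePoint.coe_ne_infty _)
        | h y =>
          have H' := congrArg Subtype.val (OnePoint.coe_injective H)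
          -- the two splittings of the same isometry differ by `g`, which carries `x` to `y`
          obtain ⟨g, hg⟩ := exists_iso_of_resl_eq h h' (congrArg Prod.fst H')
          have h2 : (nS n 𝒰).und.tr g (nSpt x) = nSpt y := by
            refine congrArg OnePoint.some ((tmap n (resr h')).injective ?_)
            refine Eq.trans ?_ (congrArg Prod.snd H')
            change tmap n (resr h') (tmap n g.toLinearIsometry x) = tmap n (resr h) x
            rw [← tmap_comp]
            congr 2
            exact LinearIsometry.ext fun a => (hg 0 a).symm
          rw [freeCls_congr g hg, h2]

/-- If `V ≅ U ⊕ B`, all complements are isometric to `B`, so `(U^* ∧ nS)(V)` is a quotient of the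
compact space `ℐ(U ⊕ B, V) × S^{nB}`; otherwise it is a point. -/
theorem compactSpace_free :
    CompactSpace ((smash (DSpace.repr (isoCat 𝒰) U) (nS n 𝒰).und).obj V) := by
  by_cases hB : ∃ B : FDSub 𝒰, Nonempty (OSum U B ≃ₗᵢ[ℝ] V)
  · obtain ⟨B, ⟨k⟩⟩ := hB
    let K := (OSum U B ≃ₗᵢ[ℝ] V) × OnePoint (NT n B)
    have : UCompactlyGeneratedSpace.{u} K := cg_compHaus (CompHaus.of K)
    have hc : Continuous fun p : K => (freeCls p.1 p.2 :
        (smash (DSpace.repr (isoCat 𝒰) U) (nS n 𝒰).und).obj V) :=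
      Continuous.sgen continuous_fst continuous_const continuous_snd
    refine Function.Surjective.compactSpace hc fun q => ?_
    induction q using free_cases with
    | h0 => exact ⟨(k, OnePoint.infty), freeCls_pt k⟩
    | h A h s =>
      obtain ⟨g⟩ := FDSub.nonempty_iso_of_osum h k
      exact ⟨(_, _), (freeCls_congr (h' := (osum (.refl ℝ U) g.symm).trans h) g
        (fun _ _ => by simp) s).symm⟩
  · have h0 : ∀ q, q = ((smash (DSpace.repr (isoCat 𝒰) U) (nS n 𝒰).und).obj V).pt := fun q => by
      induction q using free_cases with
      | h0 => rfl
      | h A h s => exact absurd ⟨A, ⟨h⟩⟩ hB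
    have : Subsingleton ((smash (DSpace.repr (isoCat 𝒰) U) (nS n 𝒰).und).obj V) :=
      ⟨fun p q => (h0 p).trans (h0 q).symm⟩
    infer_instance

variable [Fact (Module.rank ℝ 𝒰 = Cardinal.aleph0)]

theorem freeToJet_surjective : Function.Surjective (freeToJet n U V) := by
  intro α
  induction α using OnePoint.rec with
  | infty => exact ⟨_, freeToJet_pt⟩
  | coe p =>
    obtain ⟨⟨f, x⟩, hx⟩ := p
    obtain ⟨B, h, rfl, H⟩ := exists_splitting n f
    obtain ⟨y, rfl⟩ := H x hx
    exact ⟨_, freeToJet_freeCls h (nSpt y)⟩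

/-- The homeomorphism `(U^* ∧ nS)(V) ≅ 𝒥_n(U, V)`: a continuous bijection from a compact space to
a Hausdorff space. -/
noncomputable def freeHomeoJet (n : ℕ) (U V : FDSub 𝒰) :
    (smash (DSpace.repr (isoCat 𝒰) U) (nS n 𝒰).und).obj V ≃ₜ (jet 𝒰 n).Hom U V :=
  haveI := compactSpace_free (n := n) (U := U) (V := V)
  haveI : T2Space ((jet 𝒰 n).Hom U V) := inferInstanceAs (T2Space (OnePoint (Gamma n U V)))
  Continuous.homeoOfEquivCompactToT2
    (f := Equiv.ofBijective (freeToJet n U V) ⟨freeToJet_injective, freeToJet_surjective⟩)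
    continuous_freeToJet

theorem freeHomeoJet_freeCls (h : OSum U A ≃ₗᵢ[ℝ] V) (s : (nS n 𝒰).und.obj A) :
    freeHomeoJet n U V (freeCls h s) =
      jetOf h s := freeToJet_freeCls h s

theorem freeHomeoJet_pt : freeHomeoJet n U V
    ((smash (DSpace.repr (isoCat 𝒰) U) (nS n 𝒰).und).obj V).pt = ((jet 𝒰 n).Hom U V).pt :=
  freeToJet_pt

/-- Every jet is the basepoint or of the form `jetOf h s`. -/
theorem jet_cases {P : (jet 𝒰 n).Hom U V → Prop} (h0 : P ((jet 𝒰 n).Hom U V).pt)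
    (h : ∀ (A : FDSub 𝒰) (h : OSum U A ≃ₗᵢ[ℝ] V) (s : (nS n 𝒰).und.obj A), P (jetOf h s)) :
    ∀ α, P α := by
  intro α
  obtain ⟨q, rfl⟩ := (freeHomeoJet n U V).surjective α
  induction q using free_cases with
  | h0 => exact (congrArg P freeHomeoJet_pt).mpr h0
  | h A k s => exact (congrArg P (freeHomeoJet_freeCls k s)).mpr (h A k s)

end JetsFromSplittings

/-! ### The isomorphism of the jet category with the diagram category -/

section JetIso

variable {𝒰 : Type u} [NormedAddCommGroup 𝒰] [InnerProductSpace ℝ 𝒰]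
  [Fact (Module.rank ℝ 𝒰 = Cardinal.aleph0)] {n : ℕ} {A B C D E U V W : FDSub 𝒰}

/-- Evaluation at the canonical generator of `U^* ∧ nS`. -/
noncomputable def evalFree (M : IModule (nSMonoid 𝒰 n).toCommMonoidStr) (U : FDSub 𝒰) :
    IModule.mapSpace (freeMod n U).und M ≃ₜ M.X.obj U :=
  IModule.evalGen M U

theorem evalFree_pt (M : IModule (nSMonoid 𝒰 n).toCommMonoidStr) :
    evalFree M U (IModule.mapSpace (freeMod n U).und M).pt = (M.X.obj U).pt := rfl

theorem evalFree_mapComp (M N : IModule (nSMonoid 𝒰 n).toCommMonoidStr)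
    (φ : IModule.mapSpace (freeMod n U).und M) (f : M ⟶ N) :
    evalFree N U (IModule.mapComp φ f) = f.hom.app U (evalFree M U φ) := rfl

/-- The homeomorphism `𝒥_n(U, V) ≅ (U^* ∧ nS)(V) ≅ nS-mod(V^* ∧ nS, U^* ∧ nS)`. -/
noncomputable def jetHomeo (n : ℕ) (U V : FDSub 𝒰) :
    (jet 𝒰 n).Hom U V ≃ₜ (diagram 𝒰 n).Hom U V :=
  (freeHomeoJet n U V).symm.trans (evalFree (freeMod n U).und V).symm

theorem evalFree_jetHomeo (h : OSum U A ≃ₗᵢ[ℝ] V) (s : (nS n 𝒰).und.obj A) :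
    evalFree (freeMod n U).und V (jetHomeo n U V (jetOf h s)) = freeCls h s := by
  refine ((evalFree (freeMod n U).und V).apply_symm_apply _).trans ?_
  rw [← freeHomeoJet_freeCls]
  exact (freeHomeoJet n U V).symm_apply_apply _

theorem jetHomeo_pt :
    jetHomeo n U V ((jet 𝒰 n).Hom U V).pt = ((diagram 𝒰 n).Hom U V).pt := by
  refine (evalFree (freeMod n U).und V).injective ?_
  refine ((evalFree (freeMod n U).und V).apply_symm_apply _).trans ?_
  rw [← freeHomeoJet_pt]
  exact (freeHomeoJet n U V).symm_apply_apply _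

theorem hom_freeCls {M : IModule (nSMonoid 𝒰 n).toCommMonoidStr} (φ : (freeMod n U).und ⟶ M)
    (h : OSum U A ≃ₗᵢ[ℝ] V) (s : (nS n 𝒰).und.obj A) :
    φ.hom.app V (freeCls h s) = M.act.app V (sgen h (evalFree M U φ) s) := by
  have h1 := IModule.app_sgen_eq (m := (nSMonoid 𝒰 n).toCommMonoidStr) (M := M) φ h (.refl ℝ U) s
  rw [ISpace.tr_refl] at h1
  exact h1

/-- Under evaluation at the generators, precomposition with the module map of the jet `jetOf h s`
is the action of `s`. -/
theorem evalFree_jetHomeo_comp (M : IModule (nSMonoid 𝒰 n).toCommMonoidStr)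
    (φ : IModule.mapSpace (freeMod n U).und M) (h : OSum U A ≃ₗᵢ[ℝ] V)
    (s : (nS n 𝒰).und.obj A) :
    evalFree M V (IModule.mapComp (jetHomeo n U V (jetOf h s)) φ) =
      M.act.app V (sgen h (evalFree M U φ) s) := by
  refine Eq.trans ?_ (hom_freeCls φ h s)
  exact congrArg (IModule.Hom.hom φ |>.app V) (evalFree_jetHomeo h s)

theorem jetHomeo_one : jetHomeo n U U ((jet 𝒰 n).one U) = (diagram 𝒰 n).one U := by
  refine (evalFree (freeMod n U).und U).injective ?_
  have h1 : (jet 𝒰 n).one U = jetOf (ozero U) (nSpt 0) := by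
    refine congrArg OnePoint.some (Subtype.ext (Prod.ext ?_ (map_zero _).symm))
    exact LinearIsometry.ext fun a => rfl
  rw [h1, evalFree_jetHomeo]
  rfl

theorem jetHomeo_comp (β : (jet 𝒰 n).Hom V W) (α : (jet 𝒰 n).Hom U V) :
    jetHomeo n U W ((jet 𝒰 n).comp β α) =
      (diagram 𝒰 n).comp (jetHomeo n V W β) (jetHomeo n U V α) := by
  induction β using jet_cases with
  | h0 => rw [(jet 𝒰 n).pt_comp, jetHomeo_pt, jetHomeo_pt, (diagram 𝒰 n).pt_comp]
  | h C h s =>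
    induction α using jet_cases with
    | h0 => rw [(jet 𝒰 n).comp_pt, jetHomeo_pt, jetHomeo_pt, (diagram 𝒰 n).comp_pt]
    | h B k r =>
      refine (evalFree (freeMod n U).und W).injective ?_
      refine Eq.trans ?_ (evalFree_jetHomeo_comp (freeMod n U).und
        (jetHomeo n U V (jetOf k r)) h s).symm
      rw [evalFree_jetHomeo, jet_comp_jetOf h k (sumIso B C), evalFree_jetHomeo]
      exact (IModule.freeAct_sgen (X := DSpace.repr (isoCat 𝒰) U)
        (nSMonoid 𝒰 n).toCommMonoidStr h k (sumIso B C) ((isoCat 𝒰).one U) r s).symm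

theorem smul_freeGen (σ : O n) : (freeMod n U).X.smul σ (freeGen n U) = freeGen n U :=
  congrArg (freeCls (ozero U)) ((nSMonoid 𝒰 n).smul_one (FDSub.zero 𝒰) σ
    (Sum.inl (.refl ℝ _) : (FDSub.zero 𝒰 ≃ₗᵢ[ℝ] FDSub.zero 𝒰) ⊕ PUnit.{u + 1}))

theorem evalFree_conj (M : GIModule (nSMonoid 𝒰 n)) (σ : O n) (φ : (freeMod n U).und ⟶ M.und) :
    evalFree M.und U (GIModule.conj σ φ) = M.X.smul σ (evalFree M.und U φ) := by
  refine (GIModule.conj_app σ φ U (freeGen n U)).trans ?_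
  exact congrArg (fun z => M.X.smul σ (φ.hom.app U z)) (smul_freeGen σ⁻¹)

theorem jetHomeo_smul (σ : O n) (α : (jet 𝒰 n).Hom U V) :
    jetHomeo n U V ((jet 𝒰 n).smul σ α) = (diagram 𝒰 n).smul σ (jetHomeo n U V α) := by
  induction α using jet_cases with
  | h0 => rw [(jet 𝒰 n).smul_pt, jetHomeo_pt, (diagram 𝒰 n).smul_pt]
  | h A h s =>
    refine (evalFree (freeMod n U).und V).injective ?_
    refine Eq.trans ?_ (evalFree_conj (freeMod n U) σ (jetHomeo n U V (jetOf h s))).symm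
    rw [jet_smul_jetOf, evalFree_jetHomeo, evalFree_jetHomeo]
    rfl

/-- The isomorphism of `O(n)`-topological categories between the jet category and the diagram
category of `nS`. -/
noncomputable def jetIso (𝒰 : Type u) [NormedAddCommGroup 𝒰] [InnerProductSpace ℝ 𝒰]
    [Fact (Module.rank ℝ 𝒰 = Cardinal.aleph0)] (n : ℕ) :
    GTopCategory.Iso (jet 𝒰 n) (diagram 𝒰 n) where
  homeo := jetHomeo n
  map_pt _ _ := jetHomeo_pt
  map_one _ := jetHomeo_one
  map_comp := jetHomeo_comp
  map_smul := jetHomeo_smul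

end JetIso

/-! ### Modules as spaces over the jet category -/

section Modules

variable {𝒰 : Type u} [NormedAddCommGroup 𝒰] [InnerProductSpace ℝ 𝒰]
  [Fact (Module.rank ℝ 𝒰 = Cardinal.aleph0)] {n : ℕ} {A B C D E U V W : FDSub 𝒰}

/-- The `𝒥_n`-space `U ↦ nS-mod(U^* ∧ nS, M)` of a module `M`. -/
noncomputable def jetSpaceOf (M : IModule (nSMonoid 𝒰 n).toCommMonoidStr) :
    DSpace (jet 𝒰 n).toTopCategory where
  obj U := IModule.mapSpace (freeMod n U).und M
  map {U V} α φ := IModule.mapComp (jetHomeo n U V α) φ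
  continuous_map U V := IModule.continuous_mapSpace_comp.comp (KProd.continuous_mk
    ((jetHomeo n U V).continuous.comp KProd.continuous_fst) KProd.continuous_snd)
  map_pt _ := IModule.hom_ext' fun _ _ => rfl
  pt_map φ := by
    rw [jetHomeo_pt]
    exact IModule.hom_ext' fun W _ => φ.hom.app_pt W
  map_one φ := by
    rw [jetHomeo_one]
    exact Category.id_comp (obj := IModule (nSMonoid 𝒰 n).toCommMonoidStr) φ
  map_comp _ _ φ := by
    rw [jetHomeo_comp]
    exact Category.assoc (obj := IModule (nSMonoid 𝒰 n).toCommMonoidStr) _ _ φ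

/-- The functor `M ↦ (U ↦ nS-mod(U^* ∧ nS, M))` from `nS`-modules to `𝒥_n`-spaces. -/
noncomputable def jetFunctor (𝒰 : Type u) [NormedAddCommGroup 𝒰] [InnerProductSpace ℝ 𝒰]
    [Fact (Module.rank ℝ 𝒰 = Cardinal.aleph0)] (n : ℕ) :
    IModule (nSMonoid 𝒰 n).toCommMonoidStr ⥤ DSpace (jet 𝒰 n).toTopCategory where
  obj := jetSpaceOf
  map {M N} f :=
    { app := fun _ φ => IModule.mapComp φ f
      continuous_app := fun _ => IModule.continuous_mapSpace_comp.comp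
        (KProd.continuous_mk continuous_id
          (continuous_const (Y := IModule.mapSpace M N) (y := f)))
      app_pt := fun _ => IModule.hom_ext' fun W _ => f.hom.app_pt W
      naturality := fun _ φ =>
        Category.assoc (obj := IModule (nSMonoid 𝒰 n).toCommMonoidStr) _ φ f }
  map_id _ := DSpace.hom_ext fun _ φ =>
    Category.comp_id (obj := IModule (nSMonoid 𝒰 n).toCommMonoidStr) φ
  map_comp f g := DSpace.hom_ext fun _ φ =>
    (Category.assoc (obj := IModule (nSMonoid 𝒰 n).toCommMonoidStr) φ f g).symm

/-- The components of the module map that corresponds to a map of `𝒥_n`-spaces. -/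
noncomputable def preimageHom {M N : IModule (nSMonoid 𝒰 n).toCommMonoidStr}
    (g : jetSpaceOf M ⟶ jetSpaceOf N) (U : FDSub 𝒰) (x : M.X.obj U) : N.X.obj U :=
  evalFree N U (g.app U ((evalFree M U).symm x))

theorem preimageHom_evalFree {M N : IModule (nSMonoid 𝒰 n).toCommMonoidStr}
    (g : jetSpaceOf M ⟶ jetSpaceOf N) (φ : IModule.mapSpace (freeMod n U).und M) :
    preimageHom g U (evalFree M U φ) = evalFree N U (g.app U φ) := by
  rw [preimageHom, Homeomorph.symm_apply_apply]

/-- Since the action of `nS` on a module is the action of the jets on `nS-mod(U^* ∧ nS, -)`, maps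
of `𝒥_n`-spaces preserve it. -/
theorem preimageHom_act {M N : IModule (nSMonoid 𝒰 n).toCommMonoidStr}
    (g : jetSpaceOf M ⟶ jetSpaceOf N) (h : OSum U A ≃ₗᵢ[ℝ] V) (x : M.X.obj U)
    (s : (nS n 𝒰).und.obj A) :
    N.act.app V (sgen h (preimageHom g U x) s) =
      preimageHom g V (M.act.app V (sgen h x s)) := by
  obtain ⟨φ, rfl⟩ := (evalFree M U).surjective x
  have h1 : g.app V (IModule.mapComp (jetHomeo n U V (jetOf h s)) φ) =
    IModule.mapComp (jetHomeo n U V (jetOf h s)) (g.app U φ) := g.naturality (jetOf h s) φ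
  rw [← evalFree_jetHomeo_comp, preimageHom_evalFree, preimageHom_evalFree, h1]
  exact (evalFree_jetHomeo_comp N (g.app U φ) h s).symm

/-- The module map that corresponds to a map of `𝒥_n`-spaces. -/
noncomputable def modulePreimage {M N : IModule (nSMonoid 𝒰 n).toCommMonoidStr}
    (g : jetSpaceOf M ⟶ jetSpaceOf N) : M ⟶ N where
  hom := ISpace.homMk (preimageHom g)
    (fun U => (evalFree N U).continuous.comp ((g.continuous_app U).comp
      (evalFree M U).symm.continuous))
    (fun U => by
      have h1 : (evalFree M U).symm (M.X.obj U).pt =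
          (IModule.mapSpace (freeMod n U).und M).pt :=
        (evalFree M U).symm_apply_eq.2 (evalFree_pt M).symm
      exact (congrArg (fun y => evalFree N U (g.app U y)) h1).trans
        (congrArg (evalFree N U) (g.app_pt U)))
    (fun {U V} f x => by
      rw [IModule.tr_eq_act_one M, IModule.tr_eq_act_one N, preimageHom_act])
  comm := IModule.comm_of_apply fun h x s => preimageHom_act g h x s

theorem jetFunctor_map_modulePreimage {M N : IModule (nSMonoid 𝒰 n).toCommMonoidStr}
    (g : jetSpaceOf M ⟶ jetSpaceOf N) : (jetFunctor 𝒰 n).map (modulePreimage g) = g :=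
  DSpace.hom_ext fun U φ => (evalFree N U).injective (preimageHom_evalFree g φ)

/-- A module map is determined by its composites with the maps out of free modules, since
`evalFree` makes these the values of the map. -/
theorem jetFunctor_map_injective {M N : IModule (nSMonoid 𝒰 n).toCommMonoidStr} {f g : M ⟶ N}
    (H : ∀ (U : FDSub 𝒰) (φ : IModule.mapSpace (freeMod n U).und M),
      IModule.mapComp φ f = IModule.mapComp φ g) : f = g :=
  IModule.hom_ext' fun U x => by
    obtain ⟨φ, rfl⟩ := (evalFree M U).surjective x
    rw [← evalFree_mapComp, ← evalFree_mapComp, H]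

instance : (jetFunctor 𝒰 n).Full := ⟨fun g => ⟨modulePreimage g, jetFunctor_map_modulePreimage g⟩⟩

instance : (jetFunctor 𝒰 n).Faithful := ⟨fun {M N} _ _ h => jetFunctor_map_injective fun U φ =>
  congrArg (fun k : jetSpaceOf M ⟶ jetSpaceOf N => DSpace.Hom.app k U φ) h⟩

end Modules

/-! ### Spaces over the jet category as modules -/

/-- The isomorphism of `D`-spaces given by natural based homeomorphisms. -/
def DSpace.isoOfHomeo {Obj : Type u} {D : TopCategory Obj} {E F : DSpace D}
    (e : ∀ U, E.obj U ≃ₜ F.obj U) (hp : ∀ U, e U (E.obj U).pt = (F.obj U).pt)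
    (hn : ∀ {U V : Obj} (α : D.Hom U V) (x : E.obj U), e V (E.map α x) = F.map α (e U x)) :
    E ≅ F where
  hom :=
    { app := fun U => e U
      continuous_app := fun U => (e U).continuous
      app_pt := hp
      naturality := hn }
  inv :=
    { app := fun U => (e U).symm
      continuous_app := fun U => (e U).symm.continuous
      app_pt := fun U => (e U).symm_apply_eq.2 (hp U).symm
      naturality := fun α x => (e _).symm_apply_eq.2 (by
        rw [hn, Homeomorph.apply_symm_apply]) }
  hom_inv_id := DSpace.hom_ext fun U x => (e U).symm_apply_apply x
  inv_hom_id := DSpace.hom_ext fun U x => (e U).apply_symm_apply x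

/-- The isomorphism of equivariant `D`-spaces given by an equivariant isomorphism of the underlying
`D`-spaces. -/
def GDSpace.isoOfIso {G : Type} [Group G] [TopologicalSpace G] {Obj : Type u}
    {D : GTopCategory G Obj} {E F : GDSpace D} (e : E.toDSpace ≅ F.toDSpace)
    (hs : ∀ (U : Obj) (g : G) (x : E.obj U),
      e.hom.app U (E.smul g x) = F.smul g (e.hom.app U x)) : E ≅ F where
  hom := ⟨e.hom, hs⟩
  inv := ⟨e.inv, fun U g y => by
    have h1 : ∀ y : F.obj U, e.hom.app U (e.inv.app U y) = y := fun y =>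
      congrArg (fun k : F.toDSpace ⟶ F.toDSpace => k.app U y) e.inv_hom_id
    have h2 : ∀ x : E.obj U, e.inv.app U (e.hom.app U x) = x := fun x =>
      congrArg (fun k : E.toDSpace ⟶ E.toDSpace => k.app U x) e.hom_inv_id
    rw [← h2 (E.smul g (e.inv.app U y)), hs, h1]⟩
  hom_inv_id := GDSpace.hom_ext e.hom_inv_id
  inv_hom_id := GDSpace.hom_ext e.inv_hom_id

section IsometryJets

variable {𝒰 : Type u} [NormedAddCommGroup 𝒰] [InnerProductSpace ℝ 𝒰] {n : ℕ}
  {A B C D E U V W : FDSub 𝒰}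

/-- The jet `(f, 0)` of an isometric isomorphism `f`. -/
noncomputable def isoJet (n : ℕ) (f : U ≃ₗᵢ[ℝ] V) : (jet 𝒰 n).Hom U V :=
  jetPt f.toLinearIsometry 0 (zero_mem _)

theorem isoJet_trans (g : V ≃ₗᵢ[ℝ] W) (f : U ≃ₗᵢ[ℝ] V) :
    isoJet n (f.trans g) = (jet 𝒰 n).comp (isoJet n g) (isoJet n f) :=
  congrArg OnePoint.some (Subtype.ext (Prod.ext rfl
    (((zero_add _).trans (map_zero (tmap n g.toLinearIsometry))).symm)))

theorem jet_smul_isoJet (σ : O n) (f : U ≃ₗᵢ[ℝ] V) :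
    (jet 𝒰 n).smul σ (isoJet n f) = isoJet n f :=
  congrArg OnePoint.some (Subtype.ext (Prod.ext rfl (map_zero (trot σ))))

theorem continuous_isoJet : Continuous (isoJet n : (U ≃ₗᵢ[ℝ] V) → (jet 𝒰 n).Hom U V) :=
  OnePoint.continuous_coe.comp
    (Continuous.subtype_mk (continuous_toLI.prodMk continuous_const) _)

theorem isoJet_comp_jetOf (k : V ≃ₗᵢ[ℝ] W) (h : OSum U A ≃ₗᵢ[ℝ] V) (s : (nS n 𝒰).und.obj A) :
    (jet 𝒰 n).comp (isoJet n k) (jetOf h s) = jetOf (h.trans k) s := by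
  induction s using nS_cases with
  | h0 => rfl
  | h x =>
    refine congrArg OnePoint.some (Subtype.ext (Prod.ext rfl ?_))
    exact (zero_add _).trans (tmap_comp k.toLinearIsometry (resr h) x).symm

theorem jetOf_comp_isoJet (h : OSum V A ≃ₗᵢ[ℝ] W) (f : U ≃ₗᵢ[ℝ] V) (s : (nS n 𝒰).und.obj A) :
    (jet 𝒰 n).comp (jetOf h s) (isoJet n f) = jetOf ((osum f (.refl ℝ A)).trans h) s := by
  induction s using nS_cases with
  | h0 => rfl
  | h x =>
    refine congrArg OnePoint.some (Subtype.ext (Prod.ext ?_ ?_))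
    · exact LinearIsometry.ext fun u => rfl
    · have h1 : resr h = resr ((osum f (.refl ℝ A)).trans h) :=
        LinearIsometry.ext fun a => by simp [resr_apply]
      change tmap n (resr h) x + tmap n (resl h) 0 = _
      rw [map_zero, add_zero, h1]

theorem jetOf_zero (h : OSum U A ≃ₗᵢ[ℝ] V) (f : FDSub.zero 𝒰 ≃ₗᵢ[ℝ] A) :
    jetOf h (nSpt 0 : (nS n 𝒰).obj A) = isoJet n (unitIso h f) := by
  refine congrArg OnePoint.some (Subtype.ext (Prod.ext ?_ (map_zero _)))
  exact LinearIsometry.ext fun u => (unitIso_apply h f u).symm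

end IsometryJets

section JetSpaces

variable {𝒰 : Type u} [NormedAddCommGroup 𝒰] [InnerProductSpace ℝ 𝒰] {n : ℕ}
  {A B C D U V W : FDSub 𝒰}

/-- The underlying `ℐ`-space of a `𝒥_n`-space. -/
noncomputable def restrictIso (E : DSpace (jet 𝒰 n).toTopCategory) : ISpace 𝒰 :=
  ISpace.mk' E.obj (fun f x => E.map (isoJet n f) x)
    (fun U V => (E.continuous_map U V).comp (KProd.continuous_mk
      (continuous_isoJet.comp KProd.continuous_fst) KProd.continuous_snd))
    (fun f => E.map_pt (isoJet n f))
    (fun x => E.map_one x)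
    (fun g f x => (congrArg (E.map · x) (isoJet_trans g f)).trans (E.map_comp _ _ x))

/-- The action `[h; x, s] ↦ E(h|_U, (ℝ^n ⊗ h|_A) s) x` of `nS` on a `𝒥_n`-space. -/
noncomputable def jetAct (E : DSpace (jet 𝒰 n).toTopCategory) :
    smash (restrictIso E) (nS n 𝒰).und ⟶ restrictIso E :=
  ISpace.homMk
    (fun V => Smash.lift (X := restrictIso E) (Y := (nS n 𝒰).und) (E.obj V).pt
      (fun h x s => E.map (jetOf h s) x)
      (fun {A B A' B'} f g h x s => by
        refine Eq.trans ?_ (E.map_comp (jetOf h ((nS n 𝒰).und.tr g s)) (isoJet n f) x)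
        refine congrArg (E.map · x) ?_
        refine Eq.trans ?_ (jetOf_comp_isoJet h f ((nS n 𝒰).und.tr g s)).symm
        exact jetOf_congr g (fun _ _ => rfl) s)
      (fun h s => E.map_pt (jetOf h s))
      (fun h x => E.pt_map x))
    (fun V => Smash.continuous_dom (X := restrictIso E) (Y := (nS n 𝒰).und) fun A B => by
      let P := KProd (OSum A B ≃ₗᵢ[ℝ] V) (KProd ((restrictIso E).obj A) ((nS n 𝒰).und.obj B))
      have h1 : Continuous fun p : P => (p.1 : OSum A B ≃ₗᵢ[ℝ] V) := KProd.continuous_fst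
      have h2 : Continuous fun p : P => (p.2.1 : E.obj A) :=
        KProd.continuous_fst.comp KProd.continuous_snd
      have h3 : Continuous fun p : P => (p.2.2 : OnePoint (NT n B)) :=
        KProd.continuous_snd.comp KProd.continuous_snd
      exact (E.continuous_map A V).comp
        (KProd.continuous_mk (continuous_jetOf.comp (h1.prodMk h3)) h2))
    (fun _ => E.map_pt _)
    (fun {V W} k => Smash.ind (X := restrictIso E) (Y := (nS n 𝒰).und) fun A B h x s => by
      change E.map (jetOf (h.trans k) s) x = E.map (isoJet n k) (E.map (jetOf h s) x)
      rw [← isoJet_comp_jetOf]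
      exact E.map_comp _ _ x)

variable [Fact (Module.rank ℝ 𝒰 = Cardinal.aleph0)]

/-- The `nS`-module of a `𝒥_n`-space. -/
noncomputable def moduleOf (E : DSpace (jet 𝒰 n).toTopCategory) :
    IModule (nSMonoid 𝒰 n).toCommMonoidStr where
  X := restrictIso E
  act := jetAct E
  act_one := smash_hom_ext (X := restrictIso E) fun A B V h x f => by
    rcases f with f | _
    · exact congrArg (E.map · x) (jetOf_zero h f)
    · exact E.pt_map x
  act_mul := smash_hom_ext (X := smash (restrictIso E) (nS n 𝒰).und) fun D C V h q s => by
    revert q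
    refine Smash.ind (X := restrictIso E) (Y := (nS n 𝒰).und) fun A B k x r => ?_
    change E.map (jetOf h s) (E.map (jetOf k r) x) =
      E.map (jetOf (assocIso k (sumIso B C) h) ((nsMul n).app _ (sgen (sumIso B C) r s))) x
    rw [← jet_comp_jetOf]
    exact (E.map_comp _ _ x).symm

/-- The `𝒥_n`-space of the module of `E` is `E`, by evaluation at the generators. -/
noncomputable def jetSpaceOfModuleOf (E : DSpace (jet 𝒰 n).toTopCategory) :
    jetSpaceOf (moduleOf E) ≅ E :=
  DSpace.isoOfHomeo (E := jetSpaceOf (moduleOf E)) (F := E) (evalFree (moduleOf E))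
    (fun _ => rfl)
    (fun {U V} α φ => by
      induction α using jet_cases with
      | h0 =>
        rw [E.pt_map]
        exact congrArg (evalFree (moduleOf E) V) ((jetSpaceOf (moduleOf E)).pt_map φ)
      | h A h s => exact evalFree_jetHomeo_comp (moduleOf E) φ h s)

instance : (jetFunctor 𝒰 n).EssSurj := ⟨fun E => ⟨moduleOf E, ⟨jetSpaceOfModuleOf E⟩⟩⟩

instance : (jetFunctor 𝒰 n).IsEquivalence where

end JetSpaces

/-! ### The equivariant case -/

section Equivariance

variable {𝒰 : Type u} [NormedAddCommGroup 𝒰] [InnerProductSpace ℝ 𝒰]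
  [Fact (Module.rank ℝ 𝒰 = Cardinal.aleph0)] {n : ℕ} {A B C D U V W : FDSub 𝒰}

/-- The equivariant `𝒥_n`-space `U ↦ nS-mod(U^* ∧ nS, M)` of an equivariant module `M`. -/
noncomputable def gjetSpaceOf (M : GIModule (nSMonoid 𝒰 n)) : GDSpace (jet 𝒰 n) where
  toDSpace := jetSpaceOf M.und
  smul σ φ := GIModule.conj σ φ
  continuous_smul _ := GIModule.continuous_conj
  one_smul φ := GIModule.conj_one φ
  mul_smul σ τ φ := GIModule.conj_mul σ τ φ
  smul_pt _ σ := GIModule.conj_zeroHom σ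
  smul_map {U V} σ α φ := by
    refine (GIModule.conj_comp σ (jetHomeo n U V α) φ).trans ?_
    exact congrArg (fun β => IModule.mapComp β (GIModule.conj σ φ)) (jetHomeo_smul σ α).symm

theorem conj_comp_und {M N P : GIModule (nSMonoid 𝒰 n)} (σ : O n) (φ : P.und ⟶ M.und)
    (f : M ⟶ N) : GIModule.conj σ (φ ≫ GIModule.Hom.und f) =
      GIModule.conj σ φ ≫ GIModule.Hom.und f :=
  IModule.hom_ext' fun U x =>
    (GIModule.Hom.hom f |>.map_smul U σ (φ.hom.app U (P.X.smul σ⁻¹ x))).symm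

/-- The functor `M ↦ (U ↦ nS-mod(U^* ∧ nS, M))` from equivariant `nS`-modules to equivariant
`𝒥_n`-spaces. -/
noncomputable def gjetFunctor (𝒰 : Type u) [NormedAddCommGroup 𝒰] [InnerProductSpace ℝ 𝒰]
    [Fact (Module.rank ℝ 𝒰 = Cardinal.aleph0)] (n : ℕ) :
    GIModule (nSMonoid 𝒰 n) ⥤ GDSpace (jet 𝒰 n) where
  obj := gjetSpaceOf
  map f := ⟨(jetFunctor 𝒰 n).map (GIModule.Hom.und f), fun _ σ φ => (conj_comp_und σ φ f).symm⟩
  map_id M := GDSpace.hom_ext ((jetFunctor 𝒰 n).map_id M.und)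
  map_comp f g := GDSpace.hom_ext
    ((jetFunctor 𝒰 n).map_comp (GIModule.Hom.und f) (GIModule.Hom.und g))

theorem preimageHom_smul {M N : GIModule (nSMonoid 𝒰 n)} (g : gjetSpaceOf M ⟶ gjetSpaceOf N)
    (σ : O n) (x : M.X.obj U) :
    preimageHom g.toHom U (M.X.smul σ x) = N.X.smul σ (preimageHom g.toHom U x) := by
  obtain ⟨φ, rfl⟩ := (evalFree M.und U).surjective x
  have h1 : preimageHom g.toHom U (M.X.smul σ (evalFree M.und U φ)) =
      evalFree N.und U (g.toHom.app U (GIModule.conj σ φ)) :=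
    (congrArg (preimageHom g.toHom U) (evalFree_conj M σ φ).symm).trans
      (preimageHom_evalFree (M := M.und) (N := N.und) g.toHom (GIModule.conj σ φ))
  have h2 : N.X.smul σ (preimageHom g.toHom U (evalFree M.und U φ)) =
      N.X.smul σ (evalFree N.und U (g.toHom.app U φ)) :=
    congrArg (N.X.smul σ) (preimageHom_evalFree (M := M.und) (N := N.und) g.toHom φ)
  refine h1.trans (Eq.trans ?_ h2.symm)
  exact (congrArg (evalFree N.und U) (g.map_smul U σ φ)).trans
    (evalFree_conj N σ (g.toHom.app U φ))

instance : (gjetFunctor 𝒰 n).Full := ⟨fun g =>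
  ⟨⟨⟨(modulePreimage g.toHom).hom, fun _ σ x => preimageHom_smul g σ x⟩,
    (modulePreimage g.toHom).comm⟩,
    GDSpace.hom_ext (jetFunctor_map_modulePreimage g.toHom)⟩⟩

instance : (gjetFunctor 𝒰 n).Faithful := ⟨fun {_ _} f g h => by
  have h1 : GIModule.Hom.und f = GIModule.Hom.und g :=
    (jetFunctor 𝒰 n).map_injective (congrArg GDSpace.Hom.toHom h)
  exact GIModule.Hom.ext (GDSpace.hom_ext (congrArg IModule.Hom.hom h1))⟩

/-- The underlying equivariant `ℐ`-space of an equivariant `𝒥_n`-space. -/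
noncomputable def grestrictIso (E : GDSpace (jet 𝒰 n)) : GISpace (O n) 𝒰 where
  toDSpace := restrictIso E.toDSpace
  smul σ x := E.smul σ x
  continuous_smul U := E.continuous_smul U
  one_smul x := E.one_smul x
  mul_smul σ τ x := E.mul_smul σ τ x
  smul_pt U σ := E.smul_pt U σ
  smul_map {U V} σ α x := by
    rcases α with f | _
    · refine (E.smul_map σ (isoJet n f) x).trans ?_
      rw [jet_smul_isoJet]
      rfl
    · exact E.smul_pt V σ

/-- The equivariant `nS`-module of an equivariant `𝒥_n`-space. -/
noncomputable def gmoduleOf (E : GDSpace (jet 𝒰 n)) : GIModule (nSMonoid 𝒰 n) where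
  X := grestrictIso E
  act := ⟨jetAct E.toDSpace, fun V σ =>
    Smash.ind (X := restrictIso E.toDSpace) (Y := (nS n 𝒰).und) fun A B h x s => by
      change E.map (jetOf h ((nS n 𝒰).smul σ s)) (E.smul σ x) = E.smul σ (E.map (jetOf h s) x)
      rw [← jet_smul_jetOf]
      exact (E.smul_map σ (jetOf h s) x).symm⟩
  act_one := (moduleOf E.toDSpace).act_one
  act_mul := (moduleOf E.toDSpace).act_mul

instance : (gjetFunctor 𝒰 n).EssSurj := ⟨fun E => ⟨gmoduleOf E,
  ⟨GDSpace.isoOfIso (E := gjetSpaceOf (gmoduleOf E)) (jetSpaceOfModuleOf E.toDSpace)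
    fun _ σ φ => evalFree_conj (gmoduleOf E) σ φ⟩⟩⟩

instance : (gjetFunctor 𝒰 n).IsEquivalence where

end Equivariance

end OrthCalc

theorem mainTheorem12 {𝒰 : Type u} [NormedAddCommGroup 𝒰] [InnerProductSpace ℝ 𝒰]
    [Fact (Module.rank ℝ 𝒰 = Cardinal.aleph0)] (n : ℕ) :
    ∃ Φ : OrthCalc.GTopCategory.Iso (OrthCalc.jet 𝒰 n) (OrthCalc.diagram 𝒰 n),
      -- the isomorphism is induced by `(h, x) ↦ (h|_U, (ℝ^n ⊗ h) x)`
      (∀ (U V A : OrthCalc.FDSub 𝒰) (h : OrthCalc.OSum U A ≃ₗᵢ[ℝ] V) (x : OrthCalc.NT n A),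
        OrthCalc.diagramApp (Φ.homeo U V (OrthCalc.jetPt (OrthCalc.resl h)
            (OrthCalc.tmap n (OrthCalc.resr h) x) (OrthCalc.resr_mem_jetFib h x))) V
          (OrthCalc.freeGen n V) = OrthCalc.freePt h (.refl ℝ U) x) ∧
      -- `𝒥_n`-spaces are `nS`-modules in `ℐ`-spaces
      (∃ e : OrthCalc.DSpace (OrthCalc.jet 𝒰 n).toTopCategory ≌
            OrthCalc.IModule (OrthCalc.nSMonoid 𝒰 n).toCommMonoidStr,
        ∃ η : ∀ (M : OrthCalc.IModule (OrthCalc.nSMonoid 𝒰 n).toCommMonoidStr)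
            (U : OrthCalc.FDSub 𝒰), (e.inverse.obj M).obj U ≃ₜ
              OrthCalc.IModule.mapSpace (OrthCalc.freeMod n U).und M,
          (∀ M U, η M U ((e.inverse.obj M).obj U).pt =
            (OrthCalc.IModule.mapSpace (OrthCalc.freeMod n U).und M).pt) ∧
          (∀ M N (f : M ⟶ N) U x, η N U ((e.inverse.map f).app U x) =
            OrthCalc.IModule.mapComp (η M U x) f) ∧
          (∀ M U V (α : (OrthCalc.jet 𝒰 n).Hom U V) x, η M V ((e.inverse.obj M).map α x) =
            OrthCalc.IModule.mapComp (Φ.homeo U V α) (η M U x))) ∧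
      -- `O(n)`-equivariant `𝒥_n`-spaces are `nS`-modules in `O(n)`-equivariant `ℐ`-spaces
      (∃ e : OrthCalc.GDSpace (OrthCalc.jet 𝒰 n) ≌ OrthCalc.GIModule (OrthCalc.nSMonoid 𝒰 n),
        ∃ η : ∀ (M : OrthCalc.GIModule (OrthCalc.nSMonoid 𝒰 n)) (U : OrthCalc.FDSub 𝒰),
            (e.inverse.obj M).obj U ≃ₜ
              OrthCalc.IModule.mapSpace (OrthCalc.freeMod n U).und M.und,
          (∀ M U, η M U ((e.inverse.obj M).obj U).pt =
            (OrthCalc.IModule.mapSpace (OrthCalc.freeMod n U).und M.und).pt) ∧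
          (∀ M N (f : M ⟶ N) U x, η N U ((e.inverse.map f).toHom.app U x) =
            OrthCalc.IModule.mapComp (η M U x) (OrthCalc.GIModule.Hom.und f)) ∧
          (∀ M U V (α : (OrthCalc.jet 𝒰 n).Hom U V) x, η M V ((e.inverse.obj M).map α x) =
            OrthCalc.IModule.mapComp (Φ.homeo U V α) (η M U x)) ∧
          (∀ M U (σ : OrthCalc.O n) x, η M U ((e.inverse.obj M).smul σ x) =
            OrthCalc.GIModule.conj σ (η M U x))) := by
  refine ⟨OrthCalc.jetIso 𝒰 n, fun U V A h x => ?_, ?_, ?_⟩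
  · exact OrthCalc.evalFree_jetHomeo h (OrthCalc.nSpt x)
  -- the functors are defined by the spaces of module maps themselves, so `η` is the identity
  · refine ⟨(OrthCalc.jetFunctor 𝒰 n).asEquivalence.symm, fun M U => Homeomorph.refl _, ?_, ?_, ?_⟩
    · exact fun _ _ => rfl
    · exact fun _ _ _ _ _ => rfl
    · exact fun _ _ _ _ _ => rfl
  · refine ⟨(OrthCalc.gjetFunctor 𝒰 n).asEquivalence.symm, fun M U => Homeomorph.refl _,
      ?_, ?_, ?_, ?_⟩
    · exact fun _ _ => rfl
    · exact fun _ _ _ _ _ => rfl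
    · exact fun _ _ _ _ _ => rfl
    · exact fun _ _ _ _ => rfl
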